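/- Let $n\ge 2$. An oriented necklace with $n$ beads is a link $K_0\cup K_1\cup\dots\cup K_n$ in $\mathbb R^3$ such that: $K_0$ is an oriented Euclidean circle of radius $1$ centred at the origin $O$; each $K_i$ $(1\le i\le n)$ is a Euclidean circle of radius $r_i\in(0,\tfrac12)$ whose centre $O_i$ lies on $K_0$ and which lies in the plane that contains the line $OO_i$ and is perpendicular to the plane of $K_0$; and $r_i\ne r_j$ whenever $i\neq j$ and $O_i=O_j$. (The beads are oriented by $\mathrm{lk}(K_0,K_i)=+1$.) Let $\operatorname{Conf}\mathcal L_n$ be the space of oriented necklaces with unlabelled beads $\{K_1,\dots,K_n\}$, that is, the quotient by $\mathfrak S_n$ of the space of the data (oriented unit normal of $K_0$; $O_1,r_1,\dots,O_n,r_n$). Its base point $\mathcal L_n$ is the necklace whose core $K_0$ is the unit circle of the horizontal plane, oriented counterclockwise, and whose bead $K_i$ has radius $\tfrac14$ and centre $(\cos\theta_i,\sin\theta_i,0)$, $\theta_i=2\pi(i-1)/n$. Let $\mathcal L'_n=K_1\cup\dots\cup K_n\subset\mathcal L_n$ be the union of the beads and $*=(0,0,2)$, a point outside the ball of radius $\tfrac32$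 that contains all necklaces. Let $x_i\in\pi_1(\mathbb R^3\setminus\mathcal L'_n,*)$ be the meridian of $K_i$ represented by the loop $s\mapsto\bigl(\sin(\pi s)\cos\alpha(s),\ \sin(\pi s)\sin\alpha(s),\ 2-2\sin(\pi s)\bigr)$ with $\alpha(s)=\theta_i+(2s-1)\pi/n$, $s\in[0,1]$, which passes once through $K_i$ in the direction of $K_0$. Products in fundamental groups are read from left to right ($xy$ means first $x$, then $y$). A motion realizing a loop $\Gamma=(\Gamma(t))_{t\in[0,1]}$ in $\operatorname{Conf}\mathcal L_n$ based at $\mathcal L_n$ is a continuous path $(f_t)_{t\in[0,1]}$ of homeomorphisms of $\mathbb R^3$, supported in a common compact set, with $f_0=\mathrm{id}$, $f_t(*)=*$, such that for all $t$ the map $f_t$ carries the core of $\mathcal L_n$ onto the core of $\Gamma(t)$ and the union of the beads of $\mathcal L_n$ onto the union of the beads of $\Gamma(t)$. Then $\pi_1(\mathbb R^3\setminus\mathcal L'_n,*)$ is free on $x_1,\dots,x_n$, so that it is identified with the free group $F_n=\langle x_1,\dots,x_n\rangle$. An automorphism $\phi$ of $F_n$ is said to be induced by $g\in\pi_1(\operatorname{Conf}\mathcal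 L_n,\mathcal L_n)$ if $\phi=(f_1)_*$ for a motion $(f_t)$ realizing some loop that represents $g$. The automorphisms of $F_n$ induced by the elements of $\pi_1(\operatorname{Conf}\mathcal L_n,\mathcal L_n)$ are exactly the automorphisms $\phi$ of $F_n$ that satisfy both of the following conditions: 1. there are $w_1,\dots,w_n\in F_n$ and a permutation $\pi\in\mathfrak S_n$ with $\phi(x_i)=w_i\,x_{\pi(i)}\,w_i^{-1}$ for all $i=1,\dots,n$; 2. there is $w\in F_n$ with $\phi(x_1x_2\cdots x_n)=w\,x_1x_2\cdots x_n\,w^{-1}$. -/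

import Mathlib

noncomputable section

namespace Necklace

/-- Euclidean three-space. -/
abbrev E3 : Type := EuclideanSpace ℝ (Fin 3)

/-- The core circle `K₀`: the circle of centre `O` and radius `1` in the plane orthogonal to the
unit vector `u`, oriented by `u`. -/
def coreCircle (u : E3) : Set E3 := {p | ‖p‖ = 1 ∧ inner ℝ p u = 0}

/-- The Euclidean circle of centre `c` and radius `r` in the plane spanned by `c` and `u`, i.e. the
plane that contains the line `Oc` and is perpendicular to the plane of the core circle. -/
def beadCircle (u c : E3) (r : ℝ) : Set E3 :=
  {p | dist p c = r ∧ p ∈ Submodule.span ℝ ({c, u} : Set E3)}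

/-- The space of oriented necklaces with labelled beads `K₁, …, Kₙ`. A point `q` consists of the
unit normal `q.1` of the oriented core circle (the beads are then oriented by the convention
`lk(K₀, Kᵢ) = +1`) and of the centre `(q.2 i).1` and radius `(q.2 i).2` of each bead `Kᵢ`. The
centres lie on the core circle, the radii lie in `(0, 1/2)`, and distinct beads that have the same
centre have distinct radii. -/
def OrderedConf (n : ℕ) : Type :=
  {q : E3 × (Fin n → E3 × ℝ) // ‖q.1‖ = 1 ∧
    (∀ i, (q.2 i).1 ∈ coreCircle q.1 ∧ 0 < (q.2 i).2 ∧ (q.2 i).2 < 1 / 2) ∧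
    ∀ i j, i ≠ j → (q.2 i).1 = (q.2 j).1 → (q.2 i).2 ≠ (q.2 j).2}

instance (n : ℕ) : TopologicalSpace (OrderedConf n) :=
  inferInstanceAs (TopologicalSpace (Subtype _))

/-- The symmetric group acts on labelled necklaces by permuting the labels of the beads. -/
instance (n : ℕ) : MulAction (Equiv.Perm (Fin n)) (OrderedConf n) where
  smul σ q := ⟨(q.1.1, fun i => q.1.2 (σ⁻¹ i)), q.2.1, fun i => q.2.2.1 (σ⁻¹ i),
    fun i j hij => q.2.2.2 (σ⁻¹ i) (σ⁻¹ j) fun h => hij ((σ⁻¹).injective h)⟩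
  one_smul _ := rfl
  mul_smul σ τ q := by
    apply Subtype.ext
    refine Prod.ext rfl (funext fun i => ?_)
    change q.1.2 ((σ * τ)⁻¹ i) = q.1.2 (τ⁻¹ (σ⁻¹ i))
    rw [mul_inv_rev, Equiv.Perm.mul_apply]

/-- The configuration space of necklaces with `n` beads, with the quotient topology. -/
abbrev Conf (n : ℕ) : Type := MulAction.orbitRel.Quotient (Equiv.Perm (Fin n)) (OrderedConf n)

/-- The union `K₁ ∪ ⋯ ∪ Kₙ` of the beads of a labelled necklace. -/
def OrderedConf.beads {n : ℕ} (q : OrderedConf n) : Set E3 :=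
  ⋃ i, beadCircle q.1.1 (q.1.2 i).1 (q.1.2 i).2

/-- The core circle `K₀` of a necklace. -/
def core {n : ℕ} : Conf n → Set E3 :=
  Quotient.lift (fun q : OrderedConf n => coreCircle q.1.1) (by
    rintro _ b ⟨σ, rfl⟩
    rfl)

/-- The union `K₁ ∪ ⋯ ∪ Kₙ` of the beads of a necklace. -/
def beads {n : ℕ} : Conf n → Set E3 :=
  Quotient.lift OrderedConf.beads (by
    rintro _ b ⟨σ, rfl⟩
    exact (σ⁻¹).surjective.iUnion_comp
      (fun i => beadCircle b.1.1 (b.1.2 i).1 (b.1.2 i).2))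

/-- The point of space with cylindrical coordinates `(ρ, α, z)`. -/
def cyl (ρ α z : ℝ) : E3 := !₂[ρ * Real.cos α, ρ * Real.sin α, z]

/-- The base necklace with labelled beads: the core circle lies in the horizontal plane, and the
beads `K₁, …, Kₙ` have radius `1/4` and are evenly spaced, in this order, along the core circle. -/
def stdOrdered (n : ℕ) : OrderedConf n :=
  ⟨(cyl 0 0 1, fun i => (cyl 1 (2 * Real.pi * (i : ℕ) / n) 0, 1 / 4)), by
    refine ⟨?_, fun i => ⟨⟨?_, ?_⟩, by norm_num, by norm_num⟩, fun i j hij h => ?_⟩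
    · simp [cyl, EuclideanSpace.norm_eq, Fin.sum_univ_three]
    · simp [cyl, EuclideanSpace.norm_eq, Fin.sum_univ_three]
    · simp [cyl, PiLp.inner_apply, Fin.sum_univ_three]
    · exfalso
      apply hij
      have hn : (0 : ℝ) < n := by
        have := i.pos
        exact_mod_cast this
      have h0 := congrArg (fun p : E3 => p 0) h
      have h1 := congrArg (fun p : E3 => p 1) h
      simp only [cyl, one_mul, PiLp.toLp_apply, Matrix.cons_val_zero, Matrix.cons_val_one]
        at h0 h1
      obtain ⟨k, hk⟩ := Real.Angle.angle_eq_iff_two_pi_dvd_sub.1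
        (Real.Angle.cos_sin_inj h0 h1)
      have hk' : ((i : ℕ) : ℝ) - (j : ℕ) = n * k := by
        field_simp at hk
        linarith
      have hk2 : ((i : ℕ) : ℤ) - (j : ℕ) = n * k := by exact_mod_cast hk'
      have hi := i.isLt
      have hj := j.isLt
      have hk0 : k = 0 := by
        by_contra hne
        rcases lt_or_gt_of_ne hne with hlt | hlt
        · nlinarith
        · nlinarith
      apply Fin.ext
      rw [hk0] at hk2
      omega⟩

/-- The base necklace `Lₙ`. -/
def std (n : ℕ) : Conf n := Quotient.mk _ (stdOrdered n)

/-- The complement in space of the beads of the base necklace (its core circle is forgotten). -/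
abbrev Compl (n : ℕ) : Type := {p : E3 // p ∉ beads (std n)}

theorem mem_beads_std {n : ℕ} {ρ α z : ℝ} (hρ : 0 ≤ ρ) (h : cyl ρ α z ∈ beads (std n)) :
    ∃ i : Fin n, 0 < ρ ∧ (∃ k : ℤ, α - 2 * Real.pi * (i : ℕ) / n = 2 * Real.pi * k) ∧
      (ρ - 1) ^ 2 + z ^ 2 = 1 / 16 := by
  obtain ⟨i, hd, hs⟩ := Set.mem_iUnion.1 h
  refine ⟨i, ?_⟩
  change dist (cyl ρ α z) (cyl 1 (2 * Real.pi * (i : ℕ) / n) 0) = 1 / 4 at hd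
  change cyl ρ α z ∈
    Submodule.span ℝ ({cyl 1 (2 * Real.pi * (i : ℕ) / n) 0, cyl 0 0 1} : Set E3) at hs
  set β := 2 * Real.pi * (i : ℕ) / n with hβ
  obtain ⟨a, b, hab⟩ := Submodule.mem_span_pair.1 hs
  have h0 := congrArg (fun p : E3 => p 0) hab
  have h1 := congrArg (fun p : E3 => p 1) hab
  simp [cyl] at h0 h1
  have hd2 : (ρ * Real.cos α - Real.cos β) ^ 2 + (ρ * Real.sin α - Real.sin β) ^ 2 + z ^ 2
      = 1 / 16 := by
    have h2 : dist (cyl ρ α z) (cyl 1 β 0) ^ 2 = (1 / 4) ^ 2 := by rw [hd]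
    rw [EuclideanSpace.dist_eq, Real.sq_sqrt (by positivity)] at h2
    simp [cyl, Fin.sum_univ_three, Real.dist_eq, sq_abs] at h2
    rw [h2]; norm_num
  have hb := Real.sin_sq_add_cos_sq β
  have ha := Real.sin_sq_add_cos_sq α
  have had : (a - 1) ^ 2 + z ^ 2 = 1 / 16 := by
    rw [← h0, ← h1] at hd2
    have e : (a - 1) ^ 2 + z ^ 2 = (a * Real.cos β - Real.cos β) ^ 2 +
        (a * Real.sin β - Real.sin β) ^ 2 + z ^ 2 := by
      linear_combination (-(a - 1) ^ 2) * hb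
    rw [e, hd2]
  have hapos : 0 < a := by nlinarith [sq_nonneg z]
  have hsq : a ^ 2 = ρ ^ 2 := by
    linear_combination (-a ^ 2) * hb + ρ ^ 2 * ha
      + (a * Real.cos β + ρ * Real.cos α) * h0 + (a * Real.sin β + ρ * Real.sin α) * h1
  have hEq : a = ρ := (sq_eq_sq₀ hapos.le hρ).1 hsq
  subst hEq
  refine ⟨hapos, ?_, had⟩
  obtain ⟨k, hk⟩ := Real.Angle.angle_eq_iff_two_pi_dvd_sub.1
    (Real.Angle.cos_sin_inj (mul_left_cancel₀ hapos.ne' h0).symm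
      (mul_left_cancel₀ hapos.ne' h1).symm)
  exact ⟨k, hk⟩

/-- The base point `(0, 0, 2)`. It lies outside the ball of radius `3/2` about `O`, which contains
every necklace. -/
def basePoint : E3 := cyl 0 0 2

/-- The base point of the complement of the beads of the base necklace. -/
def base (n : ℕ) : Compl n :=
  ⟨basePoint, fun h => by
    obtain ⟨i, hi, -⟩ := mem_beads_std le_rfl h
    exact lt_irrefl _ hi⟩

/-- The meridian of the `i`-th bead (labels start at `0`) as a map from the unit interval to space.
It lies on the cone over the core circle of the base necklace with apex the base point. It leaves
the apex half-way between the `(i-1)`-st bead and the `i`-th one, turns in the direction of the core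
circle, passes through the `i`-th bead at its centre at time `1/2`, and returns to the apex half-way
between the `i`-th bead and the `(i+1)`-st one. -/
def meridianFun (n : ℕ) (i : Fin n) (s : ℝ) : E3 :=
  cyl (Real.sin (Real.pi * s)) (2 * Real.pi * (i : ℕ) / n + (2 * s - 1) * Real.pi / n)
    (2 - 2 * Real.sin (Real.pi * s))

theorem meridianFun_notMem (n : ℕ) (i : Fin n) (s : unitInterval) :
    meridianFun n i s ∉ beads (std n) := by
  intro h
  have hs0 : (0 : ℝ) ≤ s := s.2.1
  have hs1 : (s : ℝ) ≤ 1 := s.2.2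
  have hpi := Real.pi_pos
  have hsin : 0 ≤ Real.sin (Real.pi * s) :=
    Real.sin_nonneg_of_nonneg_of_le_pi (by positivity) (by nlinarith)
  obtain ⟨j, hpos, ⟨k, hk⟩, hc⟩ := mem_beads_std hsin h
  have hn : (0 : ℝ) < n := by
    have := i.pos
    exact_mod_cast this
  have hk1 : 2 * (s : ℝ) - 1 = 2 * (((n : ℤ) * k + (j : ℕ) - (i : ℕ) : ℤ) : ℝ) := by
    push_cast
    field_simp at hk
    linarith
  set m : ℤ := (n : ℤ) * k + (j : ℕ) - (i : ℕ) with hm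
  have hm0 : m = 0 := by
    have a1 : (m : ℝ) < 1 := by linarith
    have a2 : (-1 : ℝ) < m := by linarith
    have b1 : m < 1 := by exact_mod_cast a1
    have b2 : -1 < m := by exact_mod_cast a2
    omega
  have hs : (s : ℝ) = 1 / 2 := by
    rw [hm0] at hk1
    push_cast at hk1
    linarith
  have h1 : Real.sin (Real.pi * s) = 1 := by
    rw [hs, mul_one_div, Real.sin_pi_div_two]
  rw [h1] at hc
  norm_num at hc

/-- The meridian of the `i`-th bead, as a loop in the complement of the beads. -/
def meridianLoop (n : ℕ) (i : Fin n) : Path (base n) (base n) where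
  toFun s := ⟨meridianFun n i s, meridianFun_notMem n i s⟩
  continuous_toFun := by
    refine Continuous.subtype_mk ?_ _
    unfold meridianFun cyl
    refine (PiLp.continuous_toLp 2 _).comp (continuous_pi fun j => ?_)
    fin_cases j
    · simp
      fun_prop
    · simp
      fun_prop
    · simp
      fun_prop
  source' := by
    apply Subtype.ext
    simp [meridianFun, base, basePoint, cyl]
  target' := by
    apply Subtype.ext
    simp [meridianFun, base, basePoint, cyl]

/-- The homomorphism from `Fₙ` to the fundamental group of the complement of the beads that sends
the generator `xᵢ` to the class of the `i`-th meridian. Mathlib's product `p * q` in a fundamental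
group is "first `q`, then `p`"; passing to the opposite group gives the usual convention, in which a
word `x y` stands for "first `x`, then `y`". -/
def wordClass (n : ℕ) : FreeGroup (Fin n) →* (FundamentalGroup (Compl n) (base n))ᵐᵒᵖ :=
  FreeGroup.lift fun i =>
    MulOpposite.op (FundamentalGroup.fromPath (Path.Homotopic.Quotient.mk (meridianLoop n i)))

/-- A motion that realizes a loop `Γ` of necklaces: a path `f t` of compactly supported
homeomorphisms of space, starting at the identity and fixing the base point, such that `f t` carries
the base necklace to the necklace `Γ t` (core circle to core circle, beads to beads). -/
structure Motion {n : ℕ} (Γ : Path (std n) (std n)) where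
  /-- the homeomorphism at time `t` -/
  f : unitInterval → E3 ≃ₜ E3
  continuous_f : Continuous fun x : unitInterval × E3 => f x.1 x.2
  continuous_symm : Continuous fun x : unitInterval × E3 => (f x.1).symm x.2
  compact_support : ∃ K : Set E3, IsCompact K ∧ ∀ t, ∀ p ∉ K, f t p = p
  f_zero : f 0 = Homeomorph.refl E3
  f_base : ∀ t, f t basePoint = basePoint
  image_core : ∀ t, f t '' core (std n) = core (Γ t)
  image_beads : ∀ t, f t '' beads (std n) = beads (Γ t)

/-- The final homeomorphism of a motion, restricted to the complement of the beads. -/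
def Motion.endMap {n : ℕ} {Γ : Path (std n) (std n)} (F : Motion Γ) : C(Compl n, Compl n) where
  toFun p := ⟨F.f 1 p, fun h => p.2 (by
    have h1 := F.image_beads 1
    rw [Γ.target] at h1
    exact ((F.f 1).injective.mem_set_image).1 (h1.symm ▸ h : F.f 1 p.1 ∈ F.f 1 '' beads (std n)))⟩
  continuous_toFun := ((F.f 1).continuous.comp continuous_subtype_val).subtype_mk _

theorem Motion.endMap_base {n : ℕ} {Γ : Path (std n) (std n)} (F : Motion Γ) :
    F.endMap (base n) = base n :=
  Subtype.ext (F.f_base 1)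

/-- The homomorphism that the end of a motion induces on the fundamental group of the complement of
the beads. -/
def Motion.induced {n : ℕ} {Γ : Path (std n) (std n)} (F : Motion Γ) :
    FundamentalGroup (Compl n) (base n) →* FundamentalGroup (Compl n) (base n) :=
  FundamentalGroup.mapOfEq F.endMap F.endMap_base

/-- The automorphism `φ` of `Fₙ` is induced by the element `g` of the fundamental group of the
configuration space of necklaces: under the identification of `Fₙ` with the fundamental group of the
complement of the beads, `φ` is the map induced by the end of a motion that realizes a loop
representing `g`. -/
def Induces {n : ℕ} (g : FundamentalGroup (Conf n) (std n)) (φ : MulAut (FreeGroup (Fin n))) :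
    Prop :=
  ∃ Γ : Path (std n) (std n), FundamentalGroup.fromPath (Path.Homotopic.Quotient.mk Γ) = g ∧
    ∃ F : Motion Γ, ∀ w : FreeGroup (Fin n),
      (wordClass n (φ w)).unop = F.induced (wordClass n w).unop

end Necklace

end

noncomputable section

namespace Necklace

open Set Topology unitInterval

/-! ### Coordinates -/

/-! Identification with the free group. The beads of the base necklace bound disjoint flat discs in
half-planes about the vertical axis, and the signed crossings of a loop with these discs spell a
word. This is the monodromy of a covering with fibre Fₙ (`bundle`); along the loop of a word w it is
right multiplication by w (`transport_wordClass`), so the meridians are free. They also generate. An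
arbitrary loop is cut into small pieces, each closed up by chosen return paths; every closed piece
either avoids the half-planes near the beads, a star-shaped region, or lifts to a star-shaped set of
cylindrical coordinates. So it is trivial, or homotopic to a dip through one half-plane or to its
inverse, and a dip is a meridian or trivial (`isWord_of_lifts`, `isWord_dip`, `isWord_of_loop`).

Necessity. A motion pulls a family of loops that avoid the moving beads back to a free homotopy in
the fixed complement (`Motion.freelyHomotopic_of_family`), and freely homotopic loops represent
conjugate words. A loop of necklaces lifts to labelled necklaces (`exists_lift`), so a small loop
around the top of a bead can follow that bead; compactness provides one size that works at all times
(`exists_tube_notMem`). This gives the first condition (`Motion.exists_map_of`). The core circle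
never meets the beads and represents x₁⋯xₙ up to free homotopy, which gives the second
(`Motion.map_prod`).

Sufficiency. The induced automorphisms form a subgroup (`realizable`), and the automorphisms in
question are generated by the rotation and one half twist (`mem_of_conj_boundary`). This is Artin's
argument: if the boundary word is fixed, the total length of the conjugators can be lowered by half
twists until no shortening is possible; then the product of the conjugates is a word without
cancellation, and comparing its length with n forces every conjugator to be trivial
(`eq_one_of_prod_conj`). The case of a boundary word that is only conjugated follows because
conjugation by x₁ composed with the rotation fixes the boundary word, so inner automorphisms are
generated too.

Realization. The rotation of the necklace is damped away from it to have compact support. For the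
half twist, angle about the axis and distance from the core circle are coordinates in which a bead
is a single point of a strip; a planar half twist exchanging two such points lifts to space by
keeping the direction around the core circle, so that one bead shrinks and passes through the other.
The induced automorphism is read off from meridians that run along the core circle, which the twist
fixes: only the spoke between the two beads moves, and its image crosses the first disc forwards and
the second one backwards (`transport_twisted_spoke`, `Motion.isTwist_aut`). -/

@[simp] theorem cyl_zero (ρ α z : ℝ) : cyl ρ α z 0 = ρ * Real.cos α := rfl
@[simp] theorem cyl_one (ρ α z : ℝ) : cyl ρ α z 1 = ρ * Real.sin α := rfl
@[simp] theorem cyl_two (ρ α z : ℝ) : cyl ρ α z 2 = z := rfl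

theorem E3.ext {p q : E3} (h0 : p 0 = q 0) (h1 : p 1 = q 1) (h2 : p 2 = q 2) : p = q := by
  ext i
  fin_cases i <;> assumption

theorem continuous_cyl {X : Type*} [TopologicalSpace X] {f g h : X → ℝ} (hf : Continuous f)
    (hg : Continuous g) (hh : Continuous h) : Continuous fun x => cyl (f x) (g x) (h x) := by
  unfold cyl
  refine (PiLp.continuous_toLp 2 _).comp (continuous_pi fun j => ?_)
  fin_cases j
  · exact hf.mul (Real.continuous_cos.comp hg)
  · exact hf.mul (Real.continuous_sin.comp hg)
  · exact hh

@[fun_prop] theorem continuous_coord (i : Fin 3) : Continuous fun p : E3 => p i := by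
  fun_prop

/-- The coordinate of `p` in the horizontal direction of angle `θ`. -/
def rad (θ : ℝ) (p : E3) : ℝ := p 0 * Real.cos θ + p 1 * Real.sin θ

/-- The coordinate of `p` in the horizontal direction of angle `θ + π / 2`. -/
def tng (θ : ℝ) (p : E3) : ℝ := p 1 * Real.cos θ - p 0 * Real.sin θ

@[fun_prop] theorem continuous_rad (θ : ℝ) : Continuous (rad θ) := by
  unfold rad; fun_prop

@[fun_prop] theorem continuous_tng (θ : ℝ) : Continuous (tng θ) := by
  unfold tng; fun_prop

theorem rad_cyl (θ ρ α z : ℝ) : rad θ (cyl ρ α z) = ρ * Real.cos (α - θ) := by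
  simp [rad, Real.cos_sub]; ring

theorem tng_cyl (θ ρ α z : ℝ) : tng θ (cyl ρ α z) = ρ * Real.sin (α - θ) := by
  simp [tng, Real.sin_sub]; ring

theorem eq_cyl_of_tng_eq_zero {θ : ℝ} {p : E3} (h : tng θ p = 0) :
    p = cyl (rad θ p) θ (p 2) := by
  have := Real.sin_sq_add_cos_sq θ
  unfold tng at h
  refine E3.ext ?_ ?_ rfl
  · simp only [cyl_zero, rad]; linear_combination (-p 0) * this - Real.sin θ * h
  · simp only [cyl_one, rad]; linear_combination (-p 1) * this + Real.cos θ * h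

/-- The cross product. -/
def cross (u c : E3) : E3 :=
  !₂[u 1 * c 2 - u 2 * c 1, u 2 * c 0 - u 0 * c 2, u 0 * c 1 - u 1 * c 0]

@[simp] theorem cross_zero (u c : E3) : cross u c 0 = u 1 * c 2 - u 2 * c 1 := rfl
@[simp] theorem cross_one (u c : E3) : cross u c 1 = u 2 * c 0 - u 0 * c 2 := rfl
@[simp] theorem cross_two (u c : E3) : cross u c 2 = u 0 * c 1 - u 1 * c 0 := rfl

theorem inner_eq (p q : E3) : inner ℝ p q = p 0 * q 0 + p 1 * q 1 + p 2 * q 2 := by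
  simp [PiLp.inner_apply, Fin.sum_univ_three]; ring

theorem norm_sq_eq (p : E3) : ‖p‖ ^ 2 = p 0 ^ 2 + p 1 ^ 2 + p 2 ^ 2 := by
  rw [← real_inner_self_eq_norm_sq, inner_eq]; ring

/-- Since `cross u c` is normal to the plane of the bead, lying in the span becomes a single
equation. In this form the condition is visibly closed when the necklace varies. -/
theorem mem_beadCircle_iff {u c : E3} {r : ℝ} (hu : ‖u‖ = 1) (hc : ‖c‖ = 1)
    (huc : inner ℝ c u = 0) {p : E3} :
    p ∈ beadCircle u c r ↔ dist p c = r ∧ inner ℝ p (cross u c) = 0 := by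
  have hu2 := norm_sq_eq u
  have hc2 := norm_sq_eq c
  rw [hu] at hu2
  rw [hc] at hc2
  rw [inner_eq] at huc
  have hp : p ∈ Submodule.span ℝ ({c, u} : Set E3) ↔ inner ℝ p (cross u c) = 0 := by
    rw [Submodule.mem_span_pair]
    constructor
    · rintro ⟨a, b, rfl⟩
      simp only [inner_eq, cross_zero, cross_one, cross_two, PiLp.add_apply, PiLp.smul_apply,
        smul_eq_mul]
      ring
    · intro h
      refine ⟨inner ℝ p c, inner ℝ p u, ?_⟩
      simp only [inner_eq, cross_zero, cross_one, cross_two] at h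
      -- The expansion of `p` in the frame `cross u c`, `c`, `u`, as a polynomial identity.
      -- Orthonormality and the hypothesis specialise `U`, `C`, `D`, `V` to 1, 1, 0, 0.
      have key : ∀ U C D V : ℝ, U = u 0 ^ 2 + u 1 ^ 2 + u 2 ^ 2 →
          C = c 0 ^ 2 + c 1 ^ 2 + c 2 ^ 2 → D = c 0 * u 0 + c 1 * u 1 + c 2 * u 2 →
          V = p 0 * (u 1 * c 2 - u 2 * c 1) + p 1 * (u 2 * c 0 - u 0 * c 2)
            + p 2 * (u 0 * c 1 - u 1 * c 0) → ∀ i, (U * C - D ^ 2) * p i = V * cross u c i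
            + (inner ℝ p c) * (U * c i - D * u i) - (inner ℝ p u) * (D * c i - C * u i) := by
        rintro _ _ _ _ rfl rfl rfl rfl i
        fin_cases i <;> simp [inner_eq] <;> ring
      ext i
      have := key 1 1 0 0 (by linarith) (by linarith) huc.symm h.symm i
      simp only [PiLp.add_apply, PiLp.smul_apply, smul_eq_mul]
      linarith
  exact and_congr Iff.rfl hp

/-! ### The beads of the base necklace -/

/-- The angle of the centre of the `i`-th bead of the base necklace. -/
def ang (n : ℕ) (i : ℕ) : ℝ := 2 * Real.pi * (i : ℕ) / n

theorem mem_beadCircle_cyl {θ r : ℝ} {p : E3} (hr : 0 ≤ r) :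
    p ∈ beadCircle (cyl 0 0 1) (cyl 1 θ 0) r ↔
      tng θ p = 0 ∧ (rad θ p - 1) ^ 2 + p 2 ^ 2 = r ^ 2 := by
  have hθ := Real.sin_sq_add_cos_sq θ
  rw [mem_beadCircle_iff]
  · have h1 : inner ℝ p (cross (cyl 0 0 1) (cyl 1 θ 0)) = tng θ p := by
      simp [inner_eq, tng]; ring
    rw [h1, and_comm]
    refine and_congr_right fun h => ?_
    rw [← sq_eq_sq₀ dist_nonneg hr, dist_eq_norm, norm_sq_eq]
    have h2 : (p - cyl 1 θ 0) 0 ^ 2 + (p - cyl 1 θ 0) 1 ^ 2 + (p - cyl 1 θ 0) 2 ^ 2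
        = (rad θ p - 1) ^ 2 + p 2 ^ 2 + tng θ p ^ 2 := by
      simp only [PiLp.sub_apply, cyl_zero, cyl_one, cyl_two, rad, tng]
      linear_combination (1 - p 0 ^ 2 - p 1 ^ 2) * hθ
    rw [h2, h]; simp
  · rw [← sq_eq_sq₀ (norm_nonneg _) zero_le_one, norm_sq_eq]; simp
  · rw [← sq_eq_sq₀ (norm_nonneg _) zero_le_one, norm_sq_eq]
    simp only [cyl_zero, cyl_one, cyl_two]; linarith
  · simp [inner_eq]

theorem mem_beads_std_iff {n : ℕ} {p : E3} :
    p ∈ beads (std n) ↔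
      ∃ i : Fin n, tng (ang n i) p = 0 ∧ (rad (ang n i) p - 1) ^ 2 + p 2 ^ 2 = 1 / 16 := by
  have : p ∈ beads (std n) ↔
      ∃ i : Fin n, p ∈ beadCircle (cyl 0 0 1) (cyl 1 (ang n i) 0) (1 / 4) := mem_iUnion
  rw [this]
  refine exists_congr fun i => ?_
  rw [mem_beadCircle_cyl (by norm_num)]
  norm_num

/-- The closed disc in the half-plane of angle `θ` that is bounded by the bead centred at the
angle `θ`. -/
def cdisc (θ : ℝ) : Set E3 := {p | tng θ p = 0 ∧ (rad θ p - 1) ^ 2 + p 2 ^ 2 ≤ 1 / 16}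

theorem isClosed_cdisc (θ : ℝ) : IsClosed (cdisc θ) :=
  (isClosed_eq (continuous_tng _) continuous_const).inter
    (isClosed_le (((continuous_rad _).sub continuous_const).pow 2 |>.add
      ((continuous_coord 2).pow 2)) continuous_const)

theorem rad_pos_of_mem_cdisc {θ : ℝ} {p : E3} (h : p ∈ cdisc θ) : 0 < rad θ p := by
  nlinarith [h.2, sq_nonneg (p 2)]

theorem ang_sub_ne {n : ℕ} {i j : Fin n} (h : i ≠ j) (k : ℤ) :
    ang n i - ang n j ≠ 2 * Real.pi * k := by
  intro e
  apply h
  have hn : (0 : ℝ) < n := by exact_mod_cast i.pos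
  have hpi := Real.pi_pos
  have e1 : ((i : ℕ) : ℝ) - (j : ℕ) = n * k := by
    unfold ang at e; field_simp at e; linarith
  have e2 : ((i : ℕ) : ℤ) - (j : ℕ) = n * k := by exact_mod_cast e1
  have hi := i.isLt
  have hj := j.isLt
  have hk0 : k = 0 := by
    by_contra hne
    rcases lt_or_gt_of_ne hne with hlt | hlt <;> nlinarith
  rw [hk0] at e2
  exact Fin.ext (by omega)

/-- A point of a disc lies off the axis, on the positive side, so its angle is determined modulo 2π.
-/
theorem cdisc_disjoint {n : ℕ} {i j : Fin n} (h : i ≠ j) {p : E3} (hi : p ∈ cdisc (ang n i))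
    (hj : p ∈ cdisc (ang n j)) : False := by
  have hp := eq_cyl_of_tng_eq_zero hi.1
  have ri := rad_pos_of_mem_cdisc hi
  have rj := rad_pos_of_mem_cdisc hj
  have tj := hj.1
  rw [hp, rad_cyl] at rj
  rw [hp, tng_cyl] at tj
  have hs : Real.sin (ang n i - ang n j) = 0 := by
    rcases mul_eq_zero.1 tj with h | h
    · exact absurd h ri.ne'
    · exact h
  have hc : 0 < Real.cos (ang n i - ang n j) := pos_of_mul_pos_right rj ri.le
  have h1 : Real.cos (ang n i - ang n j) = 1 := by
    rcases Real.sin_eq_zero_iff_cos_eq.1 hs with h | h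
    · exact h
    · rw [h] at hc; linarith
  obtain ⟨k, hk⟩ := (Real.cos_eq_one_iff _).1 h1
  exact ang_sub_ne h k (by rw [← hk]; ring)

end Necklace

end

/-! ### Freeness of the meridians, by monodromy -/

noncomputable section

namespace Necklace

open Set Topology unitInterval

/-! ### A covering of the complement of the beads with fibre the free group -/

instance (n : ℕ) : TopologicalSpace (FreeGroup (Fin n)) := ⊥

instance (n : ℕ) : DiscreteTopology (FreeGroup (Fin n)) := ⟨rfl⟩

/-- The base sets of the charts of the covering: the complement of all closed discs bounded by the
beads, and, for each `k`, a neighbourhood of the `k`-th open disc. -/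
def chart (n : ℕ) : Option (Fin n) → Set (Compl n)
  | none => {p | ∀ j : Fin n, p.1 ∉ cdisc (ang n j)}
  | some k => {p | 0 < rad (ang n k) p.1 ∧
      (tng (ang n k) p.1 = 0 → (rad (ang n k) p.1 - 1) ^ 2 + p.1 2 ^ 2 < 1 / 16) ∧
      ∀ j : Fin n, j ≠ k → p.1 ∉ cdisc (ang n j)}

theorem isOpen_chart (n : ℕ) (i : Option (Fin n)) : IsOpen (chart n i) := by
  have hd : ∀ j : Fin n, IsOpen {p : Compl n | p.1 ∉ cdisc (ang n j)} := fun j =>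
    (isClosed_cdisc _).isOpen_compl.preimage continuous_subtype_val
  rcases i with _ | k
  · have : chart n none = ⋂ j : Fin n, {p : Compl n | p.1 ∉ cdisc (ang n j)} := by
      ext p; simp [chart]
    rw [this]
    exact isOpen_iInter_of_finite hd
  · have : chart n (some k) = {p : Compl n | 0 < rad (ang n k) p.1} ∩
        ({p : Compl n | tng (ang n k) p.1 = 0 ∧
          1 / 16 ≤ (rad (ang n k) p.1 - 1) ^ 2 + p.1 2 ^ 2}ᶜ ∩
        ⋂ j : {j : Fin n // j ≠ k}, {p : Compl n | p.1 ∉ cdisc (ang n j)}) := by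
      ext p; simp [chart]
    rw [this]
    have hr := (continuous_rad (ang n k)).comp (continuous_subtype_val (p := (· ∉ beads (std n))))
    have ht := (continuous_tng (ang n k)).comp (continuous_subtype_val (p := (· ∉ beads (std n))))
    have hz := (continuous_coord 2).comp (continuous_subtype_val (p := (· ∉ beads (std n))))
    refine (isOpen_lt continuous_const hr).inter (IsOpen.inter ?_ ?_)
    · exact ((isClosed_eq ht continuous_const).inter (isClosed_le continuous_const
        (((hr.sub continuous_const).pow 2).add (hz.pow 2)))).isOpen_compl
    · exact isOpen_iInter_of_finite fun j => hd j

/-- A point of a closed disc that is on no bead lies in the open disc, and disjointness keeps it off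
the other discs. -/
theorem exists_mem_chart {n : ℕ} (p : Compl n) : ∃ i, p ∈ chart n i := by
  by_cases h : p ∈ chart n none
  · exact ⟨_, h⟩
  · simp only [chart, mem_ofPred_eq, not_forall, not_not] at h
    obtain ⟨k, hk⟩ := h
    refine ⟨some k, rad_pos_of_mem_cdisc hk, fun _ => lt_of_le_of_ne hk.2 fun e => ?_,
      fun j hj hj' => cdisc_disjoint hj hj' hk⟩
    exact p.2 (mem_beads_std_iff.2 ⟨k, hk.1, e⟩)

/-- The change of coordinates from the `i`-th chart to the chart of the complement of the discs. -/
def jump (n : ℕ) : Option (Fin n) → Compl n → FreeGroup (Fin n)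
  | none => fun _ => 1
  | some k => fun p => if 0 < tng (ang n k) p.1 then FreeGroup.of k else 1

@[simp] theorem jump_none (n : ℕ) (p : Compl n) : jump n none p = 1 := rfl

/-- The `k`-th chart meets the plane `tng = 0` only inside the open disc, which every other chart
avoids. Hence the sign of `tng`, and with it the jump, is locally constant on overlaps although it
is not on the chart itself. -/
theorem tng_ne_zero_of_mem_chart {n : ℕ} {k : Fin n} {i : Option (Fin n)} (hi : i ≠ some k)
    {p : Compl n} (hp : p ∈ chart n i) (hk : p ∈ chart n (some k)) : tng (ang n k) p.1 ≠ 0 := by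
  intro h
  have hd : p.1 ∈ cdisc (ang n k) := ⟨h, (hk.2.1 h).le⟩
  rcases i with _ | j
  · exact hp k hd
  · exact hp.2.2 k (fun e => hi (by rw [e])) hd

theorem continuousOn_jump {n : ℕ} {k i : Option (Fin n)} (hi : i ≠ k) :
    ContinuousOn (jump n k) (chart n i ∩ chart n k) := by
  rcases k with _ | k
  · exact continuousOn_const
  · rintro p ⟨hp, hk⟩
    have ht := (continuous_tng (ang n k)).comp (continuous_subtype_val (p := (· ∉ beads (std n))))
    refine ContinuousAt.continuousWithinAt ?_
    rcases lt_or_gt_of_ne (tng_ne_zero_of_mem_chart hi hp hk) with h | h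
    · refine (continuousAt_const (y := (1 : FreeGroup (Fin n)))).congr ?_
      filter_upwards [(isOpen_lt ht continuous_const).mem_nhds h] with q hq
      exact (if_neg (not_lt.2 (le_of_lt hq))).symm
    · refine (continuousAt_const (y := FreeGroup.of k)).congr ?_
      filter_upwards [(isOpen_lt continuous_const ht).mem_nhds h] with q hq
      exact (if_pos hq).symm

open Classical in
/-- The chart used at the point `p`. -/
def chartAt (n : ℕ) (p : Compl n) : Option (Fin n) :=
  if p ∈ chart n none then none else (exists_mem_chart p).choose

/-- Giving priority to `none` fixes the meaning of the fibre coordinate off the discs, so that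
transports between such points compose without correction. -/
theorem chartAt_of_mem {n : ℕ} {p : Compl n} (h : p ∈ chart n none) : chartAt n p = none :=
  if_pos h

/-- The covering of the complement of the beads, as a fibre bundle with discrete fibre `Fₙ`. -/
def bundle (n : ℕ) : FiberBundleCore (Option (Fin n)) (Compl n) (FreeGroup (Fin n)) where
  baseSet := chart n
  isOpen_baseSet := isOpen_chart n
  indexAt := chartAt n
  mem_baseSet_at p := by
    unfold chartAt
    split_ifs with h
    · exact h
    · exact (exists_mem_chart p).choose_spec
  coordChange i j p g := g * (jump n i p * (jump n j p)⁻¹)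
  coordChange_self i p _ g := by simp
  continuousOn_coordChange i j := by
    by_cases hij : i = j
    · subst hij
      simp only [mul_inv_cancel, mul_one]
      exact continuousOn_snd
    · have h1 : ContinuousOn (fun p : Compl n × FreeGroup (Fin n) => jump n i p.1)
          ((chart n i ∩ chart n j) ×ˢ univ) :=
        (inter_comm (chart n j) _ ▸ continuousOn_jump (Ne.symm hij)).comp continuousOn_fst
          fun p hp => hp.1
      have h2 : ContinuousOn (fun p : Compl n × FreeGroup (Fin n) => jump n j p.1)
          ((chart n i ∩ chart n j) ×ˢ univ) :=
        (continuousOn_jump hij).comp continuousOn_fst fun p hp => hp.1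
      have hm : Continuous fun t : FreeGroup (Fin n) × FreeGroup (Fin n) × FreeGroup (Fin n) =>
          t.1 * (t.2.1 * t.2.2⁻¹) := continuous_of_discreteTopology
      exact hm.comp_continuousOn (continuousOn_snd.prodMk (h1.prodMk h2))
  coordChange_comp i j k p _ g := by group

theorem isCoveringMap_bundle (n : ℕ) : IsCoveringMap (bundle n).proj :=
  IsFiberBundle.isCoveringMap fun p =>
    ⟨(bundle n).localTriv ((bundle n).indexAt p), (bundle n).mem_baseSet_at p⟩

/-- The monodromy of the covering along a class of paths. -/
def transport {n : ℕ} {x y : Compl n} (γ : Path.Homotopic.Quotient x y) (g : FreeGroup (Fin n)) :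
    FreeGroup (Fin n) :=
  ((isCoveringMap_bundle n).monodromy γ ⟨⟨x, g⟩, rfl⟩).1.2

theorem transport_refl {n : ℕ} {x : Compl n} (g : FreeGroup (Fin n)) :
    transport (Path.Homotopic.Quotient.refl x) g = g := by
  unfold transport
  rw [(isCoveringMap_bundle n).monodromy_refl]; rfl

theorem transport_trans {n : ℕ} {x y z : Compl n} (γ : Path.Homotopic.Quotient x y)
    (γ' : Path.Homotopic.Quotient y z) (g : FreeGroup (Fin n)) :
    transport (γ.trans γ') g = transport γ' (transport γ g) := by
  unfold transport
  rw [(isCoveringMap_bundle n).monodromy_trans_apply]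
  have : ∀ e : (bundle n).proj ⁻¹' {y}, e = ⟨⟨y, e.1.2⟩, rfl⟩ := by
    rintro ⟨⟨a, b⟩, rfl⟩; rfl
  conv_lhs => rw [this ((isCoveringMap_bundle n).monodromy γ _)]

theorem transport_cast {n : ℕ} {x y x' y' : Compl n} (γ : Path.Homotopic.Quotient x y)
    (hx : x' = x) (hy : y' = y) (g : FreeGroup (Fin n)) :
    transport (γ.cast hx hy) g = transport γ g := by
  subst hx hy; simp

/-- The lift is constant in the coordinates of the `i`-th chart; the two jumps translate to and from
the chart of the complement of the discs at the ends. -/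
theorem transport_of_mem_chart {n : ℕ} {x y : Compl n} (γ : Path x y) (i : Option (Fin n))
    (h : ∀ s, γ s ∈ chart n i) (hx : x ∈ chart n none) (hy : y ∈ chart n none)
    (g : FreeGroup (Fin n)) :
    transport (.mk γ) g = g * (jump n i x)⁻¹ * jump n i y := by
  set T := (bundle n).localTriv i with hT
  have hmem : ∀ s, (γ s, g * (jump n i x)⁻¹) ∈ T.target := fun s => by
    rw [T.mem_target]; exact h s
  have hcont : Continuous fun s => T.invFun (γ s, g * (jump n i x)⁻¹) := by
    rw [← continuousOn_univ]
    exact T.continuousOn_invFun.comp (γ.continuous.prodMk continuous_const).continuousOn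
      fun s _ => hmem s
  have hval : ∀ s, T.invFun (γ s, g * (jump n i x)⁻¹) =
      ⟨γ s, g * (jump n i x)⁻¹ * (jump n i (γ s) * (jump n (chartAt n (γ s)) (γ s))⁻¹)⟩ :=
    fun s => rfl
  have h0 : T.invFun (γ 0, g * (jump n i x)⁻¹) = ⟨x, g⟩ := by
    rw [hval, γ.source, chartAt_of_mem hx]; simp
  have hl : (⟨_, hcont⟩ : C(I, (bundle n).TotalSpace)) =
      (isCoveringMap_bundle n).liftPath γ ⟨x, g⟩ γ.source := by
    rw [(isCoveringMap_bundle n).eq_liftPath_iff']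
    exact ⟨rfl, h0⟩
  have h1 := congrArg (fun f : C(I, (bundle n).TotalSpace) => (f 1).2) hl
  change _ = transport (.mk γ) g at h1
  rw [← h1]
  change (T.invFun (γ 1, g * (jump n i x)⁻¹)).2 = _
  rw [hval, γ.target, chartAt_of_mem hy]
  simp only [jump_none, inv_one, mul_one]
  rfl

theorem transport_subpath_comp {n : ℕ} {x y : Compl n} (γ : Path x y) (r s t : I)
    (g : FreeGroup (Fin n)) :
    transport (.mk (γ.subpath r t)) g =
      transport (.mk (γ.subpath s t)) (transport (.mk (γ.subpath r s)) g) := by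
  rw [← transport_trans, ← Path.Homotopic.Quotient.mk_trans]
  congr 1
  exact (Path.Homotopic.Quotient.eq.2 ⟨Path.Homotopy.subpathTransSubpath γ r s t⟩).symm

theorem transport_subpath_zero_one {n : ℕ} {x y : Compl n} (γ : Path x y)
    (g : FreeGroup (Fin n)) :
    transport (.mk (γ.subpath 0 1)) g = transport (.mk γ) g := by
  rw [Path.subpath_zero_one, Path.Homotopic.Quotient.mk_cast, transport_cast]

theorem subpath_mem {X : Type*} [TopologicalSpace X] {x y : X} (γ : Path x y) {s t : I}
    (hst : s ≤ t) {S : Set X} (h : ∀ r ∈ Icc s t, γ r ∈ S) (r : I) : γ.subpath s t r ∈ S :=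
  h _ ⟨Icc.le_convexComb hst r, Icc.convexComb_le hst r⟩

theorem transport_subpath_of_mem_chart {n : ℕ} {x y : Compl n} (γ : Path x y)
    (i : Option (Fin n)) {s t : I} (hst : s ≤ t) (h : ∀ r ∈ Icc s t, γ r ∈ chart n i)
    (hx : γ s ∈ chart n none) (hy : γ t ∈ chart n none) (g : FreeGroup (Fin n)) :
    transport (.mk (γ.subpath s t)) g = g * (jump n i (γ s))⁻¹ * jump n i (γ t) :=
  transport_of_mem_chart _ i (subpath_mem γ hst h) hx hy g

theorem transport_subpath_none {n : ℕ} {x y : Compl n} (γ : Path x y) {s t : I} (hst : s ≤ t)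
    (h : ∀ r ∈ Icc s t, γ r ∈ chart n none) (g : FreeGroup (Fin n)) :
    transport (.mk (γ.subpath s t)) g = g := by
  rw [transport_subpath_of_mem_chart γ none hst h (h _ ⟨le_rfl, hst⟩) (h _ ⟨hst, le_rfl⟩)]
  simp

end Necklace

end

noncomputable section

namespace Necklace

open Set Topology unitInterval

/-! ### Transport along paths given in cylindrical coordinates -/

theorem of_cyl_mem_cdisc {ρ α z θ : ℝ} (hρ : 0 ≤ ρ) (h : cyl ρ α z ∈ cdisc θ) :
    (∃ k : ℤ, α - θ = 2 * Real.pi * k) ∧ (ρ - 1) ^ 2 + z ^ 2 ≤ 1 / 16 := by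
  have hr := rad_pos_of_mem_cdisc h
  obtain ⟨ht, hd⟩ := h
  rw [rad_cyl] at hr hd
  rw [tng_cyl] at ht
  have hρ' : 0 < ρ := lt_of_le_of_ne hρ fun e => by rw [← e] at hr; simp at hr
  have hc : 0 < Real.cos (α - θ) := pos_of_mul_pos_right hr hρ
  have h1 : Real.cos (α - θ) = 1 := by
    rcases Real.sin_eq_zero_iff_cos_eq.1 ((mul_eq_zero.1 ht).resolve_left hρ'.ne') with h | h
    · exact h
    · rw [h] at hc; linarith
  rw [h1, mul_one] at hd
  obtain ⟨k, hk⟩ := (Real.cos_eq_one_iff _).1 h1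
  exact ⟨⟨k, by rw [← hk]; ring⟩, hd⟩

theorem mem_chart_none_of_lt {n : ℕ} {p : Compl n} {ρ α z : ℝ} (hp : p.1 = cyl ρ α z)
    (hρ : 0 ≤ ρ) (h : 1 / 16 < (ρ - 1) ^ 2 + z ^ 2) : p ∈ chart n none := fun j hj => by
  rw [hp] at hj
  exact absurd (of_cyl_mem_cdisc hρ hj).2 (not_le.2 h)

theorem mem_chart_none_of_ne {n : ℕ} {p : Compl n} {ρ α z : ℝ} (hp : p.1 = cyl ρ α z)
    (hρ : 0 ≤ ρ) (h : ∀ (j : Fin n) (k : ℤ), α - ang n j ≠ 2 * Real.pi * k) :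
    p ∈ chart n none := fun j hj => by
  rw [hp] at hj
  obtain ⟨⟨k, hk⟩, -⟩ := of_cyl_mem_cdisc hρ hj
  exact h j k hk

/-- Modulo 2π the bead angles form a lattice of step 2π/n, so a bead angle at distance less than one
step from another coincides with it. -/
theorem ang_unique {n : ℕ} {k j : Fin n} {α : ℝ} (h : |α - ang n k| < 2 * Real.pi / n) {m : ℤ}
    (hm : α - ang n j = 2 * Real.pi * m) : j = k ∧ α = ang n k := by
  have hn : (0 : ℝ) < n := by exact_mod_cast k.pos
  have hpi := Real.pi_pos
  have e : α - ang n k = 2 * Real.pi / n * (((j : ℕ) - (k : ℕ) + n * m : ℤ) : ℝ) := by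
    have e2 : α - ang n k = 2 * Real.pi * m + ang n j - ang n k := by linarith
    rw [e2]; unfold ang; push_cast; field_simp; ring
  rw [e, abs_mul, abs_of_pos (by positivity), mul_lt_iff_lt_one_right (by positivity)] at h
  have h0 : ((j : ℕ) : ℤ) - (k : ℕ) + n * m = 0 := by
    rw [← Int.cast_abs] at h
    exact Int.abs_lt_one_iff.1 (by exact_mod_cast h)
  rw [h0] at e
  have hj := j.isLt
  have hk := k.isLt
  have hm0 : m = 0 := by
    by_contra hne
    rcases lt_or_gt_of_ne hne with hlt | hlt <;> nlinarith
  rw [hm0] at h0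
  refine ⟨Fin.ext (by omega), ?_⟩
  simp at e; linarith

theorem two_pi_div_le {n : ℕ} (hn : 2 ≤ n) : Real.pi / n ≤ Real.pi / 2 := by
  have : (2 : ℝ) ≤ n := by exact_mod_cast hn
  have hpi := Real.pi_pos
  exact div_le_div_of_nonneg_left hpi.le (by norm_num) this

/-- With at least two beads the sector has half-width at most π/2, hence lies in the open half-space
`0 < rad`. -/
theorem mem_chart_some {n : ℕ} (hn : 2 ≤ n) {k : Fin n} {p : Compl n} {ρ α z : ℝ}
    (hp : p.1 = cyl ρ α z) (hρ : 0 < ρ) (hα : |α - ang n k| < Real.pi / n)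
    (h : α = ang n k → (ρ - 1) ^ 2 + z ^ 2 < 1 / 16) : p ∈ chart n (some k) := by
  have hn2 := two_pi_div_le hn
  have hpi := Real.pi_pos
  obtain ⟨h1, h2⟩ := abs_lt.1 hα
  have hc : 0 < Real.cos (α - ang n k) :=
    Real.cos_pos_of_mem_Ioo ⟨by linarith, by linarith⟩
  refine ⟨?_, fun ht => ?_, fun j hj hd => ?_⟩
  · rw [hp, rad_cyl]; positivity
  · rw [hp, tng_cyl] at ht
    have hs := (mul_eq_zero.1 ht).resolve_left hρ.ne'
    rw [Real.sin_eq_zero_iff_of_lt_of_lt (by linarith) (by linarith)] at hs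
    rw [hp, rad_cyl, hs, Real.cos_zero, mul_one]
    exact h (by linarith)
  · rw [hp] at hd
    obtain ⟨⟨m, hm⟩, -⟩ := of_cyl_mem_cdisc hρ.le hd
    refine hj (ang_unique (lt_of_lt_of_le hα ?_) hm).1
    have : 0 ≤ Real.pi / n := by positivity
    rw [mul_div_assoc]; linarith

/-- The change of coordinates at the angle `α` across the `k`-th disc. -/
def side (n : ℕ) (k : Fin n) (α : ℝ) : FreeGroup (Fin n) :=
  if ang n k < α then FreeGroup.of k else 1

theorem side_of_lt {n : ℕ} {k : Fin n} {α : ℝ} (h : ang n k < α) :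
    side n k α = FreeGroup.of k := if_pos h

theorem side_of_gt {n : ℕ} {k : Fin n} {α : ℝ} (h : α < ang n k) :
    side n k α = 1 := if_neg (not_lt.2 h.le)

theorem jump_some {n : ℕ} (hn : 2 ≤ n) {k : Fin n} {p : Compl n} {ρ α z : ℝ}
    (hp : p.1 = cyl ρ α z) (hρ : 0 < ρ) (hα : |α - ang n k| < Real.pi / n) :
    jump n (some k) p = side n k α := by
  have hn2 := two_pi_div_le hn
  have hpi := Real.pi_pos
  obtain ⟨h1, h2⟩ := abs_lt.1 hα
  change (if 0 < tng (ang n k) p.1 then _ else _) = _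
  unfold side
  rw [hp, tng_cyl]
  congr 1
  rw [eq_iff_iff, mul_pos_iff_of_pos_left hρ]
  constructor
  · intro h
    by_contra hc
    exact absurd h (not_lt.2 (Real.sin_nonpos_of_nonpos_of_neg_pi_le (by linarith) (by linarith)))
  · intro h
    exact Real.sin_pos_of_pos_of_lt_pi (by linarith) (by linarith)

theorem transport_subpath_some {n : ℕ} (hn : 2 ≤ n) {x y : Compl n} (γ : Path x y) {s t : I}
    (hst : s ≤ t) (k : Fin n) {ρ α z : I → ℝ} (hγ : ∀ r, (γ r).1 = cyl (ρ r) (α r) (z r))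
    (hρ : ∀ r ∈ Icc s t, 0 < ρ r) (hα : ∀ r ∈ Icc s t, |α r - ang n k| < Real.pi / n)
    (h : ∀ r ∈ Icc s t, α r = ang n k → (ρ r - 1) ^ 2 + z r ^ 2 < 1 / 16)
    (hs : γ s ∈ chart n none) (ht : γ t ∈ chart n none) (g : FreeGroup (Fin n)) :
    transport (.mk (γ.subpath s t)) g = g * (side n k (α s))⁻¹ * side n k (α t) := by
  rw [transport_subpath_of_mem_chart γ (some k) hst
    (fun r hr => mem_chart_some hn (hγ r) (hρ r hr) (hα r hr) (h r hr)) hs ht,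
    jump_some hn (hγ s) (hρ s ⟨le_rfl, hst⟩) (hα s ⟨le_rfl, hst⟩),
    jump_some hn (hγ t) (hρ t ⟨hst, le_rfl⟩) (hα t ⟨hst, le_rfl⟩)]

/-- The path is off the discs before `s` and after `t`, and in between it can cross only the `k`-th
disc. What remains is to compare on which side of the disc it is at the two times. -/
theorem transport_of_crossing {n : ℕ} (hn : 2 ≤ n) {x y : Compl n} (γ : Path x y) {s t : I}
    (hst : s ≤ t) (k : Fin n) {ρ α z : I → ℝ} (hγ : ∀ r, (γ r).1 = cyl (ρ r) (α r) (z r))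
    (hρ : ∀ r ∈ Icc s t, 0 < ρ r) (hα : ∀ r ∈ Icc s t, |α r - ang n k| < Real.pi / n)
    (h : ∀ r ∈ Icc s t, α r = ang n k → (ρ r - 1) ^ 2 + z r ^ 2 < 1 / 16)
    (h0 : ∀ r ≤ s, γ r ∈ chart n none) (h1 : ∀ r ≥ t, γ r ∈ chart n none)
    (g : FreeGroup (Fin n)) :
    transport (.mk γ) g = g * (side n k (α s))⁻¹ * side n k (α t) := by
  rw [← transport_subpath_zero_one, transport_subpath_comp γ 0 s 1,
    transport_subpath_comp γ s t 1, transport_subpath_none γ (nonneg s) fun r hr => h0 r hr.2,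
    transport_subpath_none γ (le_one t) fun r hr => h1 r hr.1,
    transport_subpath_some hn γ hst k hγ hρ hα h (h0 s le_rfl) (h1 t le_rfl)]

theorem transport_of_mem_none {n : ℕ} {x y : Compl n} (γ : Path x y)
    (h : ∀ s, γ s ∈ chart n none) (g : FreeGroup (Fin n)) : transport (.mk γ) g = g := by
  rw [← transport_subpath_zero_one, transport_subpath_none γ (nonneg 1) fun r _ => h r]

theorem transport_symm {n : ℕ} {x y : Compl n} (γ : Path.Homotopic.Quotient x y)
    {g h : FreeGroup (Fin n)} (e : transport γ g = h) : transport γ.symm h = g := by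
  rw [← e, ← transport_trans, Path.Homotopic.Quotient.trans_symm, transport_refl]

/-! ### The transport along words in the meridians -/

/-- The bound 0.87 is just above √3/2. On the cone z = 2 − 2ρ the squared distance to the core
circle is 5(1 − ρ)², which exceeds 1/16 for ρ ≤ 0.87; so a meridian can touch the discs only in its
middle third. -/
theorem sin_le_of_le_third {s : ℝ} (h0 : 0 ≤ s) (h : s ≤ 1 / 3) :
    Real.sin (Real.pi * s) ≤ 87 / 100 := by
  have hpi := Real.pi_pos
  calc Real.sin (Real.pi * s) ≤ Real.sin (Real.pi / 3) :=
        Real.sin_le_sin_of_le_of_le_pi_div_two (by nlinarith) (by linarith) (by nlinarith)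
    _ = √3 / 2 := Real.sin_pi_div_three
    _ ≤ 87 / 100 := by
        have : √3 ≤ 1.74 := Real.sqrt_le_iff.2 (by norm_num)
        linarith

theorem sin_le_of_ge_two_thirds {s : ℝ} (h0 : s ≤ 1) (h : 2 / 3 ≤ s) :
    Real.sin (Real.pi * s) ≤ 87 / 100 := by
  have := sin_le_of_le_third (s := 1 - s) (by linarith) (by linarith)
  rwa [mul_sub, mul_one, Real.sin_pi_sub] at this

/-- The first third of the unit interval ends here. -/
def third : I := ⟨1 / 3, by norm_num, by norm_num⟩

/-- The last third of the unit interval begins here. -/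
def twoThirds : I := ⟨2 / 3, by norm_num, by norm_num⟩

theorem sin_pi_mul_nonneg (s : I) : 0 ≤ Real.sin (Real.pi * s) :=
  Real.sin_nonneg_of_nonneg_of_le_pi (mul_nonneg Real.pi_pos.le s.2.1)
    (by nlinarith [Real.pi_pos, s.2.2])

theorem sin_pi_mul_le (s : I) (h : s ≤ third ∨ twoThirds ≤ s) :
    Real.sin (Real.pi * s) ≤ 87 / 100 := by
  rcases h with h | h
  · exact sin_le_of_le_third s.2.1 h
  · exact sin_le_of_ge_two_thirds s.2.2 h

theorem sin_pi_mul_pos (s : I) (h : s ∈ Icc third twoThirds) : 0 < Real.sin (Real.pi * s) := by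
  have h1 : (1 / 3 : ℝ) ≤ s := h.1
  have h2 : (s : ℝ) ≤ 2 / 3 := h.2
  have hpi := Real.pi_pos
  exact Real.sin_pos_of_pos_of_lt_pi (by nlinarith) (by nlinarith)

/-- A loop on the cone over the core circle that dips once to the core circle, and crosses the
angle of the `k`-th bead near the core circle, represents the `k`-th generator. -/
theorem transport_of_dip {n : ℕ} (hn : 2 ≤ n) (k : Fin n) (γ : Path (base n) (base n))
    {α : I → ℝ} (hγ : ∀ s : I, (γ s).1 =
      cyl (Real.sin (Real.pi * s)) (α s) (2 - 2 * Real.sin (Real.pi * s)))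
    (hα : ∀ s ∈ Icc third twoThirds, α s = ang n k + (2 * s - 1) * Real.pi / n)
    (g : FreeGroup (Fin n)) : transport (.mk γ) g = g * FreeGroup.of k := by
  have hpi := Real.pi_pos
  have hn0 : (0 : ℝ) < n := by exact_mod_cast k.pos
  have hpn : 0 < Real.pi / n := by positivity
  have hle : third ≤ twoThirds := by
    change (1 / 3 : ℝ) ≤ 2 / 3; norm_num
  have hout : ∀ s : I, s ≤ third ∨ twoThirds ≤ s → γ s ∈ chart n none := fun s hs => by
    refine mem_chart_none_of_lt (hγ s) (sin_pi_mul_nonneg s) ?_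
    nlinarith [sin_pi_mul_le s hs]
  rw [transport_of_crossing hn γ hle k hγ sin_pi_mul_pos (fun s hs => ?_) (fun s hs he => ?_)
    (fun s hs => hout s (.inl hs)) (fun s hs => hout s (.inr hs)), hα _ ⟨le_rfl, hle⟩,
    hα _ ⟨hle, le_rfl⟩, side_of_gt, side_of_lt]
  · simp
  · rw [lt_add_iff_pos_right, mul_div_assoc]
    refine mul_pos ?_ hpn
    simp only [twoThirds]; norm_num
  · rw [add_lt_iff_neg_left, mul_div_assoc]
    refine mul_neg_of_neg_of_pos ?_ hpn
    simp only [third]; norm_num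
  · have h1 : (1 / 3 : ℝ) ≤ s := hs.1
    have h2 : (s : ℝ) ≤ 2 / 3 := hs.2
    rw [hα s hs, add_sub_cancel_left, mul_div_assoc, abs_mul, abs_of_pos hpn]
    have : |2 * (s : ℝ) - 1| < 1 := abs_lt.2 ⟨by linarith, by linarith⟩
    exact mul_lt_of_lt_one_left hpn this
  · rw [hα s hs, add_eq_left, mul_div_assoc, mul_eq_zero] at he
    have hs2 : (s : ℝ) = 1 / 2 := by linarith [he.resolve_right hpn.ne']
    have : Real.pi * (1 / 2 : ℝ) = Real.pi / 2 := by ring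
    rw [hs2, this, Real.sin_pi_div_two]; norm_num

theorem transport_meridianLoop {n : ℕ} (hn : 2 ≤ n) (k : Fin n) (g : FreeGroup (Fin n)) :
    transport (.mk (meridianLoop n k)) g = g * FreeGroup.of k :=
  transport_of_dip hn k _ (fun _ => rfl) (fun _ _ => rfl) g

/-- Monodromy turns concatenation into composition, so it suffices to know one crossing per
generator. Evaluated at 1, the transport recovers the word from its class. -/
theorem transport_wordClass {n : ℕ} (hn : 2 ≤ n) (w g : FreeGroup (Fin n)) :
    transport (wordClass n w).unop g = g * w := by
  induction w using FreeGroup.induction_on generalizing g with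
  | C1 => rw [map_one]; exact (transport_refl g).trans (mul_one g).symm
  | of k =>
    rw [wordClass, FreeGroup.lift_apply_of]
    exact transport_meridianLoop hn k g
  | inv_of k h =>
    rw [map_inv]
    exact transport_symm (wordClass n (.of k)).unop (by rw [h]; group)
  | mul v w hv hw =>
    rw [map_mul, ← mul_assoc, ← hv, ← hw]
    exact transport_trans _ _ g

theorem wordClass_injective {n : ℕ} (hn : 2 ≤ n) : Function.Injective (wordClass n) := by
  intro v w h
  have := transport_wordClass hn v 1
  rw [h, transport_wordClass hn w 1] at this
  simpa using this.symm

end Necklace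

end

/-! ### Generation by the meridians -/

noncomputable section

namespace Necklace

open Set Topology unitInterval

/-! ### Paths with lifts to a star-convex set -/

section Lifts

variable {X V : Type*} [TopologicalSpace X] [TopologicalSpace V]

/-- The path `p` lifts the path `γ` through the map `Φ`. -/
def Lifts (Φ : V → X) {a b : V} {x y : X} (p : Path a b) (γ : Path x y) : Prop :=
  ∀ t, Φ (p t) = γ t

theorem Lifts.symm {Φ : V → X} {a b : V} {x y : X} {p : Path a b} {γ : Path x y}
    (h : Lifts Φ p γ) : Lifts Φ p.symm γ.symm := fun _ => h _

theorem Lifts.trans {Φ : V → X} {a b c : V} {x y z : X} {p : Path a b} {γ : Path x y}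
    {q : Path b c} {δ : Path y z} (h : Lifts Φ p γ) (h' : Lifts Φ q δ) :
    Lifts Φ (p.trans q) (γ.trans δ) := fun t => by
  rw [Path.trans_apply, Path.trans_apply]
  split_ifs
  · exact h _
  · exact h' _

/-- The tool that replaces explicit homotopies in the complement of the beads: it suffices to lift
both paths, with the same ends, to a simply connected set of coordinates. -/
theorem Lifts.homotopic [SimplyConnectedSpace V] {Φ : V → X} (hΦ : Continuous Φ) {a b : V}
    {x y : X} {p q : Path a b} {γ δ : Path x y} (hp : Lifts Φ p γ) (hq : Lifts Φ q δ) :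
    γ.Homotopic δ := by
  have hx : Φ a = x := by rw [← p.source, hp, γ.source]
  have hy : Φ b = y := by rw [← p.target, hp, γ.target]
  subst hx hy
  have h1 : γ = p.map hΦ := by ext t; exact (hp t).symm
  have h2 : δ = q.map hΦ := by ext t; exact (hq t).symm
  rw [h1, h2]
  exact (SimplyConnectedSpace.paths_homotopic p q).map ⟨Φ, hΦ⟩

end Lifts

theorem simplyConnectedSpace_of_starConvex {V : Type*} [AddCommGroup V] [Module ℝ V]
    [TopologicalSpace V] [IsTopologicalAddGroup V] [ContinuousSMul ℝ V] {S : Set V} {c : V}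
    (h : StarConvex ℝ c S) (hc : c ∈ S) : SimplyConnectedSpace S :=
  haveI := h.contractibleSpace ⟨c, hc⟩
  inferInstance

/-! ### Loops in the range of `wordClass` -/

/-- A class of loops is represented by a word in the meridians. -/
def IsWord {n : ℕ} (a : Path.Homotopic.Quotient (base n) (base n)) : Prop :=
  ∃ w, (wordClass n w).unop = a

theorem IsWord.refl (n : ℕ) : IsWord (Path.Homotopic.Quotient.refl (base n)) :=
  ⟨1, by rw [map_one]; rfl⟩

theorem IsWord.trans {n : ℕ} {a b : Path.Homotopic.Quotient (base n) (base n)} (ha : IsWord a)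
    (hb : IsWord b) : IsWord (a.trans b) := by
  obtain ⟨v, rfl⟩ := ha
  obtain ⟨w, rfl⟩ := hb
  exact ⟨v * w, by rw [map_mul]; rfl⟩

theorem IsWord.symm {n : ℕ} {a : Path.Homotopic.Quotient (base n) (base n)} (ha : IsWord a) :
    IsWord a.symm := by
  obtain ⟨v, rfl⟩ := ha
  exact ⟨v⁻¹, by rw [map_inv]; rfl⟩

theorem IsWord.meridian {n : ℕ} (k : Fin n) : IsWord (.mk (meridianLoop n k)) :=
  ⟨.of k, by rw [wordClass, FreeGroup.lift_apply_of]; rfl⟩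

/-! ### Dips through the half-plane of a bead -/

theorem notMem_beads_of_dip {n : ℕ} {k : Fin n} {α ρ z : ℝ} (hρ : 0 ≤ ρ)
    (hα : |α - ang n k| ≤ Real.pi / n)
    (h : α = ang n k → (ρ - 1) ^ 2 + z ^ 2 ≠ 1 / 16) : cyl ρ α z ∉ beads (std n) := by
  intro hb
  obtain ⟨j, -, ⟨m, hm⟩, hc⟩ := mem_beads_std hρ hb
  have hn : (0 : ℝ) < n := by exact_mod_cast k.pos
  have hpi := Real.pi_pos
  refine h (ang_unique (lt_of_le_of_lt hα ?_) hm).2 hc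
  rw [mul_div_assoc]
  have : 0 < Real.pi / n := by positivity
  linarith

theorem abs_two_mul_sub_one_le {n : ℕ} (k : Fin n) (s : I) :
    |ang n k + (2 * s - 1) * Real.pi / n - ang n k| ≤ Real.pi / n := by
  have hn : (0 : ℝ) < n := by exact_mod_cast k.pos
  have hpi := Real.pi_pos
  have : 0 < Real.pi / n := by positivity
  rw [add_sub_cancel_left, mul_div_assoc, abs_mul, abs_of_pos this]
  refine mul_le_of_le_one_left this.le (abs_le.2 ⟨?_, ?_⟩)
  · linarith [s.2.1]
  · linarith [s.2.2]

theorem eq_half_of_ang {n : ℕ} {k : Fin n} {s : ℝ}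
    (h : ang n k + (2 * s - 1) * Real.pi / n = ang n k) : s = 1 / 2 := by
  have hn : (0 : ℝ) < n := by exact_mod_cast k.pos
  have hpi := Real.pi_pos
  have : Real.pi / n ≠ 0 := by positivity
  rw [add_eq_left, mul_div_assoc, mul_eq_zero] at h
  linarith [h.resolve_right this]

theorem sin_pi_half : Real.sin (Real.pi * (1 / 2)) = 1 := by
  rw [mul_one_div, Real.sin_pi_div_two]

/-- The loop that passes through the half-plane of the `k`-th bead at the point `q`. -/
def dip {n : ℕ} (k : Fin n) (q : ℝ × ℝ) (hq : 0 ≤ q.1) (h : (q.1 - 1) ^ 2 + q.2 ^ 2 ≠ 1 / 16) :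
    Path (base n) (base n) where
  toFun s := ⟨cyl (q.1 * Real.sin (Real.pi * s)) (ang n k + (2 * s - 1) * Real.pi / n)
      (2 + (q.2 - 2) * Real.sin (Real.pi * s)), by
    refine notMem_beads_of_dip (mul_nonneg hq (sin_pi_mul_nonneg s)) (abs_two_mul_sub_one_le k s)
      fun e => ?_
    rw [eq_half_of_ang e, sin_pi_half]
    simpa using h⟩
  continuous_toFun := by
    refine Continuous.subtype_mk (continuous_cyl ?_ ?_ ?_) _ <;> fun_prop
  source' := by
    apply Subtype.ext
    simp [base, basePoint, cyl]
  target' := by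
    apply Subtype.ext
    simp [base, basePoint, cyl]

/-- A dip meets the half-plane of the bead at time 1/2 only, and there at its parameter. Moving the
parameter along a segment is therefore harmless as long as the segment misses the bead. -/
theorem dip_homotopic {n : ℕ} (k : Fin n) {q q' : ℝ × ℝ} (hq : 0 ≤ q.1)
    (h : (q.1 - 1) ^ 2 + q.2 ^ 2 ≠ 1 / 16) (hq' : 0 ≤ q'.1)
    (h' : (q'.1 - 1) ^ 2 + q'.2 ^ 2 ≠ 1 / 16)
    (H : ∀ t : I, ((1 - t) * q.1 + t * q'.1 - 1) ^ 2 + ((1 - t) * q.2 + t * q'.2) ^ 2 ≠ 1 / 16) :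
    (dip k q hq h).Homotopic (dip k q' hq' h') := by
  refine ⟨⟨⟨⟨fun x : I × I => ⟨cyl (((1 - x.1) * q.1 + x.1 * q'.1) * Real.sin (Real.pi * x.2))
      (ang n k + (2 * x.2 - 1) * Real.pi / n)
      (2 + (((1 - x.1) * q.2 + x.1 * q'.2) - 2) * Real.sin (Real.pi * x.2)), ?_⟩, ?_⟩,
      fun s => ?_, fun s => ?_⟩, fun t s hs => ?_⟩⟩
  · have h1 : 0 ≤ 1 - (x.1 : ℝ) := by linarith [x.1.2.2]
    have h2 : 0 ≤ (x.1 : ℝ) := x.1.2.1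
    refine notMem_beads_of_dip (mul_nonneg (by positivity) (sin_pi_mul_nonneg x.2))
      (abs_two_mul_sub_one_le k x.2) fun e => ?_
    rw [eq_half_of_ang e, sin_pi_half]
    simpa using H x.1
  · refine Continuous.subtype_mk (continuous_cyl ?_ ?_ ?_) _ <;> fun_prop
  · apply Subtype.ext; simp [dip]
  · apply Subtype.ext; simp [dip]
  · rcases hs with rfl | hs
    · apply Subtype.ext; simp [dip, base, basePoint, cyl]
    · rw [mem_singleton_iff.1 hs]
      apply Subtype.ext; simp [dip, base, basePoint, cyl]

/-- Inside the bead the parameter contracts to the centre, where the dip is the meridian. Outside,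
it can be moved around the bead to the base point, where the dip is constant. -/
theorem isWord_dip {n : ℕ} (k : Fin n) (q : ℝ × ℝ) (hq : 0 ≤ q.1)
    (h : (q.1 - 1) ^ 2 + q.2 ^ 2 ≠ 1 / 16) : IsWord (.mk (dip k q hq h)) := by
  rcases lt_or_gt_of_ne h with h1 | h1
  · have := dip_homotopic k hq h (q' := (1, 0)) zero_le_one (by norm_num) fun t => ne_of_lt ?_
    · rw [Path.Homotopic.Quotient.eq.2 this]
      have e : dip k (1, 0) zero_le_one (by norm_num) = meridianLoop n k := by
        refine Path.ext (funext fun s => Subtype.ext ?_)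
        change cyl _ _ _ = cyl _ _ _
        congr 1
        · exact one_mul _
        · ring
      rw [e]
      exact IsWord.meridian k
    · have ht0 := t.2.1
      have ht1 := t.2.2
      have : ((1 - (t : ℝ)) * q.1 + t * 1 - 1) ^ 2 + ((1 - (t : ℝ)) * q.2 + t * 0) ^ 2
          = (1 - (t : ℝ)) ^ 2 * ((q.1 - 1) ^ 2 + q.2 ^ 2) := by ring
      simp only [this]
      calc _ ≤ 1 * ((q.1 - 1) ^ 2 + q.2 ^ 2) := by
            refine mul_le_mul_of_nonneg_right ?_ (by positivity)
            exact pow_le_one₀ (by linarith) (by linarith)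
        _ < _ := by linarith
  · -- a sign, such that moving vertically in this direction increases the distance to the centre
    obtain ⟨ε, hε, hεq⟩ : ∃ ε : ℝ, ε ^ 2 = 1 ∧ 0 ≤ ε * q.2 := by
      rcases le_total 0 q.2 with h | h
      · exact ⟨1, by norm_num, by linarith⟩
      · exact ⟨-1, by norm_num, by linarith⟩
    have e1 : ∀ t : I, (0 : ℝ) ≤ t := fun t => t.2.1
    have e2 : ∀ t : I, (0 : ℝ) ≤ 1 - t := fun t => by linarith [t.2.2]
    -- After a vertical shift by 2 away from the core plane the height is at least 2 in absolute
    -- value, so the horizontal move to the axis stays clear of the bead.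
    have far : ∀ ρ : ℝ, 1 / 16 < (ρ - 1) ^ 2 + (q.2 + 2 * ε) ^ 2 := fun ρ => by
      nlinarith [sq_nonneg (ρ - 1), sq_nonneg q.2]
    have s1 := dip_homotopic k hq h (q' := (q.1, q.2 + 2 * ε)) hq (far _).ne' fun t => by
      refine (lt_of_lt_of_le h1 ?_).ne'
      have : ((1 - (t : ℝ)) * q.1 + t * q.1 - 1) ^ 2 + ((1 - (t : ℝ)) * q.2 + t * (q.2 + 2 * ε)) ^ 2
        = (q.1 - 1) ^ 2 + q.2 ^ 2 + 4 * t * (ε * q.2) + 4 * t ^ 2 * ε ^ 2 := by ring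
      simp only [this, hε]
      have := mul_nonneg (e1 t) hεq
      nlinarith [sq_nonneg (t : ℝ)]
    have s2 := dip_homotopic k (q := (q.1, q.2 + 2 * ε)) hq (far _).ne' (q' := (0, q.2 + 2 * ε))
      le_rfl (far _).ne' fun t => by
        have : (1 - (t : ℝ)) * (q.2 + 2 * ε) + t * (q.2 + 2 * ε) = q.2 + 2 * ε := by ring
        simp only [this]
        exact (far _).ne'
    have s3 := dip_homotopic k (q := (0, q.2 + 2 * ε)) le_rfl (far _).ne' (q' := (0, 2)) le_rfl
      (by norm_num) fun t => by
        refine ne_of_gt ?_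
        simp only [mul_zero, add_zero, zero_sub]
        nlinarith [sq_nonneg ((1 - (t : ℝ)) * (q.2 + 2 * ε) + t * 2)]
    rw [Path.Homotopic.Quotient.eq.2 ((s1.trans s2).trans s3)]
    have e : dip k (0, 2) le_rfl (by norm_num) = Path.refl (base n) := by
      refine Path.ext (funext fun s => Subtype.ext ?_)
      change cyl (0 * _) _ (2 + (2 - 2) * _) = cyl 0 0 2
      simp [cyl]
    rw [e]
    exact IsWord.refl n

end Necklace

end

noncomputable section

namespace Necklace

open Set Topology unitInterval

/-! ### The meridians generate -/

/-- The part of the half-plane of angle `θ` at distance at least `3 / 4` from the axis. -/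
def page (θ : ℝ) : Set E3 := {p | tng θ p = 0 ∧ 3 / 4 ≤ rad θ p}

theorem isClosed_page (θ : ℝ) : IsClosed (page θ) :=
  (isClosed_eq (continuous_tng _) continuous_const).inter
    (isClosed_le continuous_const (continuous_rad _))

/-- The complement of the pages that contain the beads. -/
def offPages (n : ℕ) : Set E3 := {p | ∀ j : Fin n, p ∉ page (ang n j)}

theorem isOpen_offPages (n : ℕ) : IsOpen (offPages n) := by
  have : offPages n = ⋂ j : Fin n, (page (ang n j))ᶜ := by ext; simp [offPages]
  rw [this]
  exact isOpen_iInter_of_finite fun j => (isClosed_page _).isOpen_compl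

theorem notMem_beads_of_mem_offPages {n : ℕ} {p : E3} (h : p ∈ offPages n) :
    p ∉ beads (std n) := by
  rw [mem_beads_std_iff]
  rintro ⟨i, ht, hd⟩
  exact h i ⟨ht, by nlinarith [sq_nonneg (p 2)]⟩

theorem rad_basePoint (θ : ℝ) : rad θ basePoint = 0 := by simp [rad, basePoint]

theorem tng_basePoint (θ : ℝ) : tng θ basePoint = 0 := by simp [tng, basePoint]

theorem basePoint_mem_offPages (n : ℕ) : basePoint ∈ offPages n := fun j hj => by
  have := hj.2
  rw [rad_basePoint] at this
  norm_num at this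

/-- The base point is on the axis, so `rad` and `tng` are scaled along segments towards it. A
segment that meets a page thus starts further out on the same page. -/
theorem starConvex_offPages (n : ℕ) : StarConvex ℝ basePoint (offPages n) := by
  intro p hp a b ha hb hab j hj
  have h1 : tng (ang n j) (a • basePoint + b • p) = b * tng (ang n j) p := by
    have := tng_basePoint (ang n j)
    simp only [tng, PiLp.add_apply, PiLp.smul_apply, smul_eq_mul] at this ⊢
    linear_combination a * this
  have h2 : rad (ang n j) (a • basePoint + b • p) = b * rad (ang n j) p := by
    have := rad_basePoint (ang n j)
    simp only [rad, PiLp.add_apply, PiLp.smul_apply, smul_eq_mul] at this ⊢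
    linear_combination a * this
  obtain ⟨h3, h4⟩ := hj
  rw [h1] at h3
  rw [h2] at h4
  have hb0 : b ≠ 0 := fun e => by rw [e] at h4; norm_num at h4
  have hb1 : b ≤ 1 := by linarith
  exact hp j ⟨(mul_eq_zero.1 h3).resolve_left hb0, by
    have : 0 < rad (ang n j) p := pos_of_mul_pos_right (by linarith) hb
    nlinarith⟩

theorem cyl_mem_page_iff {θ ρ α z : ℝ} (hρ : 0 ≤ ρ) :
    cyl ρ α z ∈ page θ ↔ (∃ m : ℤ, α - θ = 2 * Real.pi * m) ∧ 3 / 4 ≤ ρ := by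
  unfold page
  rw [mem_ofPred_eq, tng_cyl, rad_cyl]
  constructor
  · rintro ⟨ht, hr⟩
    have hρ' : ρ ≠ 0 := fun e => by rw [e] at hr; norm_num at hr
    have hc : 0 < Real.cos (α - θ) := pos_of_mul_pos_right (by linarith) hρ
    have h1 : Real.cos (α - θ) = 1 := by
      rcases Real.sin_eq_zero_iff_cos_eq.1 ((mul_eq_zero.1 ht).resolve_left hρ') with h | h
      · exact h
      · rw [h] at hc; linarith
    obtain ⟨m, hm⟩ := (Real.cos_eq_one_iff _).1 h1
    rw [h1, mul_one] at hr
    exact ⟨⟨m, by rw [← hm]; ring⟩, hr⟩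
  · rintro ⟨⟨m, hm⟩, hr⟩
    have : α - θ = m * (2 * Real.pi) := by rw [hm]; ring
    rw [this, Real.cos_int_mul_two_pi]
    have hs : Real.sin (m * (2 * Real.pi)) = 0 :=
      Real.sin_eq_zero_iff_cos_eq.2 (.inl (Real.cos_int_mul_two_pi m))
    rw [hs]
    constructor <;> linarith

/-- Cylindrical coordinates `(α, ρ, z)` as a map. -/
def cylMap (a : ℝ × ℝ × ℝ) : E3 := cyl a.2.1 a.1 a.2.2

theorem continuous_cylMap : Continuous cylMap :=
  continuous_cyl (by fun_prop) (by fun_prop) (by fun_prop)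

/-- Cylindrical coordinates on the half-space around the direction of angle `θ`. -/
def coords (θ : ℝ) (p : E3) : ℝ × ℝ × ℝ :=
  (θ + Real.arctan (tng θ p / rad θ p), √(rad θ p ^ 2 + tng θ p ^ 2), p 2)

theorem continuousAt_coords {θ : ℝ} {p : E3} (h : 0 < rad θ p) :
    ContinuousAt (coords θ) p := by
  unfold coords
  have hr := (continuous_rad θ).continuousAt (x := p)
  have ht := (continuous_tng θ).continuousAt (x := p)
  refine ContinuousAt.prodMk ?_ (ContinuousAt.prodMk ?_ (continuous_coord 2).continuousAt)
  · exact continuousAt_const.add (Real.continuous_arctan.continuousAt.comp (ht.div hr h.ne'))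
  · exact Real.continuous_sqrt.continuousAt.comp ((hr.pow 2).add (ht.pow 2))

theorem cylMap_coords {θ : ℝ} {p : E3} (h : 0 < rad θ p) : cylMap (coords θ p) = p := by
  have hθ := Real.sin_sq_add_cos_sq θ
  set ρ := √(rad θ p ^ 2 + tng θ p ^ 2) with hρ
  have hρ0 : 0 < ρ := Real.sqrt_pos.2 (by positivity)
  have hs : √(1 + (tng θ p / rad θ p) ^ 2) = ρ / rad θ p := by
    rw [Real.sqrt_eq_iff_mul_self_eq (by positivity) (by positivity), ← sq, div_pow, div_pow,
      hρ, Real.sq_sqrt (by positivity)]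
    field_simp
  have e1 : ρ * Real.cos (Real.arctan (tng θ p / rad θ p)) = rad θ p := by
    rw [Real.cos_arctan, hs]; field_simp
  have e2 : ρ * Real.sin (Real.arctan (tng θ p / rad θ p)) = tng θ p := by
    rw [Real.sin_arctan, hs]; field_simp
  refine E3.ext ?_ ?_ rfl
  · change ρ * Real.cos (θ + _) = _
    rw [Real.cos_add]
    have : p 0 = rad θ p * Real.cos θ - tng θ p * Real.sin θ := by
      simp only [rad, tng]; linear_combination (-p 0) * hθ
    linear_combination Real.cos θ * e1 - Real.sin θ * e2 - this
  · change ρ * Real.sin (θ + _) = _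
    rw [Real.sin_add]
    have : p 1 = rad θ p * Real.sin θ + tng θ p * Real.cos θ := by
      simp only [rad, tng]; linear_combination (-p 1) * hθ
    linear_combination Real.sin θ * e1 + Real.cos θ * e2 - this

theorem coords_fst_eq_iff {θ : ℝ} {p : E3} (h : 0 < rad θ p) :
    (coords θ p).1 = θ ↔ tng θ p = 0 := by
  simp [coords, h.ne']

theorem coords_snd_of_tng {θ : ℝ} {p : E3} (h : 0 < rad θ p) (ht : tng θ p = 0) :
    (coords θ p).2 = (rad θ p, p 2) := by
  simp [coords, ht, Real.sqrt_sq h.le]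

/-- The set of coordinates of points of the sector around the `k`-th bead that meet its half-plane
in `Q`. -/
def sectorSet (n : ℕ) (k : Fin n) (Q : Set (ℝ × ℝ)) : Set (ℝ × ℝ × ℝ) :=
  {a | |a.1 - ang n k| ≤ Real.pi / n ∧ 0 ≤ a.2.1 ∧ (a.1 = ang n k → a.2 ∈ Q)}

/-- A segment from a point of the half-plane of the bead either stays in the half-plane, where `Q`
is convex, or leaves it at once and does not return. -/
theorem starConvex_sectorSet {n : ℕ} (k : Fin n) {Q : Set (ℝ × ℝ)} (hQ : Convex ℝ Q)
    {q : ℝ × ℝ} (hq : q ∈ Q) (hq0 : 0 ≤ q.1) :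
    StarConvex ℝ (ang n k, q) (sectorSet n k Q) := by
  rintro ⟨α, h⟩ ⟨h1, h2, h3⟩ a b ha hb hab
  have e : a * ang n k + b * α - ang n k = b * (α - ang n k) := by
    rw [← eq_sub_iff_add_eq] at hab
    rw [hab]; ring
  refine ⟨?_, ?_, fun h4 => ?_⟩
  · simp only [Prod.smul_mk, Prod.mk_add_mk, smul_eq_mul]
    rw [e, abs_mul, abs_of_nonneg hb]
    exact (mul_le_of_le_one_left (abs_nonneg _) (by linarith)).trans h1
  · simp only [Prod.smul_mk, Prod.mk_add_mk, Prod.fst_add, Prod.smul_fst, smul_eq_mul]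
    simp only at h2
    positivity
  · simp only [Prod.smul_mk, Prod.mk_add_mk, smul_eq_mul] at h4 ⊢
    rcases eq_or_ne b 0 with hb0 | hb0
    · rw [hb0] at hab ⊢
      rw [show a = 1 by linarith]
      simpa using hq
    · have : α = ang n k := by
        have := (mul_eq_zero.1 (e ▸ sub_eq_zero.2 h4)).resolve_left hb0
        linarith
      exact hQ hq (h3 this) ha hb hab

theorem cylMap_notMem_of_mem_sectorSet {n : ℕ} {k : Fin n} {Q : Set (ℝ × ℝ)}
    (hQ : ∀ q ∈ Q, (q.1 - 1) ^ 2 + q.2 ^ 2 ≠ 1 / 16) {a : ℝ × ℝ × ℝ}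
    (ha : a ∈ sectorSet n k Q) : cylMap a ∉ beads (std n) :=
  notMem_beads_of_dip ha.2.1 ha.1 fun e => hQ _ (ha.2.2 e)

/-- The map from a sector to the complement of the beads. -/
def sectorMap {n : ℕ} {k : Fin n} {Q : Set (ℝ × ℝ)}
    (hQ : ∀ q ∈ Q, (q.1 - 1) ^ 2 + q.2 ^ 2 ≠ 1 / 16) (a : sectorSet n k Q) : Compl n :=
  ⟨cylMap a, cylMap_notMem_of_mem_sectorSet hQ a.2⟩

theorem continuous_sectorMap {n : ℕ} {k : Fin n} {Q : Set (ℝ × ℝ)}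
    (hQ : ∀ q ∈ Q, (q.1 - 1) ^ 2 + q.2 ^ 2 ≠ 1 / 16) :
    Continuous (sectorMap (n := n) (k := k) hQ) :=
  (continuous_cylMap.comp continuous_subtype_val).subtype_mk _

/-- The straight path from a point off the pages to the base point. -/
def straight {n : ℕ} (y : Compl n) (hy : y.1 ∈ offPages n) : Path y (base n) where
  toFun s := ⟨(s : ℝ) • basePoint + (1 - s : ℝ) • y.1, notMem_beads_of_mem_offPages
    (starConvex_offPages n hy s.2.1 (by linarith [s.2.2]) (by ring))⟩
  continuous_toFun := by
    refine Continuous.subtype_mk ?_ _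
    fun_prop
  source' := by apply Subtype.ext; simp
  target' := by apply Subtype.ext; simp [base]

/-- Two paths in the complement of the pages are homotopic. -/
theorem homotopic_of_mem_offPages {n : ℕ} {x y : Compl n} (γ δ : Path x y)
    (hγ : ∀ s, (γ s).1 ∈ offPages n) (hδ : ∀ s, (δ s).1 ∈ offPages n) : γ.Homotopic δ := by
  have := simplyConnectedSpace_of_starConvex (starConvex_offPages n) (basePoint_mem_offPages n)
  let Φ : offPages n → Compl n := fun p => ⟨p.1, notMem_beads_of_mem_offPages p.2⟩
  have hΦ : Continuous Φ := continuous_subtype_val.subtype_mk _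
  have hx : x.1 ∈ offPages n := by have := hγ 0; rwa [γ.source] at this
  have hy : y.1 ∈ offPages n := by have := hγ 1; rwa [γ.target] at this
  let lift : ∀ γ : Path x y, (∀ s, (γ s).1 ∈ offPages n) →
      Path (⟨x.1, hx⟩ : offPages n) ⟨y.1, hy⟩ := fun γ hγ =>
    { toFun := fun s => ⟨(γ s).1, hγ s⟩
      continuous_toFun := (continuous_subtype_val.comp γ.continuous).subtype_mk _
      source' := by apply Subtype.ext; exact congrArg (fun q : Compl n => q.1) γ.source
      target' := by apply Subtype.ext; exact congrArg (fun q : Compl n => q.1) γ.target }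
  exact Lifts.homotopic hΦ (p := lift γ hγ) (q := lift δ hδ) (fun _ => rfl) (fun _ => rfl)

theorem straight_mem {n : ℕ} (y : Compl n) (hy : y.1 ∈ offPages n) (s : I) :
    (straight y hy s).1 ∈ offPages n :=
  starConvex_offPages n hy s.2.1 (by linarith [s.2.2]) (by ring)

end Necklace

end

/-! ### Return paths to the base point, in cylindrical coordinates -/

noncomputable section

namespace Necklace

open Set Topology unitInterval

/-- The segment from `a` to the point of the axis at height `2`, approached from the angle half-way
between the `k`-th bead and the next one (`e = 1`) or the previous one (`e = -1`). -/
def slide (n : ℕ) (k : Fin n) (e : ℝ) (a : ℝ × ℝ × ℝ) (s : ℝ) : ℝ × ℝ × ℝ :=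
  ((1 - s) * a.1 + s * (ang n k + e * (Real.pi / n)), (1 - s) * a.2.1, (1 - s) * a.2.2 + s * 2)

/-- The sign `e` records the side of the half-plane on which `a` lies. The signed angle is a sum of
two nonnegative terms, and the second one vanishes only at time 0. -/
theorem slide_fst_eq {n : ℕ} {k : Fin n} {e : ℝ} (he : e = 1 ∨ e = -1) {a : ℝ × ℝ × ℝ}
    (h : 0 ≤ e * (a.1 - ang n k)) {s : ℝ} (hs : s ∈ Icc (0 : ℝ) 1)
    (h1 : (slide n k e a s).1 = ang n k) : s = 0 := by
  have hn : (0 : ℝ) < n := by exact_mod_cast k.pos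
  have hpi : 0 < Real.pi / n := div_pos Real.pi_pos hn
  have e2 : e * e = 1 := by rcases he with rfl | rfl <;> norm_num
  have h2 : (1 - s) * (e * (a.1 - ang n k)) + s * (Real.pi / n) = 0 := by
    simp only [slide] at h1
    linear_combination e * h1 - s * (Real.pi / n) * e2
  have h3 : 0 ≤ (1 - s) * (e * (a.1 - ang n k)) := mul_nonneg (by linarith [hs.2]) h
  have h4 : s * (Real.pi / n) ≤ 0 := by linarith
  have h5 : 0 ≤ s * (Real.pi / n) := mul_nonneg hs.1 hpi.le
  exact (mul_eq_zero.1 (le_antisymm h4 h5)).resolve_right hpi.ne'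

theorem abs_slide_le {n : ℕ} {k : Fin n} {e : ℝ} (he : e = 1 ∨ e = -1) {a : ℝ × ℝ × ℝ}
    (h : |a.1 - ang n k| ≤ Real.pi / n) {s : ℝ} (hs : s ∈ Icc (0 : ℝ) 1) :
    |(slide n k e a s).1 - ang n k| ≤ Real.pi / n := by
  have hn : (0 : ℝ) < n := by exact_mod_cast k.pos
  have hpi : 0 < Real.pi / n := div_pos Real.pi_pos hn
  obtain ⟨h1, h2⟩ := abs_le.1 h
  obtain ⟨h3, h4⟩ := hs
  simp only [slide]
  rw [abs_le]
  rcases he with rfl | rfl <;> constructor <;> nlinarith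

theorem slide_zero {n : ℕ} {k : Fin n} {e : ℝ} (a : ℝ × ℝ × ℝ) : slide n k e a 0 = a := by
  simp [slide]

theorem slide_one {n : ℕ} {k : Fin n} {e : ℝ} (a : ℝ × ℝ × ℝ) :
    slide n k e a 1 = (ang n k + e * (Real.pi / n), 0, 2) := by
  simp [slide]

theorem slide_mem {n : ℕ} {k : Fin n} {e : ℝ} (he : e = 1 ∨ e = -1) {Q : Set (ℝ × ℝ)}
    {a : ℝ × ℝ × ℝ} (ha : a ∈ sectorSet n k Q) (h : 0 ≤ e * (a.1 - ang n k)) {s : ℝ}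
    (hs : s ∈ Icc (0 : ℝ) 1) : slide n k e a s ∈ sectorSet n k Q := by
  refine ⟨abs_slide_le he ha.1 hs, mul_nonneg (by linarith [hs.2]) ha.2.1, fun h1 => ?_⟩
  have hs0 := slide_fst_eq he h hs h1
  rw [hs0, slide_zero] at h1 ⊢
  exact ha.2.2 h1

/-- The end lies on the edge of the sector, off the half-plane of the bead, so nothing is asked of
`Q`. The ends for `e = 1` and `e = -1` are different coordinates of the same point of space, the
base point. -/
theorem end_mem {n : ℕ} {k : Fin n} {e : ℝ} (he : e = 1 ∨ e = -1) {Q : Set (ℝ × ℝ)} :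
    (ang n k + e * (Real.pi / n), ((0 : ℝ), (2 : ℝ))) ∈ sectorSet n k Q := by
  have hn : (0 : ℝ) < n := by exact_mod_cast k.pos
  have hpi : 0 < Real.pi / n := div_pos Real.pi_pos hn
  refine ⟨?_, le_rfl, fun h => ?_⟩
  · rcases he with rfl | rfl <;> simp [abs_of_pos hpi]
  · exfalso
    simp only at h
    rcases he with rfl | rfl <;> linarith

theorem continuous_slide {n : ℕ} {k : Fin n} {e : ℝ} (a : ℝ × ℝ × ℝ) :
    Continuous (slide n k e a) := by
  unfold slide; fun_prop

/-- The segment `slide` as a path in a sector. -/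
def slidePath {n : ℕ} {k : Fin n} {e : ℝ} (he : e = 1 ∨ e = -1) {Q : Set (ℝ × ℝ)}
    {a : ℝ × ℝ × ℝ} (ha : a ∈ sectorSet n k Q) (h : 0 ≤ e * (a.1 - ang n k)) :
    Path (⟨a, ha⟩ : sectorSet n k Q) ⟨_, end_mem he⟩ where
  toFun s := ⟨slide n k e a s, slide_mem he ha h s.2⟩
  continuous_toFun := ((continuous_slide a).comp continuous_subtype_val).subtype_mk _
  source' := Subtype.ext (slide_zero a)
  target' := Subtype.ext (slide_one a)

/-- The segment `slide` as a path from a point to the base point. -/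
def sideReturn {n : ℕ} (k : Fin n) (e : ℝ) (y : Compl n) (hy : 0 < rad (ang n k) y.1)
    (h : ∀ s : I, cylMap (slide n k e (coords (ang n k) y.1) s) ∉ beads (std n)) :
    Path y (base n) where
  toFun s := ⟨cylMap (slide n k e (coords (ang n k) y.1) s), h s⟩
  continuous_toFun := (continuous_cylMap.comp
    ((continuous_slide _).comp continuous_subtype_val)).subtype_mk _
  source' := by
    apply Subtype.ext
    change cylMap (slide n k e _ 0) = _
    rw [slide_zero, cylMap_coords hy]
  target' := by
    apply Subtype.ext
    change cylMap (slide n k e _ 1) = _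
    rw [slide_one]
    simp [cylMap, base, basePoint, cyl]

theorem rad_pos_of_mem_page {θ : ℝ} {p : E3} (h : p ∈ page θ) : 0 < rad θ p := by
  linarith [h.2]

theorem coords_mem_sectorSet {n : ℕ} {k : Fin n} {Q : Set (ℝ × ℝ)} {p : E3}
    (h : 0 < rad (ang n k) p) (hα : |(coords (ang n k) p).1 - ang n k| ≤ Real.pi / n)
    (hQ : tng (ang n k) p = 0 → (rad (ang n k) p, p 2) ∈ Q) :
    coords (ang n k) p ∈ sectorSet n k Q := by
  refine ⟨hα, Real.sqrt_nonneg _, fun e => ?_⟩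
  have ht := (coords_fst_eq_iff h).1 e
  rw [coords_snd_of_tng h ht]
  exact hQ ht

theorem coords_fst_of_tng {θ : ℝ} {p : E3} (h : tng θ p = 0) : (coords θ p).1 = θ := by
  simp [coords, h]

theorem sideReturn_aux {n : ℕ} {k : Fin n} {y : Compl n} (hy : y.1 ∈ page (ang n k)) (s : I) :
    cylMap (slide n k (-1) (coords (ang n k) y.1) s) ∉ beads (std n) := by
  have hr := rad_pos_of_mem_page hy
  have hn : (0 : ℝ) < n := by exact_mod_cast k.pos
  have hpi : 0 < Real.pi / n := div_pos Real.pi_pos hn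
  have hQ : ∀ q ∈ ({(rad (ang n k) y.1, y.1 2)} : Set (ℝ × ℝ)),
      (q.1 - 1) ^ 2 + q.2 ^ 2 ≠ 1 / 16 := by
    rintro q rfl h
    exact y.2 (mem_beads_std_iff.2 ⟨k, hy.1, h⟩)
  have e := coords_fst_of_tng hy.1
  refine cylMap_notMem_of_mem_sectorSet (k := k) hQ (slide_mem (.inr rfl)
    (coords_mem_sectorSet hr ?_ fun _ => mem_singleton _) ?_ s.2)
  · rw [e]; simpa using hpi.le
  · rw [e]; simp

theorem exists_page_of_notMem {n : ℕ} {y : E3} (h : y ∉ offPages n) :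
    ∃ k : Fin n, y ∈ page (ang n k) := by
  simpa [offPages] using h

open Classical in
/-- A chosen class of paths from each point to the base point. -/
def ret {n : ℕ} (y : Compl n) : Path.Homotopic.Quotient y (base n) :=
  if h : y.1 ∈ offPages n then .mk (straight y h)
  else .mk (sideReturn (exists_page_of_notMem h).choose (-1) y
    (rad_pos_of_mem_page (exists_page_of_notMem h).choose_spec)
    (sideReturn_aux (exists_page_of_notMem h).choose_spec))

theorem page_eq {n : ℕ} {k j : Fin n} {p : E3} (h : 0 < rad (ang n k) p)
    (hα : |(coords (ang n k) p).1 - ang n k| < Real.pi / n) (hj : p ∈ page (ang n j)) :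
    j = k ∧ tng (ang n k) p = 0 := by
  have hn : (0 : ℝ) < n := by exact_mod_cast k.pos
  have hpi : 0 < Real.pi / n := div_pos Real.pi_pos hn
  rw [← cylMap_coords h, cylMap,
    cyl_mem_page_iff (ρ := (coords (ang n k) p).2.1) (Real.sqrt_nonneg _)] at hj
  obtain ⟨⟨m, hm⟩, -⟩ := hj
  have := ang_unique (lt_of_lt_of_le hα (by rw [mul_div_assoc]; linarith)) hm
  exact ⟨this.1, (coords_fst_eq_iff h).1 this.2⟩

/-- In a sector, the chosen class of return paths comes from a segment in coordinates. -/
theorem ret_eq_sideReturn {n : ℕ} {k : Fin n} {Q : Set (ℝ × ℝ)}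
    (hQ : ∀ q ∈ Q, (q.1 - 1) ^ 2 + q.2 ^ 2 ≠ 1 / 16) {y : Compl n} (h : 0 < rad (ang n k) y.1)
    (hα : |(coords (ang n k) y.1).1 - ang n k| < Real.pi / n)
    (hyQ : tng (ang n k) y.1 = 0 → (rad (ang n k) y.1, y.1 2) ∈ Q) :
    ∃ e : ℝ, (e = 1 ∨ e = -1) ∧ 0 ≤ e * ((coords (ang n k) y.1).1 - ang n k) ∧
      ∃ hs, ret y = .mk (sideReturn k e y h hs) := by
  have hn : (0 : ℝ) < n := by exact_mod_cast k.pos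
  have hpi : 0 < Real.pi / n := div_pos Real.pi_pos hn
  have hmem := coords_mem_sectorSet h hα.le hyQ
  by_cases hy : y.1 ∈ offPages n
  · obtain ⟨e, he, hpos⟩ : ∃ e : ℝ, (e = 1 ∨ e = -1) ∧
        0 ≤ e * ((coords (ang n k) y.1).1 - ang n k) := by
      rcases le_total 0 ((coords (ang n k) y.1).1 - ang n k) with h | h
      · exact ⟨1, .inl rfl, by linarith⟩
      · exact ⟨-1, .inr rfl, by linarith⟩
    have hs : ∀ s : I, cylMap (slide n k e (coords (ang n k) y.1) s) ∉ beads (std n) := fun s =>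
      cylMap_notMem_of_mem_sectorSet hQ (slide_mem he hmem hpos s.2)
    refine ⟨e, he, hpos, hs, ?_⟩
    rw [ret, dif_pos hy]
    -- The straight path and the slide both stay in the simply connected complement of the pages: a
    -- slide could meet a page only at time 0, and its starting point is off the pages.
    refine Path.Homotopic.Quotient.eq.2
      (homotopic_of_mem_offPages _ _ (straight_mem y hy) fun s j hj => ?_)
    change cylMap (slide n k e (coords (ang n k) y.1) s) ∈ _ at hj
    have hj' := hj
    rw [cylMap, cyl_mem_page_iff (slide_mem he hmem hpos s.2).2.1] at hj'
    obtain ⟨⟨m, hm⟩, -⟩ := hj'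
    have hu := ang_unique (lt_of_le_of_lt (abs_slide_le he hα.le s.2)
      (by rw [mul_div_assoc]; linarith)) hm
    have hs0 := slide_fst_eq he hpos s.2 hu.2
    rw [hs0, slide_zero, cylMap_coords h] at hj
    exact hy j hj
  · have key : ∃ k' : Fin n, ∃ hk' : y.1 ∈ page (ang n k'), ret y = .mk (sideReturn k' (-1) y
        (rad_pos_of_mem_page hk') (sideReturn_aux hk')) :=
      ⟨_, (exists_page_of_notMem hy).choose_spec, by rw [ret, dif_neg hy]⟩
    obtain ⟨k', hk', hret⟩ := key
    obtain ⟨rfl, ht⟩ := page_eq h hα hk'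
    exact ⟨-1, .inr rfl, by rw [coords_fst_of_tng ht]; simp, _, hret⟩

theorem lifts_sideReturn {n : ℕ} {k : Fin n} {e : ℝ} (he : e = 1 ∨ e = -1) {Q : Set (ℝ × ℝ)}
    (hQ : ∀ q ∈ Q, (q.1 - 1) ^ 2 + q.2 ^ 2 ≠ 1 / 16) {y : Compl n} (hy : 0 < rad (ang n k) y.1)
    (hs : ∀ s : I, cylMap (slide n k e (coords (ang n k) y.1) s) ∉ beads (std n))
    (ha : coords (ang n k) y.1 ∈ sectorSet n k Q)
    (h : 0 ≤ e * ((coords (ang n k) y.1).1 - ang n k)) :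
    Lifts (sectorMap hQ) (slidePath he ha h) (sideReturn k e y hy hs) := fun _ => rfl

/-- A loop that lifts to a path in a sector is a word in the meridians. -/
theorem isWord_of_lifts {n : ℕ} {k : Fin n} {Q : Set (ℝ × ℝ)}
    (hQ : ∀ q ∈ Q, (q.1 - 1) ^ 2 + q.2 ^ 2 ≠ 1 / 16) (hc : Convex ℝ Q) {q : ℝ × ℝ} (hq : q ∈ Q)
    (hq0 : 0 ≤ q.1) {e e' : ℝ} (he : e = 1 ∨ e = -1) (he' : e' = 1 ∨ e' = -1)
    (p : Path (⟨_, end_mem he⟩ : sectorSet n k Q) ⟨_, end_mem he'⟩)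
    (γ : Path (base n) (base n)) (h : Lifts (sectorMap hQ) p γ) : IsWord (.mk γ) := by
  have hq1 : (ang n k, q) ∈ sectorSet n k Q := by
    have hn : (0 : ℝ) < n := by exact_mod_cast k.pos
    have hpi : 0 < Real.pi / n := div_pos Real.pi_pos hn
    exact ⟨by simpa using hpi.le, hq0, fun _ => hq⟩
  have := simplyConnectedSpace_of_starConvex (starConvex_sectorSet k hc hq hq0) hq1
  have hcont := continuous_sectorMap (k := k) hQ
  let d : Path (⟨_, end_mem (.inr rfl)⟩ : sectorSet n k Q) ⟨_, end_mem (.inl rfl)⟩ :=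
    { toFun := fun s => ⟨(ang n k + (2 * s - 1) * Real.pi / n,
        q.1 * Real.sin (Real.pi * s), 2 + (q.2 - 2) * Real.sin (Real.pi * s)),
        abs_two_mul_sub_one_le k s, mul_nonneg hq0 (sin_pi_mul_nonneg s), fun h => by
          rw [eq_half_of_ang h, sin_pi_half]; simpa using hq⟩
      continuous_toFun := by
        refine Continuous.subtype_mk ?_ _
        fun_prop
      source' := by
        apply Subtype.ext
        simp; ring
      target' := by
        apply Subtype.ext
        simp; ring }
  have hd : Lifts (sectorMap hQ) d (dip k q hq0 (hQ q hq)) := fun _ => rfl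
  -- The sector set is simply connected, so only the two edges matter: equal edges give the trivial
  -- loop, opposite edges the dip at `q` or its inverse.
  rcases he with rfl | rfl <;> rcases he' with rfl | rfl
  · have : γ.Homotopic (Path.refl _) := h.homotopic hcont (q := Path.refl _) fun t => by
      change sectorMap hQ _ = base n
      rw [← γ.source, ← h 0, p.source]; rfl
    rw [Path.Homotopic.Quotient.eq.2 this]
    exact IsWord.refl n
  · rw [Path.Homotopic.Quotient.eq.2 (h.homotopic hcont hd.symm)]
    exact (isWord_dip k q hq0 (hQ q hq)).symm
  · rw [Path.Homotopic.Quotient.eq.2 (h.homotopic hcont hd)]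
    exact isWord_dip k q hq0 (hQ q hq)
  · have : γ.Homotopic (Path.refl _) := h.homotopic hcont (q := Path.refl _) fun t => by
      change sectorMap hQ _ = base n
      rw [← γ.source, ← h 0, p.source]; rfl
    rw [Path.Homotopic.Quotient.eq.2 this]
    exact IsWord.refl n

end Necklace

end

/-! ### Cutting an arbitrary loop into words -/

noncomputable section

namespace Necklace

open Set Topology unitInterval

/-- Off the pages, following the path and then returning is homotopic to returning directly, so the
closed-up piece is trivial. -/
theorem isWord_ret_of_mem_offPages {n : ℕ} {y₁ y₂ : Compl n} (γ : Path y₁ y₂)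
    (h : ∀ s, (γ s).1 ∈ offPages n) :
    IsWord ((ret y₁).symm.trans ((Path.Homotopic.Quotient.mk γ).trans (ret y₂))) := by
  have h1 : y₁.1 ∈ offPages n := by have := h 0; rwa [γ.source] at this
  have h2 : y₂.1 ∈ offPages n := by have := h 1; rwa [γ.target] at this
  have : (Path.Homotopic.Quotient.mk γ).trans (ret y₂) = ret y₁ := by
    rw [ret, dif_pos h2, ret, dif_pos h1, ← Path.Homotopic.Quotient.mk_trans]
    refine Path.Homotopic.Quotient.eq.2 (homotopic_of_mem_offPages _ _ (fun s => ?_)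
      (straight_mem _ h1))
    rw [Path.trans_apply]
    split_ifs
    · exact h _
    · exact straight_mem _ h2 _
  rw [this, Path.Homotopic.Quotient.symm_trans]
  exact IsWord.refl n

/-- The path and both return paths lift together to one path of the sector set that joins edge
points. -/
theorem isWord_ret_of_mem_sector {n : ℕ} {k : Fin n} {Q : Set (ℝ × ℝ)}
    (hQ : ∀ q ∈ Q, (q.1 - 1) ^ 2 + q.2 ^ 2 ≠ 1 / 16) (hc : Convex ℝ Q) {q : ℝ × ℝ} (hq : q ∈ Q)
    (hq0 : 0 ≤ q.1) {y₁ y₂ : Compl n} (γ : Path y₁ y₂) (h : ∀ s, 0 < rad (ang n k) (γ s).1)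
    (hα : ∀ s, |(coords (ang n k) (γ s).1).1 - ang n k| < Real.pi / n)
    (hyQ : ∀ s, tng (ang n k) (γ s).1 = 0 → (rad (ang n k) (γ s).1, (γ s).1 2) ∈ Q) :
    IsWord ((ret y₁).symm.trans ((Path.Homotopic.Quotient.mk γ).trans (ret y₂))) := by
  obtain ⟨h0, hα0, hQ0⟩ : 0 < rad (ang n k) y₁.1 ∧
      |(coords (ang n k) y₁.1).1 - ang n k| < Real.pi / n ∧
      (tng (ang n k) y₁.1 = 0 → (rad (ang n k) y₁.1, y₁.1 2) ∈ Q) := by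
    have := And.intro (h 0) (And.intro (hα 0) (hyQ 0))
    rwa [γ.source] at this
  obtain ⟨h1, hα1, hQ1⟩ : 0 < rad (ang n k) y₂.1 ∧
      |(coords (ang n k) y₂.1).1 - ang n k| < Real.pi / n ∧
      (tng (ang n k) y₂.1 = 0 → (rad (ang n k) y₂.1, y₂.1 2) ∈ Q) := by
    have := And.intro (h 1) (And.intro (hα 1) (hyQ 1))
    rwa [γ.target] at this
  obtain ⟨e, he, hpos, hs, hret⟩ := ret_eq_sideReturn hQ h0 hα0 hQ0
  obtain ⟨e', he', hpos', hs', hret'⟩ := ret_eq_sideReturn hQ h1 hα1 hQ1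
  have m0 := coords_mem_sectorSet h0 hα0.le hQ0
  have m1 := coords_mem_sectorSet h1 hα1.le hQ1
  let p : Path (⟨_, m0⟩ : sectorSet n k Q) ⟨_, m1⟩ :=
    { toFun := fun s => ⟨coords (ang n k) (γ s).1,
        coords_mem_sectorSet (h s) (hα s).le (hyQ s)⟩
      continuous_toFun := by
        refine Continuous.subtype_mk (continuous_iff_continuousAt.2 fun s => ?_) _
        exact ContinuousAt.comp (f := fun s => (γ s).1) (continuousAt_coords (h s))
          (continuous_subtype_val.comp γ.continuous).continuousAt
      source' := by
        apply Subtype.ext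
        exact congrArg (fun q : Compl n => coords (ang n k) q.1) γ.source
      target' := by
        apply Subtype.ext
        exact congrArg (fun q : Compl n => coords (ang n k) q.1) γ.target }
  have hp : Lifts (sectorMap hQ) p γ := fun s => Subtype.ext (cylMap_coords (h s))
  rw [hret, hret', ← Path.Homotopic.Quotient.mk_trans, ← Path.Homotopic.Quotient.mk_symm,
    ← Path.Homotopic.Quotient.mk_trans]
  exact isWord_of_lifts hQ hc hq hq0 he he' _ _
    ((lifts_sideReturn he hQ h0 hs m0 hpos).symm.trans
      (hp.trans (lifts_sideReturn he' hQ h1 hs' m1 hpos')))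

/-- For a point on a page, `Q` is a disc of the half-plane around that point which misses the bead;
being convex, it makes the sector set star-shaped. -/
theorem exists_nhds_isWord_ret {n : ℕ} (y : Compl n) : ∃ N : Set (Compl n), IsOpen N ∧ y ∈ N ∧
    ∀ {y₁ y₂ : Compl n} (γ : Path y₁ y₂), (∀ s, γ s ∈ N) →
      IsWord ((ret y₁).symm.trans ((Path.Homotopic.Quotient.mk γ).trans (ret y₂))) := by
  by_cases hy : y.1 ∈ offPages n
  · exact ⟨Subtype.val ⁻¹' offPages n, (isOpen_offPages n).preimage continuous_subtype_val, hy,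
      fun γ h => isWord_ret_of_mem_offPages γ h⟩
  obtain ⟨k, hk⟩ := exists_page_of_notMem hy
  have hr := rad_pos_of_mem_page hk
  have hn : (0 : ℝ) < n := by exact_mod_cast k.pos
  have hpi : 0 < Real.pi / n := div_pos Real.pi_pos hn
  set q : ℝ × ℝ := (rad (ang n k) y.1, y.1 2) with hq
  have hqc : (q.1 - 1) ^ 2 + q.2 ^ 2 ≠ 1 / 16 := fun e =>
    y.2 (mem_beads_std_iff.2 ⟨k, hk.1, e⟩)
  have hopen : IsOpen {q : ℝ × ℝ | (q.1 - 1) ^ 2 + q.2 ^ 2 ≠ 1 / 16} :=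
    isOpen_ne_fun (by fun_prop) continuous_const
  obtain ⟨δ, hδ, hball⟩ := Metric.isOpen_iff.1 hopen q hqc
  set A : Set E3 := {p | 0 < rad (ang n k) p} with hA
  have hAo : IsOpen A := isOpen_lt continuous_const (continuous_rad _)
  have hBo : IsOpen (A ∩ coords (ang n k) ⁻¹' {a | |a.1 - ang n k| < Real.pi / n}) := by
    refine ContinuousOn.isOpen_inter_preimage
      (fun p hp => (continuousAt_coords hp).continuousWithinAt) hAo ?_
    exact isOpen_lt (by fun_prop) continuous_const
  have hCo : IsOpen {p : E3 | tng (ang n k) p = 0 ∧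
      (rad (ang n k) p, p 2) ∉ Metric.ball q δ}ᶜ := by
    exact isOpen_compl_iff.2 <| (isClosed_eq (continuous_tng _) continuous_const).inter
      (Metric.isOpen_ball.isClosed_compl.preimage
        ((continuous_rad _).prodMk (continuous_coord 2)))
  refine ⟨Subtype.val ⁻¹' ((A ∩ coords (ang n k) ⁻¹' {a | |a.1 - ang n k| < Real.pi / n}) ∩
    {p : E3 | tng (ang n k) p = 0 ∧ (rad (ang n k) p, p 2) ∉ Metric.ball q δ}ᶜ),
    (hBo.inter hCo).preimage continuous_subtype_val, ⟨⟨hr, ?_⟩, ?_⟩, fun γ h => ?_⟩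
  · change |(coords _ _).1 - _| < _
    rw [coords_fst_of_tng hk.1]; simpa using hpi
  · exact fun h => h.2 (Metric.mem_ball_self hδ)
  · exact isWord_ret_of_mem_sector hball (convex_ball q δ) (Metric.mem_ball_self hδ) hr.le γ
      (fun s => (h s).1.1) (fun s => (h s).1.2) fun s ht => by
        by_contra hc
        exact (h s).2 ⟨ht, hc⟩

/-- A Lebesgue subdivision writes the loop as a product of closed-up small pieces, since consecutive
return paths cancel. At the base point the return path is constant. -/
theorem isWord_of_loop {n : ℕ} (γ : Path (base n) (base n)) : IsWord (.mk γ) := by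
  choose N hNo hyN hN using @exists_nhds_isWord_ret n
  obtain ⟨t, t0, tmono, ⟨m, hm⟩, tsub⟩ := exists_monotone_Icc_subset_open_cover_unitInterval
    (fun y => (hNo y).preimage γ.continuous) fun s _ => mem_iUnion.2 ⟨γ s, hyN _⟩
  have key : ∀ j, IsWord ((ret (γ 0)).symm.trans
      ((Path.Homotopic.Quotient.mk (γ.subpath 0 (t j))).trans (ret (γ (t j))))) := by
    intro j
    induction j with
    | zero =>
      rw [t0, Path.subpath_self, Path.Homotopic.Quotient.mk_refl,
        Path.Homotopic.Quotient.refl_trans, Path.Homotopic.Quotient.symm_trans]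
      exact IsWord.refl n
    | succ j ih =>
      obtain ⟨y, hy⟩ := tsub j
      have h2 := hN y (γ.subpath (t j) (t (j + 1))) fun s =>
        subpath_mem γ (tmono j.le_succ) (S := N y) (fun r hr => hy hr) s
      have h3 := ih.trans h2
      have e : Path.Homotopic.Quotient.mk (γ.subpath 0 (t (j + 1))) =
          (Path.Homotopic.Quotient.mk (γ.subpath 0 (t j))).trans
            (.mk (γ.subpath (t j) (t (j + 1)))) := by
        rw [← Path.Homotopic.Quotient.mk_trans]
        exact (Path.Homotopic.Quotient.eq.2 ⟨Path.Homotopy.subpathTransSubpath γ _ _ _⟩).symm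
      rw [e]
      convert h3 using 1
      simp only [Path.Homotopic.Quotient.trans_assoc]
      rw [← Path.Homotopic.Quotient.trans_assoc (ret (γ (t j))),
        Path.Homotopic.Quotient.trans_symm, Path.Homotopic.Quotient.refl_trans]
  have h1 := key m
  rw [hm m le_rfl, Path.subpath_zero_one,
    Path.Homotopic.Quotient.mk_cast] at h1
  have hret : ∀ y (e : y = base n), ret y = Path.Homotopic.Quotient.cast (.refl (base n)) e rfl := by
    rintro y rfl
    rw [ret, dif_pos (show (base n).1 ∈ offPages n from basePoint_mem_offPages n), Path.Homotopic.Quotient.cast_rfl_rfl,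
      ← Path.Homotopic.Quotient.mk_refl]
    congr 1
    refine Path.ext (funext fun s => Subtype.ext ?_)
    change (s : ℝ) • basePoint + (1 - s : ℝ) • basePoint = basePoint
    rw [← add_smul, add_sub_cancel, one_smul]
  rw [hret _ γ.source, hret _ γ.target] at h1
  have gen : ∀ (a b : Compl n) (ha : a = base n) (hb : b = base n)
      (c : Path.Homotopic.Quotient (base n) (base n)),
      (Path.Homotopic.Quotient.cast (.refl (base n)) ha rfl).symm.trans
        ((c.cast ha hb).trans (Path.Homotopic.Quotient.cast (.refl (base n)) hb rfl)) = c := by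
    rintro _ _ rfl rfl c
    simp only [Path.Homotopic.Quotient.cast_rfl_rfl, Path.Homotopic.Quotient.trans_refl]
    have : (Path.Homotopic.Quotient.refl (base n)).symm = .refl (base n) := by
      rw [← Path.Homotopic.Quotient.mk_refl, ← Path.Homotopic.Quotient.mk_symm, Path.refl_symm]
    rw [this, Path.Homotopic.Quotient.refl_trans]
  rw [gen] at h1
  exact h1

theorem wordClass_bijective {n : ℕ} (hn : 2 ≤ n) : Function.Bijective (wordClass n) := by
  refine ⟨wordClass_injective hn, fun a => ?_⟩
  obtain ⟨γ, hγ⟩ := Path.Homotopic.Quotient.mk_surjective a.unop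
  obtain ⟨w, hw⟩ := isWord_of_loop γ
  exact ⟨w, MulOpposite.unop_injective (hw.trans hγ)⟩

/-- A class of loops represents the word that is its transport of the identity. -/
theorem eq_wordClass_of_transport {n : ℕ} (hn : 2 ≤ n)
    {a : Path.Homotopic.Quotient (base n) (base n)} {w : FreeGroup (Fin n)}
    (h : transport a 1 = w) : a = (wordClass n w).unop := by
  obtain ⟨v, hv⟩ := (wordClass_bijective hn).2 (MulOpposite.op a)
  have e : a = (wordClass n v).unop := by rw [hv]; rfl
  rw [e, transport_wordClass hn, one_mul] at h
  rw [e, h]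

end Necklace

end

/-! ### Necessity of the two conditions -/

noncomputable section

namespace Necklace

open Set Topology unitInterval

/-! ### Free homotopy of loops -/

section Free

variable {X Y : Type*} [TopologicalSpace X] [TopologicalSpace Y]

open Path.Homotopic (Quotient)

/-- Two classes of loops, with possibly different base points, are freely homotopic. -/
def FreelyHomotopic {x y : X} (a : Quotient x x) (b : Quotient y y) : Prop :=
  ∃ κ : Quotient x y, a.trans κ = κ.trans b

theorem FreelyHomotopic.symm {x y : X} {a : Quotient x x} {b : Quotient y y}
    (h : FreelyHomotopic a b) : FreelyHomotopic b a := by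
  obtain ⟨κ, h⟩ := h
  refine ⟨κ.symm, ?_⟩
  have := congrArg (fun c => κ.symm.trans (c.trans κ.symm)) h
  simp only [Quotient.trans_assoc, Quotient.trans_symm, Quotient.trans_refl] at this
  rw [this, ← Quotient.trans_assoc, Quotient.symm_trans, Quotient.refl_trans]

theorem FreelyHomotopic.trans {x y z : X} {a : Quotient x x} {b : Quotient y y}
    {c : Quotient z z} (h : FreelyHomotopic a b) (h' : FreelyHomotopic b c) :
    FreelyHomotopic a c := by
  obtain ⟨κ, h⟩ := h
  obtain ⟨μ, h'⟩ := h'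
  exact ⟨κ.trans μ, by rw [← Quotient.trans_assoc, h, Quotient.trans_assoc, h',
    Quotient.trans_assoc]⟩

theorem FreelyHomotopic.cast {x x' : X} (a : Quotient x x) (h : x' = x) :
    FreelyHomotopic (a.cast h h) a := by
  subst h
  exact ⟨.refl _, by rw [Quotient.cast_rfl_rfl, Quotient.trans_refl, Quotient.refl_trans]⟩

theorem FreelyHomotopic.of_trans {x y : X} {a : Quotient x x} {κ : Quotient x y}
    {b : Quotient y y} (h : a = κ.trans (b.trans κ.symm)) : FreelyHomotopic a b :=
  ⟨κ, by rw [h, Quotient.trans_assoc, Quotient.trans_assoc, Quotient.symm_trans,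
    Quotient.trans_refl]⟩

theorem map_trans_quotient {x y z : X} (f : C(X, Y)) (a : Quotient x y) (b : Quotient y z) :
    (a.trans b).map f = (a.map f).trans (b.map f) := by
  induction a, b using Path.Homotopic.Quotient.ind₂ with
  | mk p q =>
    rw [← Quotient.mk_trans, ← Quotient.mk_map, ← Quotient.mk_map, ← Quotient.mk_map,
      ← Quotient.mk_trans, Path.map_trans]

theorem FreelyHomotopic.map {x y : X} {a : Quotient x x} {b : Quotient y y}
    (h : FreelyHomotopic a b) (f : C(X, Y)) : FreelyHomotopic (a.map f) (b.map f) := by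
  obtain ⟨κ, h⟩ := h
  exact ⟨κ.map f, by rw [← map_trans_quotient, h, map_trans_quotient]⟩

/-- A homotopy through loops is a free homotopy. -/
theorem FreelyHomotopic.of_homotopy {x y : X} {γ : Path x x} {δ : Path y y} (H : C(I × I, X))
    (h0 : ∀ s, H (0, s) = γ s) (h1 : ∀ s, H (1, s) = δ s) (hl : ∀ t, H (t, 0) = H (t, 1)) :
    FreelyHomotopic (Path.Homotopic.Quotient.mk γ) (.mk δ) := by
  -- The square is extended to the plane by clamping; in the simply connected plane the two halves
  -- of its boundary are homotopic.
  let Φ : ℝ × ℝ → X := fun a => H (projIcc 0 1 zero_le_one a.1, projIcc 0 1 zero_le_one a.2)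
  have hΦ : Continuous Φ := by
    refine H.continuous.comp (Continuous.prodMk ?_ ?_)
    · exact continuous_projIcc.comp continuous_fst
    · exact continuous_projIcc.comp continuous_snd
  let κ : Path x y :=
    { toFun := fun t => H (t, 0)
      continuous_toFun := by fun_prop
      source' := by rw [h0, γ.source]
      target' := by rw [h1, δ.source] }
  let p0 : Path ((0 : ℝ), (0 : ℝ)) (0, 1) :=
    { toFun := fun s => (0, s), continuous_toFun := by fun_prop
      source' := rfl, target' := rfl }
  let p1 : Path ((1 : ℝ), (0 : ℝ)) (1, 1) :=
    { toFun := fun s => (1, s), continuous_toFun := by fun_prop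
      source' := rfl, target' := rfl }
  let q0 : Path ((0 : ℝ), (0 : ℝ)) (1, 0) :=
    { toFun := fun s => (s, 0), continuous_toFun := by fun_prop
      source' := rfl, target' := rfl }
  let q1 : Path ((0 : ℝ), (1 : ℝ)) (1, 1) :=
    { toFun := fun s => (s, 1), continuous_toFun := by fun_prop
      source' := rfl, target' := rfl }
  have e : ∀ s t : I, Φ (s, t) = H (s, t) := fun s t => by
    simp only [Φ, projIcc_val]
  have l0 : Lifts Φ p0 γ := fun s => (e 0 s).trans (h0 s)
  have l1 : Lifts Φ p1 δ := fun s => (e 1 s).trans (h1 s)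
  have k0 : Lifts Φ q0 κ := fun s => e s 0
  have k1 : Lifts Φ q1 κ := fun s => (e s 1).trans (hl s).symm
  refine ⟨.mk κ, ?_⟩
  rw [← Quotient.mk_trans, ← Quotient.mk_trans]
  exact Quotient.eq.2 (Lifts.homotopic hΦ (l0.trans k1) (k0.trans l1))

end Free

/-- Freely homotopic loops at the base point represent conjugate words. -/
theorem FreelyHomotopic.exists_conj {n : ℕ} (hn : 2 ≤ n) {v w : FreeGroup (Fin n)}
    (h : FreelyHomotopic (x := base n) (y := base n) (wordClass n v).unop
      (wordClass n w).unop) : ∃ u, v = u * w * u⁻¹ := by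
  obtain ⟨κ, hκ⟩ := h
  obtain ⟨u, hu⟩ := (wordClass_bijective hn).2 (MulOpposite.op κ)
  refine ⟨u, ?_⟩
  have : wordClass n (v * u) = wordClass n (u * w) := by
    rw [map_mul, map_mul]
    apply MulOpposite.unop_injective
    have hu' : κ = (wordClass n u).unop := by rw [hu]; rfl
    rw [hu'] at hκ
    exact hκ
  exact eq_mul_inv_of_mul_eq ((wordClass_bijective hn).1 this)

/-! ### The core circle and small meridians -/

theorem transport_subpath_of_crossing {n : ℕ} (hn : 2 ≤ n) {x y : Compl n} (γ : Path x y)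
    {a s t b : I} (has : a ≤ s) (hst : s ≤ t) (htb : t ≤ b) (k : Fin n) {ρ α z : I → ℝ}
    (hγ : ∀ r, (γ r).1 = cyl (ρ r) (α r) (z r))
    (hρ : ∀ r ∈ Icc s t, 0 < ρ r) (hα : ∀ r ∈ Icc s t, |α r - ang n k| < Real.pi / n)
    (h : ∀ r ∈ Icc s t, α r = ang n k → (ρ r - 1) ^ 2 + z r ^ 2 < 1 / 16)
    (h0 : ∀ r ∈ Icc a s, γ r ∈ chart n none) (h1 : ∀ r ∈ Icc t b, γ r ∈ chart n none)
    (g : FreeGroup (Fin n)) :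
    transport (.mk (γ.subpath a b)) g = g * (side n k (α s))⁻¹ * side n k (α t) := by
  rw [transport_subpath_comp γ a s b, transport_subpath_comp γ s t b,
    transport_subpath_none γ has h0, transport_subpath_none γ htb h1,
    transport_subpath_some hn γ hst k hγ hρ hα h (h0 s ⟨has, le_rfl⟩) (h1 t ⟨le_rfl, htb⟩)]

theorem core_notMem_beads {n : ℕ} (α : ℝ) : cyl 1 α 0 ∉ beads (std n) := by
  intro h
  obtain ⟨i, -, -, hc⟩ := mem_beads_std zero_le_one h
  norm_num at hc

/-- A point of the core circle, in the complement of the beads. -/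
def corePoint (n : ℕ) (β : ℝ) : Compl n := ⟨cyl 1 β 0, core_notMem_beads β⟩

theorem continuous_corePoint (n : ℕ) : Continuous (corePoint n) :=
  (continuous_cyl continuous_const continuous_id continuous_const).subtype_mk _

theorem corePoint_add_two_pi (n : ℕ) (β : ℝ) : corePoint n (β + 2 * Real.pi) = corePoint n β := by
  apply Subtype.ext
  simp [corePoint, cyl]

/-- The core circle as a loop that starts at the angle `β`. -/
def coreLoop (n : ℕ) (β : ℝ) : Path (corePoint n β) (corePoint n β) where
  toFun s := corePoint n (β + 2 * Real.pi * s)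
  continuous_toFun := (continuous_corePoint n).comp (by fun_prop)
  source' := by simp
  target' := by simp [corePoint_add_two_pi]

theorem coreLoop_freelyHomotopic (n : ℕ) (β β' : ℝ) :
    FreelyHomotopic (Path.Homotopic.Quotient.mk (coreLoop n β)) (.mk (coreLoop n β')) := by
  refine FreelyHomotopic.of_homotopy
    ⟨fun x => corePoint n ((1 - x.1) * β + x.1 * β' + 2 * Real.pi * x.2),
      (continuous_corePoint n).comp (by fun_prop)⟩ (fun s => ?_) (fun s => ?_) fun t => ?_
  · simp [coreLoop]
  · simp [coreLoop]
  · simp [corePoint_add_two_pi]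

theorem core_mem_chart_none {n : ℕ} {k : Fin n} {α : ℝ}
    (h : |α - ang n k| ≤ Real.pi / n) (h0 : α ≠ ang n k) : corePoint n α ∈ chart n none := by
  have hn0 : (0 : ℝ) < n := by exact_mod_cast k.pos
  have hpi : 0 < Real.pi / n := div_pos Real.pi_pos hn0
  refine mem_chart_none_of_ne rfl zero_le_one fun j m hm => h0 ?_
  exact (ang_unique (lt_of_le_of_lt h (by rw [mul_div_assoc]; linarith)) hm).2

theorem ang_eq (n k : ℕ) :
    ang n k = 2 * k * (Real.pi / n) := by
  unfold ang; ring

/-- The product of the first `k` generators. -/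
def partialProd (n k : ℕ) : FreeGroup (Fin n) :=
  ((List.ofFn fun i : Fin n => FreeGroup.of i).take k).prod

theorem partialProd_succ {n k : ℕ} (hk : k < n) :
    partialProd n (k + 1) = partialProd n k * FreeGroup.of ⟨k, hk⟩ := by
  unfold partialProd
  rw [List.prod_take_succ _ _ (by simpa using hk)]
  simp

/-- Starting half-way before the first bead, the circle falls into `n` equal arcs that cross the
discs one by one, in the order of the labels. -/
theorem transport_coreLoop {n : ℕ} (hn : 2 ≤ n) (g : FreeGroup (Fin n)) :
    transport (.mk (coreLoop n (-(Real.pi / n)))) g =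
      g * (List.ofFn fun i : Fin n => FreeGroup.of i).prod := by
  have hn0 : (0 : ℝ) < n := by exact_mod_cast (by omega : 0 < n)
  have hpi : 0 < Real.pi / n := div_pos Real.pi_pos hn0
  set d := Real.pi / n with hd
  have hnd : Real.pi = n * d := by rw [hd]; field_simp
  set γ := coreLoop n (-d) with hγ
  -- Time in units of one arc: bead `k` is passed at `k + 1/2`, and the interval from `k + 1/4` to
  -- `k + 3/4` isolates the crossing.
  let τ : ∀ x : ℝ, 0 ≤ x → x ≤ n → I := fun x h0 h1 =>
    ⟨x / n, by positivity, (div_le_one hn0).2 h1⟩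
  have hval : ∀ r : I, γ r = corePoint n (-d + 2 * Real.pi * r) := fun r => rfl
  have key : ∀ (k : ℕ) (hk : (k : ℝ) ≤ n),
      transport (.mk (γ.subpath 0 (τ k k.cast_nonneg hk))) g = g * partialProd n k := by
    intro k
    induction k with
    | zero =>
      intro hk
      have : τ ((0 : ℕ) : ℝ) (Nat.cast_nonneg 0) hk = 0 := by apply Subtype.ext; simp [τ]
      rw [this, Path.subpath_self, Path.Homotopic.Quotient.mk_refl, transport_refl]
      simp [partialProd]
    | succ k ih =>
      intro hk
      have hk' : (k : ℝ) + 1 ≤ n := by exact_mod_cast hk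
      have hkn : k < n := by exact_mod_cast (by linarith : (k : ℝ) < n)
      have hk0 : (0 : ℝ) ≤ k := k.cast_nonneg
      have e0 : (k : ℝ) ≤ n := by linarith
      rw [transport_subpath_comp γ 0 (τ k k.cast_nonneg e0) _, ih e0,
        partialProd_succ hkn, ← mul_assoc]
      have ha : ang n k = 2 * k * d := ang_eq n k
      -- the angle at time `r`
      have hang : ∀ r : I, -d + 2 * Real.pi * r - ang n k = d * (2 * (n * r - k) - 1) :=
        fun r => by rw [ha, hnd]; ring
      have hle : ∀ {x y : ℝ} (hx hx' hy hy'), x ≤ y → τ x hx hx' ≤ τ y hy hy' :=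
        fun _ _ _ _ h => by
          change _ / (n : ℝ) ≤ _ / (n : ℝ)
          gcongr
      have hmul : ∀ (x : ℝ) (hx hx'), (n : ℝ) * (τ x hx hx' : ℝ) = x := fun x hx hx' => by
        change (n : ℝ) * (x / n) = x
        field_simp
      have hmem : ∀ {x y : ℝ} (hx hx' hy hy') {r : I}, r ∈ Icc (τ x hx hx') (τ y hy hy') →
          x ≤ n * r ∧ (n : ℝ) * r ≤ y := fun {x y} hx hx' hy hy' r h => by
        rw [← hmul x hx hx', ← hmul y hy hy']
        exact ⟨mul_le_mul_of_nonneg_left h.1 hn0.le, mul_le_mul_of_nonneg_left h.2 hn0.le⟩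
      have hbound : ∀ r : I, (k : ℝ) ≤ n * r → (n : ℝ) * r ≤ k + 1 →
          |-d + 2 * Real.pi * r - ang n (⟨k, hkn⟩ : Fin n)| ≤ d := fun r h1 h2 => by
        change |-d + 2 * Real.pi * r - ang n k| ≤ d
        rw [hang, abs_le]; constructor <;> nlinarith
      have e1 : (0 : ℝ) ≤ k + 1 / 4 := by linarith
      have e2 : (k : ℝ) + 1 / 4 ≤ n := by linarith
      have e3 : (0 : ℝ) ≤ k + 3 / 4 := by linarith
      have e4 : (k : ℝ) + 3 / 4 ≤ n := by linarith
      have e5 : (0 : ℝ) ≤ ((k + 1 : ℕ) : ℝ) := Nat.cast_nonneg _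
      have has : τ k k.cast_nonneg e0 ≤ τ (k + 1 / 4) e1 e2 :=
        hle k.cast_nonneg e0 e1 e2 (by linarith)
      have hst : τ (k + 1 / 4) e1 e2 ≤ τ (k + 3 / 4) e3 e4 := hle e1 e2 e3 e4 (by linarith)
      have htb : τ (k + 3 / 4) e3 e4 ≤ τ _ e5 hk := hle e3 e4 e5 hk (by push_cast; linarith)
      have hmid : ∀ r ∈ Icc (τ (k + 1 / 4) e1 e2) (τ (k + 3 / 4) e3 e4),
          |-d + 2 * Real.pi * r - ang n (⟨k, hkn⟩ : Fin n)| < d := fun r hr => by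
        change |-d + 2 * Real.pi * r - ang n k| < d
        obtain ⟨h1, h2⟩ := hmem e1 e2 e3 e4 hr
        rw [hang, abs_lt]; constructor <;> nlinarith
      have hfst : ∀ r ∈ Icc (τ k k.cast_nonneg e0) (τ (k + 1 / 4) e1 e2),
          γ r ∈ chart n none := fun r hr => by
        obtain ⟨h1, h2⟩ := hmem k.cast_nonneg e0 e1 e2 hr
        rw [hval]
        refine core_mem_chart_none (hbound r h1 (by linarith)) ?_
        change _ ≠ ang n k
        rw [← sub_ne_zero, hang]
        exact ne_of_lt (by nlinarith)
      have hlst : ∀ r ∈ Icc (τ (k + 3 / 4) e3 e4) (τ _ e5 hk), γ r ∈ chart n none :=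
        fun r hr => by
        obtain ⟨h1, h2⟩ := hmem e3 e4 e5 hk hr
        rw [hval]
        push_cast at h2
        refine core_mem_chart_none (hbound r (by linarith) h2) ?_
        change _ ≠ ang n k
        rw [← sub_ne_zero, hang]
        exact ne_of_gt (by nlinarith)
      have hs1 : -d + 2 * Real.pi * (τ (k + 1 / 4) e1 e2 : ℝ) < ang n (⟨k, hkn⟩ : Fin n) := by
        change _ < ang n k
        rw [← sub_neg, hang, hmul _ e1 e2]
        nlinarith
      have hs2 : ang n (⟨k, hkn⟩ : Fin n) < -d + 2 * Real.pi * (τ (k + 3 / 4) e3 e4 : ℝ) := by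
        change ang n k < _
        rw [← sub_pos, hang, hmul _ e3 e4]
        nlinarith
      rw [transport_subpath_of_crossing hn γ has hst htb ⟨k, hkn⟩
        (ρ := fun _ => 1) (α := fun r => -d + 2 * Real.pi * r) (z := fun _ => 0)
        (fun r => rfl) (fun _ _ => one_pos) hmid (fun r hr _ => by norm_num) hfst hlst,
        side_of_gt hs1, side_of_lt hs2]
      simp
  have h1 := key n le_rfl
  have : τ (n : ℝ) n.cast_nonneg le_rfl = 1 := by
    apply Subtype.ext
    change (n : ℝ) / n = 1
    field_simp
  rw [this, transport_subpath_zero_one] at h1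
  rw [h1, partialProd, List.take_of_length_le (by simp)]

end Necklace

end

noncomputable section

namespace Necklace

open Set Topology unitInterval

/-! ### Labelled necklaces cover necklaces -/

namespace OrderedConf

variable {n : ℕ}

/-- The unit normal of the core circle. -/
def normal (q : OrderedConf n) : E3 := q.1.1

/-- The centre of the `i`-th bead. -/
def center (q : OrderedConf n) (i : Fin n) : E3 := (q.1.2 i).1

/-- The radius of the `i`-th bead. -/
def radius (q : OrderedConf n) (i : Fin n) : ℝ := (q.1.2 i).2

@[fun_prop] theorem continuous_normal : Continuous (normal (n := n)) :=
  continuous_fst.comp continuous_subtype_val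

@[fun_prop] theorem continuous_center (i : Fin n) : Continuous fun q : OrderedConf n => q.center i :=
  continuous_fst.comp ((continuous_apply i).comp (continuous_snd.comp continuous_subtype_val))

@[fun_prop] theorem continuous_radius (i : Fin n) : Continuous fun q : OrderedConf n => q.radius i :=
  continuous_snd.comp ((continuous_apply i).comp (continuous_snd.comp continuous_subtype_val))

theorem norm_normal (q : OrderedConf n) : ‖q.normal‖ = 1 := q.2.1
theorem norm_center (q : OrderedConf n) (i : Fin n) : ‖q.center i‖ = 1 := (q.2.2.1 i).1.1
theorem inner_center_normal (q : OrderedConf n) (i : Fin n) :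
    inner ℝ (q.center i) q.normal = 0 := (q.2.2.1 i).1.2
theorem radius_pos (q : OrderedConf n) (i : Fin n) : 0 < q.radius i := (q.2.2.1 i).2.1
theorem radius_lt (q : OrderedConf n) (i : Fin n) : q.radius i < 1 / 2 := (q.2.2.1 i).2.2
theorem radius_ne (q : OrderedConf n) {i j : Fin n} (h : i ≠ j) (hc : q.center i = q.center j) :
    q.radius i ≠ q.radius j := q.2.2.2 i j h hc

theorem mem_beads_iff {q : OrderedConf n} {p : E3} : p ∈ q.beads ↔
    ∃ i, dist p (q.center i) = q.radius i ∧ inner ℝ p (cross q.normal (q.center i)) = 0 :=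
  mem_iUnion.trans (exists_congr fun i =>
    mem_beadCircle_iff q.norm_normal (q.norm_center i) (q.inner_center_normal i))

end OrderedConf

instance (n : ℕ) : T2Space (OrderedConf n) := inferInstanceAs (T2Space (Subtype _))

instance (n : ℕ) : ContinuousConstSMul (Equiv.Perm (Fin n)) (OrderedConf n) where
  continuous_const_smul π := by
    refine Continuous.subtype_mk (Continuous.prodMk ?_ (continuous_pi fun i => ?_)) _
    · exact continuous_fst.comp continuous_subtype_val
    · exact (continuous_apply (π⁻¹ i)).comp (continuous_snd.comp continuous_subtype_val)

/-- This is where beads with a common centre need distinct radii: the permutations act freely. -/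
theorem eq_one_of_smul_eq {n : ℕ} {π : Equiv.Perm (Fin n)} {q : OrderedConf n}
    (h : π • q = q) : π = 1 := by
  have h1 : ∀ i, q.1.2 (π⁻¹ i) = q.1.2 i := fun i => congrArg (fun q => q.1.2 i) h
  rw [← inv_eq_one]
  ext1 i
  by_contra hne
  exact q.radius_ne hne (congrArg Prod.fst (h1 i)) (congrArg Prod.snd (h1 i))

/-- A free action of a finite group on a Hausdorff space: each nontrivial element is separated from
the identity near `q`, and finitely many such neighbourhoods are intersected. -/
theorem isQuotientCoveringMap_mk (n : ℕ) :
    IsQuotientCoveringMap (Quotient.mk (MulAction.orbitRel (Equiv.Perm (Fin n)) (OrderedConf n)))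
      (Equiv.Perm (Fin n)) where
  __ := isQuotientMap_quotient_mk'
  continuous_const_smul := continuous_const_smul
  apply_eq_iff_mem_orbit := Quotient.eq''
  disjoint q := by
    have : ∀ π : Equiv.Perm (Fin n), ∃ U ∈ 𝓝 q, ((π • ·) '' U ∩ U).Nonempty → π = 1 := by
      intro π
      by_cases hπ : π = 1
      · exact ⟨univ, Filter.univ_mem, fun _ => hπ⟩
      · have hne : π • q ≠ q := fun h => hπ (eq_one_of_smul_eq h)
        obtain ⟨V, W, hV, hW, hqV, hqW, hd⟩ := t2_separation hne
        refine ⟨(π • ·) ⁻¹' V ∩ W, Filter.inter_mem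
          ((hV.preimage (continuous_const_smul π)).mem_nhds hqV) (hW.mem_nhds hqW), ?_⟩
        rintro ⟨_, ⟨y, hy, rfl⟩, hy'⟩
        exact (disjoint_left.1 hd hy.1 hy'.2).elim
    choose U hU hU' using this
    exact ⟨⋂ π, U π, Filter.iInter_mem.2 hU, fun π ⟨x, hx, hx'⟩ => hU' π
      ⟨x, image_mono (iInter_subset U π) hx, iInter_subset U π hx'⟩⟩

/-- A loop of necklaces is a path of labelled necklaces, from the base necklace to the base
necklace with permuted labels. -/
theorem exists_lift {n : ℕ} (Γ : Path (std n) (std n)) :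
    ∃ (q : C(I, OrderedConf n)) (π : Equiv.Perm (Fin n)), (∀ t, Quotient.mk _ (q t) = Γ t) ∧
      q 0 = stdOrdered n ∧ q 1 = π • stdOrdered n := by
  have hc := isQuotientCoveringMap_mk n
  have h0 : (Γ : C(I, Conf n)) 0 = Quotient.mk _ (stdOrdered n) := Γ.source
  refine ⟨hc.isCoveringMap.liftPath Γ (stdOrdered n) h0, ?_⟩
  have hl := hc.isCoveringMap.liftPath_lifts (Γ : C(I, Conf n)) (stdOrdered n) h0
  have hz := hc.isCoveringMap.liftPath_zero (Γ : C(I, Conf n)) (stdOrdered n) h0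
  set q := hc.isCoveringMap.liftPath Γ (stdOrdered n) h0
  have hq : ∀ t, Quotient.mk _ (q t) = Γ t := fun t => congrFun hl t
  have h1 : Quotient.mk (MulAction.orbitRel (Equiv.Perm (Fin n)) (OrderedConf n)) (q 1) =
      Quotient.mk _ (stdOrdered n) := (hq 1).trans Γ.target
  obtain ⟨π, hπ⟩ := hc.apply_eq_iff_mem_orbit.1 h1
  exact ⟨π, hq, hz, hπ.symm⟩

/-! ### Points near a bead -/

namespace OrderedConf

variable {n : ℕ}

/-- The point at height `z` over the point of the core circle that is obtained from the centre of
the `i`-th bead by a rotation of angle `β`. -/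
def tube (q : OrderedConf n) (i : Fin n) (β z : ℝ) : E3 :=
  Real.cos β • q.center i + Real.sin β • cross q.normal (q.center i) + z • q.normal

theorem tube_apply (q : OrderedConf n) (i : Fin n) (β z : ℝ) (k : Fin 3) :
    q.tube i β z k = Real.cos β * q.center i k + Real.sin β * cross q.normal (q.center i) k +
      z * q.normal k := by
  simp [tube]

@[fun_prop] theorem continuous_cross : Continuous fun x : E3 × E3 => cross x.1 x.2 := by
  unfold cross
  refine (PiLp.continuous_toLp 2 _).comp (continuous_pi fun j => ?_)
  fin_cases j <;> simp <;> fun_prop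

theorem continuous_tube {X : Type*} [TopologicalSpace X] {q : X → OrderedConf n} (i : Fin n)
    {β z : X → ℝ} (hq : Continuous q) (hβ : Continuous β) (hz : Continuous z) :
    Continuous fun x => (q x).tube i (β x) (z x) := by
  have hu : Continuous fun x => (q x).normal := continuous_normal.comp hq
  have hc : Continuous fun x => (q x).center i := (continuous_center i).comp hq
  have hx : Continuous fun x => cross (q x).normal ((q x).center i) :=
    continuous_cross.comp (hu.prodMk hc)
  unfold tube
  fun_prop

theorem dot_normal (q : OrderedConf n) :
    q.normal 0 ^ 2 + q.normal 1 ^ 2 + q.normal 2 ^ 2 = 1 := by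
  rw [← norm_sq_eq, q.norm_normal, one_pow]

theorem dot_center (q : OrderedConf n) (i : Fin n) :
    q.center i 0 ^ 2 + q.center i 1 ^ 2 + q.center i 2 ^ 2 = 1 := by
  rw [← norm_sq_eq, q.norm_center, one_pow]

theorem dot_center_normal (q : OrderedConf n) (i : Fin n) :
    q.center i 0 * q.normal 0 + q.center i 1 * q.normal 1 + q.center i 2 * q.normal 2 = 0 := by
  rw [← inner_eq, q.inner_center_normal]

/-- In the orthonormal frame formed by the centre, its cross product with the normal, and the
normal, the point has coordinates (cos β, sin β, z). This component is its distance, with sign, to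
the plane of the bead. -/
theorem inner_tube_cross (q : OrderedConf n) (i : Fin n) (β z : ℝ) :
    inner ℝ (q.tube i β z) (cross q.normal (q.center i)) = Real.sin β := by
  have h1 := q.dot_normal
  have h2 := q.dot_center i
  have h3 := q.dot_center_normal i
  rw [inner_eq]
  simp only [tube_apply, cross_zero, cross_one, cross_two]
  linear_combination (Real.sin β * (q.center i 0 ^ 2 + q.center i 1 ^ 2 + q.center i 2 ^ 2)) * h1 +
    Real.sin β * h2 - Real.sin β * (q.center i 0 * q.normal 0 + q.center i 1 * q.normal 1 +
      q.center i 2 * q.normal 2) * h3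

theorem norm_sq_tube (q : OrderedConf n) (i : Fin n) (β z : ℝ) :
    ‖q.tube i β z‖ ^ 2 = 1 + z ^ 2 := by
  have h1 := q.dot_normal
  have h2 := q.dot_center i
  have h3 := q.dot_center_normal i
  have hs := Real.sin_sq_add_cos_sq β
  rw [norm_sq_eq]
  simp only [tube_apply, cross_zero, cross_one, cross_two]
  linear_combination (Real.sin β ^ 2 * (q.center i 0 ^ 2 + q.center i 1 ^ 2 + q.center i 2 ^ 2) +
    z ^ 2) * h1 + (Real.sin β ^ 2 + Real.cos β ^ 2) * h2 + (2 * Real.cos β * z -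
      Real.sin β ^ 2 * (q.center i 0 * q.normal 0 + q.center i 1 * q.normal 1 +
      q.center i 2 * q.normal 2)) * h3 + hs

theorem inner_tube_center (q : OrderedConf n) (i : Fin n) (β z : ℝ) :
    inner ℝ (q.tube i β z) (q.center i) = Real.cos β := by
  have h2 := q.dot_center i
  have h3 := q.dot_center_normal i
  rw [inner_eq]
  simp only [tube_apply, cross_zero, cross_one, cross_two]
  linear_combination Real.cos β * h2 + z * h3

theorem inner_tube_normal (q : OrderedConf n) (i : Fin n) (β z : ℝ) :
    inner ℝ (q.tube i β z) q.normal = z := by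
  have h1 := q.dot_normal
  have h3 := q.dot_center_normal i
  rw [inner_eq]
  simp only [tube_apply, cross_zero, cross_one, cross_two]
  linear_combination z * h1 + Real.cos β * h3

theorem dist_sq_tube (q : OrderedConf n) (i : Fin n) (β z : ℝ) :
    dist (q.tube i β z) (q.center i) ^ 2 = 2 - 2 * Real.cos β + z ^ 2 := by
  rw [dist_eq_norm, norm_sub_sq_real, norm_sq_tube, inner_tube_center, q.norm_center]; ring

/-- If the top of bead `i` is in the plane of bead `j`, the two centres are equal or antipodal.
Equal centres contradict the distinctness of the radii; antipodal ones are too far apart. -/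
theorem tube_zero_notMem (q : OrderedConf n) {i j : Fin n} (h : j ≠ i) :
    ¬ (dist (q.tube i 0 (q.radius i)) (q.center j) = q.radius j ∧
      inner ℝ (q.tube i 0 (q.radius i)) (cross q.normal (q.center j)) = 0) := by
  rintro ⟨hd, hi⟩
  set s := inner ℝ (q.center i) (q.center j) with hs
  have h1 := q.dot_normal
  have hti : q.tube i 0 (q.radius i) = q.center i + q.radius i • q.normal := by
    simp [tube]
  have hc0 : inner ℝ (q.center i) (cross q.normal (q.center j)) = 0 := by
    rw [hti, inner_add_left, inner_smul_left] at hi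
    have : inner ℝ q.normal (cross q.normal (q.center j)) = 0 := by
      simp [inner_eq]; ring
    rwa [this, mul_zero, add_zero] at hi
  -- the two centres are collinear with the origin
  have hcoll : q.center i = s • q.center j := by
    have e : ‖q.center i - s • q.center j‖ ^ 2 = 0 := by
      have hs1 : s ^ 2 = 1 := by
        have key := hc0
        rw [inner_eq] at key hs
        simp only [cross_zero, cross_one, cross_two] at key
        have hi2 := q.dot_center i
        have hj2 := q.dot_center j
        have hin := q.dot_center_normal i
        have hjn := q.dot_center_normal j
        rw [hs]
        generalize q.center i = c at *
        generalize q.center j = d at *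
        generalize q.normal = u at *
        -- The square of a triple product is a Gram determinant. Here it reduces to 1 − s², and the
        -- triple product vanishes.
        have gram : (u 0 * (c 1 * d 2 - c 2 * d 1) - u 1 * (c 0 * d 2 - c 2 * d 0) +
            u 2 * (c 0 * d 1 - c 1 * d 0)) ^ 2 =
            (u 0 ^ 2 + u 1 ^ 2 + u 2 ^ 2) * ((c 0 ^ 2 + c 1 ^ 2 + c 2 ^ 2) *
              (d 0 ^ 2 + d 1 ^ 2 + d 2 ^ 2) - (c 0 * d 0 + c 1 * d 1 + c 2 * d 2) ^ 2)
            - (c 0 * u 0 + c 1 * u 1 + c 2 * u 2) * ((c 0 * u 0 + c 1 * u 1 + c 2 * u 2) *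
              (d 0 ^ 2 + d 1 ^ 2 + d 2 ^ 2) - (c 0 * d 0 + c 1 * d 1 + c 2 * d 2) *
              (d 0 * u 0 + d 1 * u 1 + d 2 * u 2))
            + (d 0 * u 0 + d 1 * u 1 + d 2 * u 2) * ((c 0 * u 0 + c 1 * u 1 + c 2 * u 2) *
              (c 0 * d 0 + c 1 * d 1 + c 2 * d 2) - (d 0 * u 0 + d 1 * u 1 + d 2 * u 2) *
              (c 0 ^ 2 + c 1 ^ 2 + c 2 ^ 2)) := by ring
        rw [h1, hi2, hj2, hin, hjn] at gram
        have z : u 0 * (c 1 * d 2 - c 2 * d 1) - u 1 * (c 0 * d 2 - c 2 * d 0) +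
            u 2 * (c 0 * d 1 - c 1 * d 0) = 0 := by linarith
        rw [z] at gram
        linarith
      rw [norm_sub_sq_real, norm_smul, mul_pow, inner_smul_right, q.norm_center, q.norm_center,
        Real.norm_eq_abs, sq_abs, ← hs]
      linarith
    rwa [sq_eq_zero_iff, norm_eq_zero, sub_eq_zero] at e
  have hs2 : s = 1 ∨ s = -1 := by
    have := congrArg norm hcoll
    rw [norm_smul, q.norm_center, q.norm_center, mul_one, Real.norm_eq_abs] at this
    exact eq_or_eq_neg_of_abs_eq this.symm
  have hd2 : dist (q.tube i 0 (q.radius i)) (q.center j) ^ 2 = 2 - 2 * s + q.radius i ^ 2 := by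
    rw [dist_eq_norm, norm_sub_sq_real, norm_sq_tube, q.norm_center, hti, inner_add_left,
      inner_smul_left, real_inner_comm, real_inner_comm (q.center j), q.inner_center_normal j,
      ← real_inner_comm, ← hs]
    simp; ring
  have hri := q.radius_pos i
  have hrj := q.radius_pos j
  rw [hd] at hd2
  rcases hs2 with hs2 | hs2
  · rw [hs2, one_smul] at hcoll
    rw [hs2] at hd2
    exact q.radius_ne h hcoll.symm ((sq_eq_sq₀ hrj.le hri.le).1 (by linarith))
  · have := q.radius_lt j
    rw [hs2] at hd2
    nlinarith

end OrderedConf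

/-- The angle and the height of a loop around a bead. -/
theorem exists_tube_notMem {n : ℕ} (q : C(I, OrderedConf n)) (i : Fin n) :
    ∃ ε : ℝ, 0 < ε ∧ ε < Real.pi / n ∧ ε ≤ 1 / 8 ∧ ∀ t s : I,
      (q t).tube i (-(ε * Real.cos (2 * Real.pi * s)))
        ((q t).radius i - ε * Real.sin (2 * Real.pi * s)) ∉ (q t).beads := by
  have hn0 : (0 : ℝ) < n := by exact_mod_cast i.pos
  let P : ℝ × I × I → E3 := fun x => (q x.2.1).tube i (-(x.1 * Real.cos (2 * Real.pi * x.2.2)))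
        ((q x.2.1).radius i - x.1 * Real.sin (2 * Real.pi * x.2.2))
  have hq : Continuous fun x : ℝ × I × I => q x.2.1 := by fun_prop
  have hr : Continuous fun x : ℝ × I × I => (q x.2.1).radius i :=
    (OrderedConf.continuous_radius i).comp hq
  have hP : Continuous P := OrderedConf.continuous_tube i hq (by fun_prop) (by fun_prop)
  -- The triples to be avoided. Bead `i` itself enters only through a bound on the size, because at
  -- size 0 the loop degenerates to a point of that bead; it is treated separately below.
  let B : Set (ℝ × I × I) := {x | (q x.2.1).radius i ≤ x.1} ∪ ⋃ j : {j : Fin n // j ≠ i},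
    {x | dist (P x) ((q x.2.1).center j) = (q x.2.1).radius j ∧
      inner ℝ (P x) (cross (q x.2.1).normal ((q x.2.1).center j)) = 0}
  have hB : IsClosed B := by
    refine (isClosed_le hr continuous_fst).union (isClosed_iUnion_of_finite fun j => ?_)
    have hc : Continuous fun x : ℝ × I × I => (q x.2.1).center j :=
      (OrderedConf.continuous_center j.1).comp hq
    have hu : Continuous fun x : ℝ × I × I => (q x.2.1).normal :=
      OrderedConf.continuous_normal.comp hq
    refine (isClosed_eq (hP.dist hc) ((OrderedConf.continuous_radius j.1).comp hq)).inter
      (isClosed_eq (hP.inner (OrderedConf.continuous_cross.comp (hu.prodMk hc)))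
        continuous_const)
  -- Projection along the compact square is closed, so one small size avoids `B` for all times and
  -- parameters.
  have hB' : IsClosed (Prod.fst '' B) := isClosedMap_fst_of_compactSpace _ hB
  have h0 : (0 : ℝ) ∈ (Prod.fst '' B)ᶜ := by
    rintro ⟨⟨x, t, s⟩, hx, rfl⟩
    rcases hx with hx | hx
    · exact absurd hx (not_le.2 ((q t).radius_pos i))
    · obtain ⟨j, hj⟩ := mem_iUnion.1 hx
      refine (q t).tube_zero_notMem j.2 ?_
      simpa [P] using hj
  obtain ⟨δ, hδ, hball⟩ := Metric.isOpen_iff.1 hB'.isOpen_compl 0 h0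
  set ε := min (δ / 2) (min (Real.pi / n / 2) (1 / 8)) with hε
  have hpin : 0 < Real.pi / n := by positivity
  have hε0 : 0 < ε := by positivity
  have hε1 : ε ≤ δ / 2 := min_le_left _ _
  have hε2 : ε ≤ Real.pi / n / 2 := (min_le_right _ _).trans (min_le_left _ _)
  have hε3 : ε ≤ 1 / 8 := (min_le_right _ _).trans (min_le_right _ _)
  have hεB : ε ∉ Prod.fst '' B :=
    hball (by rw [Metric.mem_ball, Real.dist_eq, sub_zero, abs_of_pos hε0]; linarith)
  refine ⟨ε, hε0, by linarith, hε3, fun t s hmem => hεB ⟨(ε, t, s), ?_, rfl⟩⟩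
  by_contra hB0
  simp only [B, mem_union, not_or, mem_iUnion, not_exists, mem_ofPred_eq, not_le] at hB0
  obtain ⟨j, hj⟩ := OrderedConf.mem_beads_iff.1 hmem
  by_cases hji : j = i
  -- The loop meets the plane of its own bead only where the cosine vanishes, that is at height r ±
  -- ε above the centre, and neither height equals r because 0 < ε < r.
  · subst hji
    rw [OrderedConf.inner_tube_cross] at hj
    have hcos : |Real.cos (2 * Real.pi * s)| ≤ 1 := Real.abs_cos_le_one _
    have hpi := Real.pi_gt_three
    have hβ : |ε * Real.cos (2 * Real.pi * s)| < Real.pi := by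
      rw [abs_mul, abs_of_pos hε0]; nlinarith [abs_nonneg (Real.cos (2 * Real.pi * s))]
    rw [abs_lt] at hβ
    have h3 : ε * Real.cos (2 * Real.pi * s) = 0 := by
      have := (Real.sin_eq_zero_iff_of_lt_of_lt (x := -(ε * Real.cos (2 * Real.pi * s)))
        (by linarith) (by linarith)).1 hj.2
      linarith
    have h5 : Real.cos (2 * Real.pi * s) = 0 := (mul_eq_zero.1 h3).resolve_left hε0.ne'
    have h6 := Real.sin_sq_add_cos_sq (2 * Real.pi * s)
    have h4 := (q t).dist_sq_tube j (-(ε * Real.cos (2 * Real.pi * s)))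
      ((q t).radius j - ε * Real.sin (2 * Real.pi * s))
    rw [hj.1, h3, neg_zero, Real.cos_zero] at h4
    have hr := hB0.1
    rw [h5] at h6
    have h7 : (Real.sin (2 * Real.pi * s) - 1) * (Real.sin (2 * Real.pi * s) + 1) = 0 := by
      linarith
    rcases mul_eq_zero.1 h7 with h8 | h8
    · have : Real.sin (2 * Real.pi * s) = 1 := by linarith
      rw [this] at h4; nlinarith
    · have : Real.sin (2 * Real.pi * s) = -1 := by linarith
      rw [this] at h4; nlinarith
  · exact hB0.2 ⟨j, hji⟩ hj

end Necklace

end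

noncomputable section

namespace Necklace

open Set Topology unitInterval

/-! ### Automorphisms induced by motions -/

/-- A loop that is tethered to the base point off the discs and has the monodromy of the word `w`
is freely homotopic to the loop of `w`. -/
theorem FreelyHomotopic.of_transport {n : ℕ} (hn : 2 ≤ n) {x : Compl n}
    {a : Path.Homotopic.Quotient x x} {w : FreeGroup (Fin n)} (κ : Path (base n) x)
    (hκ : ∀ s, κ s ∈ chart n none) (h : ∀ g, transport a g = g * w) :
    FreelyHomotopic a (wordClass n w).unop := by
  have e : (Path.Homotopic.Quotient.mk κ).trans (a.trans (Path.Homotopic.Quotient.mk κ).symm) =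
      (wordClass n w).unop := by
    refine eq_wordClass_of_transport hn ?_
    rw [transport_trans, transport_trans, transport_of_mem_none κ hκ, h, one_mul]
    exact transport_symm _ (transport_of_mem_none κ hκ w)
  exact (FreelyHomotopic.of_trans e.symm).symm

theorem ang_ne_of_abs_lt {n : ℕ} {k : Fin n} {α : ℝ} (h : |α - ang n k| < 2 * Real.pi / n)
    (h0 : α ≠ ang n k) (j : Fin n) (m : ℤ) : α - ang n j ≠ 2 * Real.pi * m :=
  fun hm => h0 (ang_unique h hm).2

theorem notMem_beads_of_ne {n : ℕ} {ρ α z : ℝ} (hρ : 0 ≤ ρ)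
    (h : ∀ (j : Fin n) (k : ℤ), α - ang n j ≠ 2 * Real.pi * k) : cyl ρ α z ∉ beads (std n) :=
  fun hm => by
    obtain ⟨j, -, ⟨k, hk⟩, -⟩ := mem_beads_std hρ hm
    exact h j k hk

/-- The straight path from the base point to a point of a half-plane that contains no bead. -/
def tether {n : ℕ} {α : ℝ} (h : ∀ (j : Fin n) (k : ℤ), α - ang n j ≠ 2 * Real.pi * k) (z : ℝ)
    {x : Compl n} (hx : x.1 = cyl 1 α z) : Path (base n) x where
  toFun s := ⟨cyl s α (2 + s * (z - 2)), notMem_beads_of_ne s.2.1 h⟩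
  continuous_toFun :=
    (continuous_cyl (by fun_prop) continuous_const (by fun_prop)).subtype_mk _
  source' := Subtype.ext (by simp [base, basePoint, cyl])
  target' := Subtype.ext (by simp [hx])

theorem tether_mem {n : ℕ} {α : ℝ} (h : ∀ (j : Fin n) (k : ℤ), α - ang n j ≠ 2 * Real.pi * k)
    (z : ℝ) {x : Compl n} (hx : x.1 = cyl 1 α z) (s : I) : tether h z hx s ∈ chart n none :=
  mem_chart_none_of_ne rfl s.2.1 h

theorem coreLoop_freelyHomotopic_wordClass {n : ℕ} (hn : 2 ≤ n) (β : ℝ) :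
    FreelyHomotopic (.mk (coreLoop n β))
      (wordClass n (List.ofFn fun i : Fin n => FreeGroup.of i).prod).unop := by
  have hn0 : (0 : ℝ) < n := by exact_mod_cast (by omega : 0 < n)
  have hpi : 0 < Real.pi / n := div_pos Real.pi_pos hn0
  have h : ∀ (j : Fin n) (k : ℤ), -(Real.pi / n) - ang n j ≠ 2 * Real.pi * k := by
    have e : ang n (⟨0, by omega⟩ : Fin n) = 0 := by simp [ang]
    refine ang_ne_of_abs_lt (k := ⟨0, by omega⟩) ?_ ?_
    · rw [e, sub_zero, abs_neg, abs_of_pos hpi, mul_div_assoc]; linarith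
    · rw [e]; exact (neg_lt_zero.2 hpi).ne
  refine (coreLoop_freelyHomotopic n β (-(Real.pi / n))).trans ?_
  exact .of_transport hn (tether h 0 rfl) (tether_mem h 0 rfl) (transport_coreLoop hn)

/-- A small meridian of the `k`-th bead near its top. -/
def smallMeridian {n : ℕ} (k : Fin n) (ε : ℝ) (s : ℝ) : E3 :=
  cyl 1 (ang n k + -(ε * Real.cos (2 * Real.pi * s))) (1 / 4 - ε * Real.sin (2 * Real.pi * s))

theorem continuous_smallMeridian {n : ℕ} (k : Fin n) (ε : ℝ) :
    Continuous (smallMeridian k ε) :=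
  continuous_cyl continuous_const (by fun_prop) (by fun_prop)

/-- The small meridian as a loop in the complement of the beads. -/
def smallMeridianLoop {n : ℕ} (k : Fin n) (ε : ℝ) (h : ∀ s : I, smallMeridian k ε s ∉ beads (std n)) :
    Path (⟨_, h 0⟩ : Compl n) ⟨_, h 0⟩ where
  toFun s := ⟨smallMeridian k ε s, h s⟩
  continuous_toFun := ((continuous_smallMeridian k ε).comp continuous_subtype_val).subtype_mk _
  source' := rfl
  target' := Subtype.ext (by simp [smallMeridian])

/-- In its first half the loop crosses the half-plane of the bead just below the top, hence inside
the disc and in the direction of the core circle. In the second half it returns just above the top,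
outside the disc. -/
theorem smallMeridianLoop_freelyHomotopic {n : ℕ} (hn : 2 ≤ n) (k : Fin n) {ε : ℝ} (h0 : 0 < ε)
    (hε : ε < Real.pi / n) (hε' : ε ≤ 1 / 8) (h : ∀ s : I, smallMeridian k ε s ∉ beads (std n)) :
    FreelyHomotopic (.mk (smallMeridianLoop k ε h)) (wordClass n (.of k)).unop := by
  have hpi := Real.pi_pos
  have hdist : ∀ s : ℝ, |ang n k + -(ε * Real.cos (2 * Real.pi * s)) - ang n k| < Real.pi / n :=
    fun s => by
      rw [add_sub_cancel_left, abs_neg, abs_mul, abs_of_pos h0]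
      have := Real.abs_cos_le_one (2 * Real.pi * s)
      nlinarith [abs_nonneg (Real.cos (2 * Real.pi * s))]
  have hpn : Real.pi / n < 2 * Real.pi / n := by
    rw [mul_div_assoc]; linarith
  have hne : ∀ (j : Fin n) (m : ℤ), ang n k + -(ε * Real.cos (2 * Real.pi * (0 : I))) - ang n j ≠
      2 * Real.pi * m := by
    refine ang_ne_of_abs_lt ((hdist _).trans hpn) ?_
    simp [h0.ne']
  refine .of_transport hn (tether hne _ rfl) (tether_mem hne _ rfl) fun g => ?_
  have hhalf : (0 : I) ≤ ⟨1 / 2, by norm_num, by norm_num⟩ := nonneg _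
  have hc1 : Real.cos (2 * Real.pi * (1 / 2)) = -1 := by
    rw [show 2 * Real.pi * (1 / 2) = Real.pi by ring, Real.cos_pi]
  rw [transport_of_crossing hn (smallMeridianLoop k ε h) hhalf k
    (ρ := fun _ => 1) (fun _ => rfl) (fun _ _ => one_pos) (fun s _ => hdist s)
    (fun s hs he => ?_) (fun s hs => ?_) (fun s hs => ?_), side_of_gt, side_of_lt]
  · simp
  · change _ < ang n k + -(ε * Real.cos (2 * Real.pi * (1 / 2)))
    rw [hc1]; linarith
  · simpa using h0
  · have h1 : (0 : ℝ) ≤ s := s.2.1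
    have h2 : (s : ℝ) ≤ 1 / 2 := hs.2
    have hsin : 0 ≤ Real.sin (2 * Real.pi * s) :=
      Real.sin_nonneg_of_nonneg_of_le_pi (by positivity) (by nlinarith)
    have hcos : Real.cos (2 * Real.pi * s) = 0 := by
      have : ε * Real.cos (2 * Real.pi * s) = 0 := by linarith
      exact (mul_eq_zero.1 this).resolve_left h0.ne'
    have h6 := Real.sin_sq_add_cos_sq (2 * Real.pi * s)
    rw [hcos] at h6
    have h7 : Real.sin (2 * Real.pi * s) = 1 := by nlinarith
    rw [h7]
    nlinarith
  · obtain rfl : s = 0 := le_antisymm hs (nonneg s)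
    exact mem_chart_none_of_ne rfl zero_le_one hne
  · by_cases he : ang n k + -(ε * Real.cos (2 * Real.pi * s)) = ang n k
    · refine mem_chart_none_of_lt rfl zero_le_one ?_
      have h1 : (1 / 2 : ℝ) ≤ s := hs
      have h2 : (s : ℝ) ≤ 1 := s.2.2
      have hsin : Real.sin (2 * Real.pi * s) ≤ 0 := by
        rw [← Real.sin_sub_two_pi]
        exact Real.sin_nonpos_of_nonpos_of_neg_pi_le (by nlinarith) (by nlinarith)
      have hcos : Real.cos (2 * Real.pi * s) = 0 := by
        have : ε * Real.cos (2 * Real.pi * s) = 0 := by linarith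
        exact (mul_eq_zero.1 this).resolve_left h0.ne'
      have h6 := Real.sin_sq_add_cos_sq (2 * Real.pi * s)
      rw [hcos] at h6
      have h7 : Real.sin (2 * Real.pi * s) = -1 := by nlinarith
      rw [h7]
      nlinarith
    · exact mem_chart_none_of_ne rfl zero_le_one (ang_ne_of_abs_lt ((hdist s).trans hpn) he)

theorem tube_stdOrdered {n : ℕ} (j : Fin n) (β z : ℝ) :
    (stdOrdered n).tube j β z = cyl 1 (ang n j + β) z := by
  have hc : (stdOrdered n).center j = cyl 1 (ang n j) 0 := rfl
  have hu : (stdOrdered n).normal = cyl 0 0 1 := rfl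
  refine E3.ext ?_ ?_ ?_ <;> rw [OrderedConf.tube_apply, hc, hu] <;>
    simp [Real.cos_add, Real.sin_add] <;> ring

namespace Motion

variable {n : ℕ} {Γ : Path (std n) (std n)}

theorem symm_notMem (F : Motion Γ) {t : I} {p : E3} (h : p ∉ beads (Γ t)) :
    (F.f t).symm p ∉ beads (std n) := fun hm => h (by
  rw [← F.image_beads t]
  exact ⟨_, hm, (F.f t).apply_symm_apply p⟩)

theorem induced_apply (F : Motion Γ) (a : Path.Homotopic.Quotient (base n) (base n)) :
    FreelyHomotopic (x := base n) (y := F.endMap (base n)) (F.induced a) (a.map F.endMap) := by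
  have e : F.induced a = (Path.Homotopic.Quotient.map a F.endMap).cast F.endMap_base.symm
      F.endMap_base.symm := FundamentalGroup.mapOfEq_apply ..
  rw [e]
  exact FreelyHomotopic.cast (Path.Homotopic.Quotient.map a F.endMap) F.endMap_base.symm

/-- A family of loops in the complements of the beads of the necklaces `Γ t` yields a free homotopy
between the end of the family and the image of its beginning under the end of the motion. -/
theorem freelyHomotopic_of_family (F : Motion Γ) (P : C(I × I, E3))
    (hP : ∀ t s, P (t, s) ∉ beads (Γ t)) (hl : ∀ t, P (t, 0) = P (t, 1)) {x y : Compl n}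
    {γ : Path x x} {δ : Path y y} (h0 : ∀ s, P (0, s) = (γ s).1) (h1 : ∀ s, P (1, s) = (δ s).1) :
    FreelyHomotopic ((Path.Homotopic.Quotient.mk γ).map F.endMap) (.mk δ) := by
  let H : C(I × I, Compl n) :=
    ⟨fun a => ⟨(F.f a.1).symm (P a), F.symm_notMem (hP a.1 a.2)⟩,
      (F.continuous_symm.comp (continuous_fst.prodMk P.continuous)).subtype_mk _⟩
  have hH : ∀ s, H (0, s) = γ s := fun s => Subtype.ext (by
    change (F.f 0).symm (P (0, s)) = _
    rw [F.f_zero, h0]; rfl)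
  have hE : ∀ s, F.endMap (H (1, s)) = δ s := fun s => Subtype.ext (by
    change F.f 1 ((F.f 1).symm (P (1, s))) = _
    rw [(F.f 1).apply_symm_apply, h1])
  have hL : ∀ t, H (t, 0) = H (t, 1) := fun t => Subtype.ext (by
    change (F.f t).symm (P (t, 0)) = (F.f t).symm (P (t, 1))
    rw [hl])
  let η : Path (H (1, 0)) (H (1, 0)) :=
    { toFun := fun s => H (1, s)
      continuous_toFun := by fun_prop
      source' := rfl
      target' := (hL 1).symm }
  have h2 : FreelyHomotopic (.mk γ) (.mk η) := .of_homotopy H hH (fun _ => rfl) hL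
  refine (h2.map F.endMap).trans ?_
  refine .of_homotopy ⟨fun a => δ a.2, by fun_prop⟩ (fun s => (hE s).symm) (fun _ => rfl)
    fun t => ?_
  simp

/-- The end of a motion carries a meridian to a conjugate of a meridian. -/
theorem exists_map_of (F : Motion Γ) (hn : 2 ≤ n) : ∃ π : Equiv.Perm (Fin n), ∀ i,
    FreelyHomotopic (Path.Homotopic.Quotient.map (wordClass n (.of i)).unop F.endMap)
      (wordClass n (.of (π i))).unop := by
  obtain ⟨q, π, hq, hq0, hq1⟩ := exists_lift Γ
  -- The bead labelled `i` in `π • stdOrdered n` is the standard bead `π⁻¹ i`.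
  refine ⟨π⁻¹, fun i => ?_⟩
  obtain ⟨ε, h0, hε, hε', hmem⟩ := exists_tube_notMem q i
  let P : C(I × I, E3) := ⟨fun a => (q a.1).tube i (-(ε * Real.cos (2 * Real.pi * a.2)))
        ((q a.1).radius i - ε * Real.sin (2 * Real.pi * a.2)),
    OrderedConf.continuous_tube i (by fun_prop) (by fun_prop)
      (((OrderedConf.continuous_radius i).comp (by fun_prop)).sub (by fun_prop))⟩
  have e0 : ∀ s : I, P (0, s) = smallMeridian i ε s := fun s => by
    change (q 0).tube i _ ((q 0).radius i - _) = _
    rw [hq0, tube_stdOrdered]; rfl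
  have e1 : ∀ s : I, P (1, s) = smallMeridian (π⁻¹ i) ε s := fun s => by
    change (q 1).tube i _ ((q 1).radius i - _) = _
    rw [hq1]
    exact tube_stdOrdered (π⁻¹ i) _ _
  have hP : ∀ t s, P (t, s) ∉ beads (Γ t) := fun t s => by
    rw [← hq t]; exact hmem t s
  have m0 : ∀ s : I, smallMeridian i ε s ∉ beads (std n) := fun s => by
    rw [← e0, ← Γ.source]; exact hP 0 s
  have m1 : ∀ s : I, smallMeridian (π⁻¹ i) ε s ∉ beads (std n) := fun s => by
    rw [← e1]
    have := hP 1 s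
    rwa [Γ.target] at this
  refine ((smallMeridianLoop_freelyHomotopic hn i h0 hε hε' m0).symm.map F.endMap).trans ?_
  refine .trans ?_ (smallMeridianLoop_freelyHomotopic hn (π⁻¹ i) h0 hε hε' m1)
  exact F.freelyHomotopic_of_family P hP (fun t => by simp [P]) e0 e1

theorem core_notMem {q : OrderedConf n} (i : Fin n) (β : ℝ) :
    q.tube i β 0 ∈ coreCircle q.1.1 := by
  constructor
  · rw [← sq_eq_sq₀ (norm_nonneg _) zero_le_one, q.norm_sq_tube]; ring
  · exact q.inner_tube_normal i β 0

theorem core_std_notMem_beads {p : E3} (h : p ∈ core (std n)) : p ∉ beads (std n) := by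
  intro hb
  obtain ⟨j, h1, h2⟩ := mem_beads_std_iff.1 hb
  obtain ⟨h3, h4⟩ : ‖p‖ = 1 ∧ inner ℝ p (cyl 0 0 1) = 0 := h
  have h5 := norm_sq_eq p
  rw [inner_eq] at h4
  simp only [cyl_zero, cyl_one, cyl_two] at h4
  have h6 : p 2 = 0 := by linarith
  have h7 := eq_cyl_of_tng_eq_zero h1
  have h8 : rad (ang n j) p ^ 2 = 1 := by
    have e0 : p 0 = rad (ang n j) p * Real.cos (ang n j) := congrArg (fun p : E3 => p 0) h7
    have e1 : p 1 = rad (ang n j) p * Real.sin (ang n j) := congrArg (fun p : E3 => p 1) h7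
    have := Real.sin_sq_add_cos_sq (ang n j)
    rw [h3, e0, e1, h6] at h5
    linear_combination -h5 - (rad (ang n j) p) ^ 2 * this
  rw [h6] at h2
  nlinarith

/-- The end of a motion carries the core circle to a conjugate of the core circle. -/
theorem map_prod (F : Motion Γ) (hn : 2 ≤ n) :
    FreelyHomotopic (Path.Homotopic.Quotient.map
      (wordClass n (List.ofFn fun i : Fin n => FreeGroup.of i).prod).unop F.endMap)
      (wordClass n (List.ofFn fun i : Fin n => FreeGroup.of i).prod).unop := by
  obtain ⟨q, π, hq, hq0, hq1⟩ := exists_lift Γ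
  let i : Fin n := ⟨0, by omega⟩
  let P : C(I × I, E3) := ⟨fun a => (q a.1).tube i (2 * Real.pi * a.2) 0,
    OrderedConf.continuous_tube i (by fun_prop) (by fun_prop) (by fun_prop)⟩
  have e0 : ∀ s : I, P (0, s) = (coreLoop n (ang n i) s).1 := fun s => by
    change (q 0).tube i _ _ = _
    rw [hq0, tube_stdOrdered]; rfl
  have e1 : ∀ s : I, P (1, s) = (coreLoop n (ang n (π⁻¹ i)) s).1 := fun s => by
    change (q 1).tube i _ _ = _
    rw [hq1]
    exact tube_stdOrdered (π⁻¹ i) _ _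
  -- Disjointness of core circle and beads at time `t` is inherited from the base necklace, through
  -- the injectivity of `F.f t`.
  have hP : ∀ t s, P (t, s) ∉ beads (Γ t) := fun t s hm => by
    have h1 : P (t, s) ∈ core (Γ t) := by rw [← hq t]; exact core_notMem i _
    rw [← F.image_core] at h1
    rw [← F.image_beads] at hm
    obtain ⟨a, ha, ha'⟩ := h1
    obtain ⟨b, hb, hb'⟩ := hm
    rw [← ha'] at hb'
    obtain rfl := (F.f t).injective hb'
    exact core_std_notMem_beads ha hb
  refine ((coreLoop_freelyHomotopic_wordClass hn (ang n i)).symm.map F.endMap).trans ?_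
  refine .trans ?_ (coreLoop_freelyHomotopic_wordClass hn (ang n (π⁻¹ i)))
  refine F.freelyHomotopic_of_family P hP (fun t => ?_) e0 e1
  simp [P, OrderedConf.tube]

end Motion

/-- The followed loops are not based, so they determine the images only up to conjugation, with a
separate conjugator for each loop. That is exactly what the two conditions allow. -/
theorem Induces.exists_conj {n : ℕ} (hn : 2 ≤ n) {g : FundamentalGroup (Conf n) (std n)}
    {φ : MulAut (FreeGroup (Fin n))} (h : Induces g φ) :
    (∃ (π : Equiv.Perm (Fin n)) (w : Fin n → FreeGroup (Fin n)),
      ∀ i, φ (FreeGroup.of i) = w i * FreeGroup.of (π i) * (w i)⁻¹) ∧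
    ∃ w : FreeGroup (Fin n), φ (List.ofFn fun i : Fin n => FreeGroup.of i).prod =
      w * (List.ofFn fun i : Fin n => FreeGroup.of i).prod * w⁻¹ := by
  obtain ⟨Γ, -, F, hF⟩ := h
  have key : ∀ v w : FreeGroup (Fin n), FreelyHomotopic (Path.Homotopic.Quotient.map (wordClass n v).unop F.endMap)
      (wordClass n w).unop → ∃ u, φ v = u * w * u⁻¹ := fun v w hvw => by
    refine FreelyHomotopic.exists_conj hn ?_
    rw [hF v]
    exact (F.induced_apply _).trans hvw
  obtain ⟨π, hπ⟩ := F.exists_map_of hn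
  choose w hw using fun i => key _ _ (hπ i)
  exact ⟨⟨π, w, hw⟩, key _ _ (F.map_prod hn)⟩

end Necklace

end

/-! ### Sufficiency, algebra: Artin's shortening argument -/

noncomputable section

namespace Necklace

open FreeGroup hiding map_mul map_inv map_one norm norm_mul_le

/-! ### Reduced words -/

section Words

variable {α : Type*} [DecidableEq α]

theorem isReduced_invRev {L : List (α × Bool)} (h : IsReduced L) : IsReduced (invRev L) := by
  rw [isReduced_iff_reduce_eq] at h ⊢
  rw [reduce_invRev, h]

theorem norm_mk_of_isReduced {L : List (α × Bool)} (h : IsReduced L) :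
    FreeGroup.norm (mk L) = L.length := by
  rw [FreeGroup.norm, toWord_mk, h.reduce_eq]

theorem isReduced_split {α : Type*} {L M : List (α × Bool)} {c : α × Bool}
    (h : IsReduced (L ++ [c]))
    (h' : IsReduced (c :: M)) : IsReduced (L ++ c :: M) :=
  List.isChain_split.2 ⟨h, h'⟩

/-- A letter that does not shorten a word does not cancel with its end. -/
theorem isReduced_append_of_norm_le {w : FreeGroup α} {c : α × Bool}
    (h : FreeGroup.norm w ≤ FreeGroup.norm (w * mk [c])) : IsReduced (toWord w ++ [c]) := by
  rcases List.eq_nil_or_concat' (toWord w) with hw | ⟨L, d, hw⟩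
  · rw [hw]; exact .singleton
  · have hr : IsReduced (L ++ [d]) := hw ▸ isReduced_toWord
    rw [hw, List.append_assoc]
    refine isReduced_split hr ?_
    change IsReduced [d, c]
    rw [isReduced_cons_cons]
    refine ⟨fun h1 => ?_, .singleton⟩
    by_contra h2
    have e : w * mk [c] = mk L := by
      have hd : d = (c.1, !c.2) := Prod.ext h1 (Bool.eq_not_of_ne h2)
      have h3 : mk [d] * mk [c] = 1 := by
        rw [hd, ← inv_mul_cancel (mk [c]), inv_mk]; rfl
      rw [← mk_toWord (x := w), hw, ← mul_mk, mul_assoc, h3, mul_one]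
    have h4 : FreeGroup.norm (mk L) ≤ L.length := norm_mk_le
    have h5 : FreeGroup.norm w = L.length + 1 := by rw [FreeGroup.norm, hw]; simp
    rw [e] at h
    omega

/-- If the conjugate by `w` of a letter does not shorten `w'`, then the letter does not cancel with
the beginning of `w⁻¹ w'`. -/
theorem isReduced_cons_of_norm_le {w w' : FreeGroup α} {a : α} {ε : Bool}
    (h : IsReduced (toWord w ++ [(a, !ε)]))
    (h' : FreeGroup.norm w' ≤ FreeGroup.norm (w * mk [(a, ε)] * w⁻¹ * w')) :
    IsReduced ((a, ε) :: toWord (w⁻¹ * w')) := by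
  rcases hu : toWord (w⁻¹ * w') with _ | ⟨d, L⟩
  · exact .singleton
  have hr : IsReduced (d :: L) := hu ▸ isReduced_toWord
  refine isReduced_cons_cons.2 ⟨fun h1 => ?_, hr⟩
  by_contra h2
  obtain rfl : d = (a, !ε) := Prod.ext h1.symm (Bool.eq_not_of_ne (Ne.symm h2))
  have e : w⁻¹ * w' = mk [(a, !ε)] * mk L := by
    rw [mul_mk, List.singleton_append, ← hu, mk_toWord]
  have e1 : w' = mk (toWord w ++ (a, !ε) :: L) := by
    have : mk (toWord w ++ (a, !ε) :: L) = w * (mk [(a, !ε)] * mk L) := by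
      conv_rhs => rw [← mk_toWord (x := w), mul_mk, mul_mk]
      rfl
    rw [this, ← e, mul_inv_cancel_left]
  have h3 : mk [(a, ε)] * mk [(a, !ε)] = 1 := by
    rw [← mul_inv_cancel (mk [(a, ε)]), inv_mk]; rfl
  have e2 : w * mk [(a, ε)] * w⁻¹ * w' = w * mk L := by
    rw [mul_assoc _ w⁻¹ w', e, mul_assoc w, ← mul_assoc (mk [(a, ε)]), h3, one_mul]
  have h4 : FreeGroup.norm w' = FreeGroup.norm w + (L.length + 1) := by
    rw [e1, norm_mk_of_isReduced (isReduced_split h hr), FreeGroup.norm]; simp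
  have h5 : FreeGroup.norm (w * mk L) ≤ FreeGroup.norm w + L.length :=
    (FreeGroup.norm_mul_le _ _).trans (by gcongr; exact norm_mk_le)
  rw [e2] at h'
  omega

/-- Words that are products of conjugates of generators without cancellation. -/
theorem norm_prod_conj {n : ℕ} (a : ℕ → α) (w g : ℕ → FreeGroup α) (hg0 : g 0 = w 0)
    (hg : ∀ k < n, g (k + 1) = g k * of (a k) * ((w k)⁻¹ * w (k + 1)))
    (hlast : ∀ k < n, IsReduced (toWord (w k) ++ [(a k, true)]))
    (hl : ∀ k < n, IsReduced ((a k, true) :: toWord ((w k)⁻¹ * w (k + 1))))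
    (hr : ∀ k, k + 1 < n → IsReduced (toWord ((w k)⁻¹ * w (k + 1)) ++ [(a (k + 1), true)])) :
    ∀ k ≤ n, (k < n → IsReduced (toWord (g k) ++ [(a k, true)])) ∧
      FreeGroup.norm (g k) = k + FreeGroup.norm (w 0) + ∑ j ∈ Finset.range k, FreeGroup.norm ((w j)⁻¹ * w (j + 1)) := by
  intro k
  induction k with
  | zero => exact fun _ => ⟨fun h => hg0 ▸ hlast 0 h, by simp [hg0]⟩
  | succ k ih =>
    intro hk
    obtain ⟨ih1, ih2⟩ := ih (by omega)
    have hw : toWord (g (k + 1)) = toWord (g k) ++ (a k, true) :: toWord ((w k)⁻¹ * w (k + 1)) := by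
      have e : g (k + 1) = mk (toWord (g k) ++ (a k, true) :: toWord ((w k)⁻¹ * w (k + 1))) := by
        rw [hg k hk, of]
        conv_lhs => rw [← mk_toWord (x := g k), ← mk_toWord (x := (w k)⁻¹ * w (k + 1)), mul_mk,
          mul_mk]
        simp
      rw [e, toWord_mk, (isReduced_split (ih1 hk) (hl k hk)).reduce_eq]
    refine ⟨fun hk' => ?_, ?_⟩
    · rw [hw, List.append_assoc, List.cons_append]
      refine isReduced_split (ih1 hk) ?_
      have h1 := hl k hk
      have h2 := hr k hk'
      revert h1 h2
      rcases toWord ((w k)⁻¹ * w (k + 1)) with _ | ⟨d, L⟩ <;> intro h1 h2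
      -- If the block between two generators is empty, two positive letters become adjacent, and
      -- these never cancel.
      · simp
      · rw [List.cons_append, isReduced_cons_cons]
        exact ⟨(isReduced_cons_cons.1 h1).1, h2⟩
    · rw [Finset.sum_range_succ, FreeGroup.norm, hw, List.length_append, List.length_cons]
      change FreeGroup.norm (g k) + (FreeGroup.norm _ + 1) = _
      rw [ih2]; omega

end Words

/-! ### Products of the generators -/

section Products

variable {n : ℕ} {G : Type*} [Group G]

/-- Partial products. -/
def pprod (f : Fin n → G) (k : ℕ) : G := ((List.ofFn f).take k).prod

theorem pprod_succ (f : Fin n → G) {k : ℕ} (hk : k < n) :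
    pprod f (k + 1) = pprod f k * f ⟨k, hk⟩ := by
  unfold pprod
  rw [List.prod_take_succ _ _ (by simpa using hk)]
  simp

theorem pprod_self (f : Fin n → G) : pprod f n = (List.ofFn f).prod := by
  rw [pprod, List.take_of_length_le (by simp)]

@[simp] theorem pprod_zero (f : Fin n → G) : pprod f 0 = 1 := rfl

/-- The partial products of `f` and `g` agree except possibly the one that stops between the two
modified factors. -/
theorem prod_ofFn_congr {f g : Fin n → G} {i : ℕ} (hi : i + 1 < n)
    (h : ∀ j : Fin n, (j : ℕ) ≠ i → (j : ℕ) ≠ i + 1 → f j = g j)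
    (h' : f ⟨i, by omega⟩ * f ⟨i + 1, hi⟩ = g ⟨i, by omega⟩ * g ⟨i + 1, hi⟩) :
    (List.ofFn f).prod = (List.ofFn g).prod := by
  have key : ∀ k ≤ n, k ≠ i + 1 → pprod f k = pprod g k := by
    intro k
    induction k using Nat.strong_induction_on with
    | _ k ih =>
      intro hk hki
      rcases k with _ | k
      · rfl
      by_cases hk2 : k = i + 1
      · subst hk2
        rw [pprod_succ f (by omega), pprod_succ g (by omega), pprod_succ f (by omega),
          pprod_succ g (by omega), ih i (by omega) (by omega) (by omega), mul_assoc, mul_assoc, h']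
      · rw [pprod_succ f (by omega), pprod_succ g (by omega), ih k (by omega) (by omega) hk2,
          h _ (by simpa using fun e => hki (by omega)) hk2]
  rw [← pprod_self, ← pprod_self]
  by_cases hn : n = i + 1
  · omega
  · exact key n le_rfl hn

theorem map_prod_ofFn {H : Type*} [Group H] (φ : G →* H) (f : Fin n → G) :
    φ (List.ofFn f).prod = (List.ofFn fun i => φ (f i)).prod := by
  rw [map_list_prod, List.map_ofFn]; rfl

end Products

/-- The boundary word. -/
def boundary (n : ℕ) : FreeGroup (Fin n) := (List.ofFn fun i : Fin n => FreeGroup.of i).prod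

theorem prod_ofFn_of {n : ℕ} (f : Fin n → Fin n) : (List.ofFn fun i => of (f i)).prod =
    mk (List.ofFn fun i => (f i, true)) := by
  have : ∀ L : List (Fin n), (L.map of).prod = mk (L.map fun i => (i, true)) := by
    intro L
    induction L with
    | nil => rfl
    | cons a L ih => rw [List.map_cons, List.prod_cons, ih, of, mul_mk]; rfl
  have h := this (List.ofFn f)
  rwa [List.map_ofFn, List.map_ofFn] at h

theorem isReduced_ofFn {n : ℕ} (f : Fin n → Fin n) :
    IsReduced (List.ofFn fun i => (f i, true)) := by
  have : ∀ L : List (Fin n), IsReduced (L.map fun i => (i, true)) := by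
    intro L
    induction L with
    | nil => simp
    | cons a L ih =>
      rcases L with _ | ⟨b, L⟩
      · simp
      · rw [List.map_cons, List.map_cons, isReduced_cons_cons]
        exact ⟨fun _ => rfl, ih⟩
  have h := this (List.ofFn f)
  rwa [List.map_ofFn] at h

theorem norm_boundary (n : ℕ) : FreeGroup.norm (boundary n) = n := by
  rw [boundary, prod_ofFn_of fun i => i, norm_mk_of_isReduced (isReduced_ofFn _)]
  simp

/-- Positive words are reduced, so equal products agree letter by letter. -/
theorem eq_id_of_prod_eq {n : ℕ} {f : Fin n → Fin n}
    (h : (List.ofFn fun i => of (f i)).prod = boundary n) (i : Fin n) : f i = i := by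
  rw [boundary, prod_ofFn_of f, prod_ofFn_of fun i => i] at h
  have h1 := congrArg toWord h
  rw [toWord_mk, toWord_mk, (isReduced_ofFn _).reduce_eq, (isReduced_ofFn _).reduce_eq] at h1
  exact congrArg Prod.fst (congrFun (List.ofFn_injective h1) i)

/-- A product of conjugates that admits no shortening is trivial. -/
theorem eq_one_of_prod_conj {n : ℕ} {w : Fin n → FreeGroup (Fin n)} {a : Fin n → Fin n}
    (hP : (List.ofFn fun i => w i * of (a i) * (w i)⁻¹).prod = boundary n)
    (h1 : ∀ i, ∀ ε, FreeGroup.norm (w i) ≤ FreeGroup.norm (w i * mk [(a i, ε)]))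
    (h2 : ∀ i j : Fin n, (j : ℕ) = i + 1 → FreeGroup.norm (w j) ≤ FreeGroup.norm (w i * of (a i) * (w i)⁻¹ * w j))
    (h3 : ∀ i j : Fin n, (j : ℕ) = i + 1 →
      FreeGroup.norm (w i) ≤ FreeGroup.norm (w j * (of (a j))⁻¹ * (w j)⁻¹ * w i)) (i : Fin n) : w i = 1 := by
  have hn0 : 0 < n := i.pos
  -- The value 1 at index `n` makes the last block the inverse of the last conjugator, so that the
  -- full product fits the recursion. The default letter of `a'` plays no role.
  let w' : ℕ → FreeGroup (Fin n) := fun k => if h : k < n then w ⟨k, h⟩ else 1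
  let a' : ℕ → Fin n := fun k => if h : k < n then a ⟨k, h⟩ else i
  have hw' : ∀ {k} (h : k < n), w' k = w ⟨k, h⟩ := fun h => dif_pos h
  have ha' : ∀ {k} (h : k < n), a' k = a ⟨k, h⟩ := fun h => dif_pos h
  have hwn : w' n = 1 := dif_neg (lt_irrefl n)
  let f : Fin n → FreeGroup (Fin n) := fun i => w i * of (a i) * (w i)⁻¹
  have key := norm_prod_conj (n := n) a' w' (fun k => pprod f k * w' k) (by simp) ?_ ?_ ?_ ?_
    n le_rfl
  · have h4 := key.2
    simp only [hwn, mul_one, pprod_self, f] at h4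
    rw [hP, norm_boundary] at h4
    -- The boundary word has length `n`, which the `n` generators already use up, so every other
    -- block is empty.
    have h5 : FreeGroup.norm (w' 0) = 0 := by omega
    have h6 : ∑ j ∈ Finset.range n, FreeGroup.norm ((w' j)⁻¹ * w' (j + 1)) = 0 := by omega
    rw [Finset.sum_eq_zero_iff] at h6
    have h7 : ∀ k ≤ n, w' k = 1 := by
      intro k
      induction k with
      | zero => exact fun _ => norm_eq_zero.1 h5
      | succ k ih =>
        intro hk
        have := norm_eq_zero.1 (h6 k (Finset.mem_range.2 hk))
        rwa [ih (by omega), inv_one, one_mul] at this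
    rw [← hw' i.isLt]
    exact h7 i i.isLt.le
  · intro k hk
    simp only [pprod_succ f hk, f, hw' hk, ha' hk]
    group
  · intro k hk
    rw [hw' hk, ha' hk]
    exact isReduced_append_of_norm_le (h1 _ true)
  · intro k hk
    rw [hw' hk, ha' hk]
    refine isReduced_cons_of_norm_le (isReduced_append_of_norm_le (h1 _ false)) ?_
    by_cases hk' : k + 1 < n
    · rw [hw' hk']
      exact h2 ⟨k, hk⟩ ⟨k + 1, hk'⟩ rfl
    · rw [show k + 1 = n by omega, hwn]; simp
  · intro k hk'
    have hk : k < n := by omega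
    rw [hw' hk, hw' hk', ha' hk']
    -- The lemma is applied to the inverse letter with the two neighbours exchanged; inverting the
    -- resulting word turns a statement about its beginning into one about its end.
    have e := isReduced_invRev (isReduced_cons_of_norm_le (ε := false) (w := w ⟨k + 1, hk'⟩)
      (w' := w ⟨k, hk⟩) (isReduced_append_of_norm_le (h1 ⟨k + 1, hk'⟩ true))
      (h3 ⟨k, hk⟩ ⟨k + 1, hk'⟩ rfl))
    rw [invRev_cons, ← toWord_inv] at e
    simpa [invRev] using e

/-! ### Generation by half twists and the rotation -/

section Generation

variable {n : ℕ}

/-- The automorphism `s` is the half twist of the `i`-th and the next generator. -/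
def IsTwist (s : MulAut (FreeGroup (Fin n))) (i : ℕ) (hi : i + 1 < n) : Prop :=
  s (of ⟨i, by omega⟩) = of ⟨i, by omega⟩ * of ⟨i + 1, hi⟩ * (of ⟨i, by omega⟩)⁻¹ ∧
    s (of ⟨i + 1, hi⟩) = of ⟨i, by omega⟩ ∧
    ∀ j : Fin n, (j : ℕ) ≠ i → (j : ℕ) ≠ i + 1 → s (of j) = of j

section Twist

variable {s : MulAut (FreeGroup (Fin n))} {i : ℕ} {hi : i + 1 < n}

theorem IsTwist.boundary (h : IsTwist s i hi) : s (boundary n) = boundary n := by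
  have := map_prod_ofFn (s : FreeGroup (Fin n) →* FreeGroup (Fin n)) fun i : Fin n => of i
  refine this.trans (prod_ofFn_congr hi h.2.2 ?_)
  change s _ * s _ = _
  rw [h.1, h.2.1]; group

theorem IsTwist.inv_boundary (h : IsTwist s i hi) : s⁻¹ (Necklace.boundary n) = Necklace.boundary n := by
  conv_lhs => rw [← h.boundary]
  exact s.symm_apply_apply _

theorem IsTwist.inv_apply (h : IsTwist s i hi) : s⁻¹ (of ⟨i, by omega⟩) = of ⟨i + 1, hi⟩ := by
  rw [← h.2.1]; exact s.symm_apply_apply _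

theorem IsTwist.inv_apply_succ (h : IsTwist s i hi) :
    s⁻¹ (of ⟨i + 1, hi⟩) = (of ⟨i + 1, hi⟩)⁻¹ * of ⟨i, by omega⟩ * of ⟨i + 1, hi⟩ := by
  have : s ((of ⟨i + 1, hi⟩)⁻¹ * of ⟨i, by omega⟩ * of ⟨i + 1, hi⟩) = of ⟨i + 1, hi⟩ := by
    rw [map_mul, map_mul, map_inv, h.1, h.2.1]; group
  conv_lhs => rw [← this]
  exact s.symm_apply_apply _

theorem IsTwist.inv_apply_of_ne (h : IsTwist s i hi) (j : Fin n) (h1 : (j : ℕ) ≠ i)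
    (h2 : (j : ℕ) ≠ i + 1) : s⁻¹ (of j) = of j := by
  conv_lhs => rw [← h.2.2 j h1 h2]
  exact s.symm_apply_apply _

end Twist

/-- An automorphism that permutes the generators up to conjugation and fixes the boundary word is a
product of half twists. -/
theorem mem_of_boundary {S : Subgroup (MulAut (FreeGroup (Fin n)))}
    (hS : ∀ i (hi : i + 1 < n), ∃ s ∈ S, IsTwist s i hi) :
    ∀ (N : ℕ) (φ : MulAut (FreeGroup (Fin n))) (π : Equiv.Perm (Fin n))
      (w : Fin n → FreeGroup (Fin n)), (∀ i, φ (of i) = w i * of (π i) * (w i)⁻¹) →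
      φ (boundary n) = boundary n → ∑ i, FreeGroup.norm (w i) = N → φ ∈ S := by
  intro N
  induction N using Nat.strong_induction_on with
  | _ N ih =>
  intro φ π w hφ hb hN
  -- replacing one of the conjugators by a shorter word lowers the total length
  have hsum : ∀ (i : Fin n) (v : FreeGroup (Fin n)), FreeGroup.norm v < FreeGroup.norm (w i) →
      ∑ j, FreeGroup.norm (Function.update w i v j) < N := fun i v hv => by
    rw [← hN]
    refine Finset.sum_lt_sum (fun j _ => ?_) ⟨i, Finset.mem_univ _, by simpa using hv⟩
    by_cases hj : j = i
    · subst hj; simpa using hv.le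
    · simp [hj]
  -- A conjugator matters only up to right multiplication by powers of the generator that it
  -- conjugates.
  by_cases h1 : ∀ i, ∀ ε, FreeGroup.norm (w i) ≤ FreeGroup.norm (w i * mk [(π i, ε)])
  swap
  · push Not at h1
    obtain ⟨i, ε, hlt⟩ := h1
    refine ih _ (hsum i _ hlt) φ π _ (fun j => ?_) hb rfl
    by_cases hj : j = i
    · subst hj
      have : mk [(π j, ε)] = of (π j) ∨ mk [(π j, ε)] = (of (π j))⁻¹ := by
        cases ε
        · right; rw [of, inv_mk]; rfl
        · left; rfl
      rw [Function.update_self, hφ]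
      rcases this with e | e <;> rw [e] <;> group
    · rw [Function.update_of_ne hj, hφ]
  -- Precomposing with the half twist replaces the conjugator of the right neighbour by its product
  -- with the image of the left generator, and swaps the two.
  by_cases h2 : ∀ i j : Fin n, (j : ℕ) = i + 1 →
      FreeGroup.norm (w j) ≤ FreeGroup.norm (w i * of (π i) * (w i)⁻¹ * w j)
  swap
  · push Not at h2
    obtain ⟨⟨i, hi'⟩, ⟨_, hi⟩, rfl, hlt⟩ := h2
    obtain ⟨s, hs, ht⟩ := hS i hi
    set a : Fin n := ⟨i, hi'⟩ with ha
    set b : Fin n := ⟨i + 1, hi⟩ with hbb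
    have hsa : s (of a) = of a * of b * (of a)⁻¹ := ht.1
    have hab : a ≠ b := fun h => by simp [ha, hbb] at h
    have key : φ * s ∈ S := by
      refine ih _ (hsum b _ hlt) (φ * s) (π * Equiv.swap a b) _ (fun j => ?_) ?_
        -- The new conjugators are the updated ones permuted by the swap, so their total length is
        -- unchanged by the permutation. This term also determines the family left implicit above.
        (Equiv.sum_comp (Equiv.swap a b)
          fun j => FreeGroup.norm (Function.update w b (w a * of (π a) * (w a)⁻¹ * w b) j))
      · rw [MulAut.mul_apply, Equiv.Perm.mul_apply]
        by_cases hj : j = a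
        · rw [hj, Equiv.swap_apply_left, Function.update_self, hsa, map_mul, map_mul, map_inv, hφ,
            hφ]
          group
        by_cases hj' : j = b
        · rw [hj', Equiv.swap_apply_right, Function.update_of_ne hab, ht.2.1, hφ]
        · rw [Equiv.swap_apply_of_ne_of_ne hj hj', Function.update_of_ne hj',
            ht.2.2 j (fun h => hj (Fin.ext h)) (fun h => hj' (Fin.ext h)), hφ]
      · rw [MulAut.mul_apply, ht.boundary, hb]
    simpa using S.mul_mem key (S.inv_mem hs)
  -- The mirror case: the inverse half twist shortens the conjugator of the left neighbour.
  by_cases h3 : ∀ i j : Fin n, (j : ℕ) = i + 1 →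
      FreeGroup.norm (w i) ≤ FreeGroup.norm (w j * (of (π j))⁻¹ * (w j)⁻¹ * w i)
  swap
  · push Not at h3
    obtain ⟨⟨i, hi'⟩, ⟨_, hi⟩, rfl, hlt⟩ := h3
    obtain ⟨s, hs, ht⟩ := hS i hi
    set a : Fin n := ⟨i, hi'⟩ with ha
    set b : Fin n := ⟨i + 1, hi⟩ with hbb
    have hsb : s⁻¹ (of b) = (of b)⁻¹ * of a * of b := ht.inv_apply_succ
    have hab : b ≠ a := fun h => by simp [ha, hbb] at h
    have key : φ * s⁻¹ ∈ S := by
      refine ih _ (hsum a _ hlt) (φ * s⁻¹) (π * Equiv.swap a b) _ (fun j => ?_) ?_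
        (Equiv.sum_comp (Equiv.swap a b)
          fun j => FreeGroup.norm (Function.update w a (w b * (of (π b))⁻¹ * (w b)⁻¹ * w a) j))
      · rw [MulAut.mul_apply, Equiv.Perm.mul_apply]
        by_cases hj : j = b
        · rw [hj, Equiv.swap_apply_right, Function.update_self, hsb, map_mul, map_mul,
            map_inv, hφ, hφ]
          group
        by_cases hj' : j = a
        · rw [hj', Equiv.swap_apply_left, Function.update_of_ne hab, ht.inv_apply, hφ]
        · rw [Equiv.swap_apply_of_ne_of_ne hj' hj, Function.update_of_ne hj',
            ht.inv_apply_of_ne j (fun h => hj' (Fin.ext h)) (fun h => hj (Fin.ext h)), hφ]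
      · rw [MulAut.mul_apply, ht.inv_boundary, hb]
    simpa using S.mul_mem key hs
  -- no shortening is possible
  have hprod : (List.ofFn fun i => w i * of (π i) * (w i)⁻¹).prod = boundary n := by
    rw [← hb, boundary]
    have := map_prod_ofFn (φ : FreeGroup (Fin n) →* FreeGroup (Fin n)) fun i : Fin n => of i
    refine Eq.trans ?_ this.symm
    congr 2
    funext i
    exact (hφ i).symm
  have hw := eq_one_of_prod_conj hprod h1 h2 h3
  simp only [hw, one_mul, inv_one, mul_one] at hprod hφ
  have hπ := eq_id_of_prod_eq hprod
  have : φ = 1 := by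
    have e : (φ : FreeGroup (Fin n) →* FreeGroup (Fin n)) = MonoidHom.id _ :=
      FreeGroup.ext_hom _ _ fun i => by simpa [hπ] using hφ i
    exact MulEquiv.ext fun x => DFunLike.congr_fun e x
  rw [this]
  exact S.one_mem

/-- The automorphisms that permute the generators up to conjugation and carry the boundary word to
a conjugate are generated by the rotation and one half twist. -/
theorem mem_of_conj_boundary (hn : 2 ≤ n) {S : Subgroup (MulAut (FreeGroup (Fin n)))}
    {τ s : MulAut (FreeGroup (Fin n))} (hτ : τ ∈ S) (hs : s ∈ S)
    (hτ' : ∀ k (hk : k + 1 < n), τ (of ⟨k, by omega⟩) = of ⟨k + 1, hk⟩)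
    (hτl : τ (of ⟨n - 1, by omega⟩) = of ⟨0, by omega⟩)
    (hs' : IsTwist s 0 (by omega)) {φ : MulAut (FreeGroup (Fin n))}
    (hφ : ∃ (π : Equiv.Perm (Fin n)) (w : Fin n → FreeGroup (Fin n)),
      ∀ i, φ (of i) = w i * of (π i) * (w i)⁻¹)
    (hb : ∃ w, φ (boundary n) = w * boundary n * w⁻¹) : φ ∈ S := by
  -- Conjugating by the rotation moves a half twist to the next pair of neighbours.
  have htw : ∀ i (hi : i + 1 < n), ∃ s ∈ S, IsTwist s i hi := by
    intro i
    induction i with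
    | zero => exact fun _ => ⟨s, hs, hs'⟩
    | succ i ih =>
      intro hi
      obtain ⟨s, hs, h1, h2, h3⟩ := ih (by omega)
      have hinv : ∀ k (hk : k + 1 < n), τ⁻¹ (of ⟨k + 1, hk⟩) = of ⟨k, by omega⟩ := fun k hk => by
        rw [← hτ' k hk]; exact τ.symm_apply_apply _
      have hinv0 : τ⁻¹ (of ⟨0, by omega⟩) = of ⟨n - 1, by omega⟩ := by
        rw [← hτl]; exact τ.symm_apply_apply _
      refine ⟨τ * s * τ⁻¹, S.mul_mem (S.mul_mem hτ hs) (S.inv_mem hτ), ?_, ?_, fun j hj hj' => ?_⟩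
      · rw [MulAut.mul_apply, MulAut.mul_apply, hinv i (by omega), h1, map_mul, map_mul, map_inv,
          hτ' i, hτ' (i + 1)]
      · rw [MulAut.mul_apply, MulAut.mul_apply, hinv (i + 1) hi, h2, hτ' i]
      · rw [MulAut.mul_apply, MulAut.mul_apply]
        obtain ⟨j, hjn⟩ := j
        rcases j with _ | j
        · rw [hinv0, h3 _ (by simp; omega) (by simp; omega), hτl]
        · simp only at hj hj'
          rw [hinv j hjn, h3 _ (by simp; omega) (by simp; omega), hτ' j]
  -- The rotation carries x₁⋯xₙ to x₂⋯xₙx₁, and conjugation by x₁ restores it. The composite fixes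
  -- the boundary word, hence is a product of half twists.
  have hconj0 : MulAut.conj (of (⟨0, by omega⟩ : Fin n)) ∈ S := by
    set x := of (⟨0, by omega⟩ : Fin n) with hx
    have h1 : ∀ i : Fin n, τ (of i) = of (finRotate n i) := by
      obtain ⟨m, rfl⟩ : ∃ m, n = m + 1 := ⟨n - 1, by omega⟩
      intro i
      rcases Nat.lt_or_ge (i : ℕ) m with h | h
      · rw [finRotate_of_lt h]; exact hτ' i (by omega)
      · have : i = Fin.last m := Fin.ext (by have := i.isLt; simp; omega)
        rw [this, finRotate_last]; exact hτl
    have h2 : MulAut.conj x * τ ∈ S := by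
      refine mem_of_boundary htw _ _ (finRotate n) (fun _ => x) (fun i => ?_) ?_ rfl
      · rw [MulAut.mul_apply, h1, MulAut.conj_apply]
      · obtain ⟨m, rfl⟩ : ∃ m, n = m + 1 := ⟨n - 1, by omega⟩
        have e : τ (boundary (m + 1)) = (List.ofFn fun i => of (finRotate (m + 1) i)).prod := by
          have := map_prod_ofFn (τ : FreeGroup (Fin (m + 1)) →* FreeGroup (Fin (m + 1)))
            fun i : Fin (m + 1) => of i
          refine this.trans ?_
          congr 2
          funext i
          exact h1 i
        rw [MulAut.mul_apply, MulAut.conj_apply, e, List.ofFn_succ', List.concat_eq_append,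
          List.prod_append, finRotate_last, boundary, List.ofFn_succ, List.prod_cons]
        have e2 : (fun i : Fin m => of (finRotate (m + 1) i.castSucc)) =
            fun i : Fin m => of i.succ := by
          funext i
          rw [finRotate_of_lt (by simp)]
          rfl
        rw [e2]
        simp [hx, mul_assoc]
    simpa using S.mul_mem h2 (S.inv_mem hτ)
  have hconj : ∀ i (hi : i < n), MulAut.conj (of (⟨i, hi⟩ : Fin n)) ∈ S := by
    intro i
    induction i with
    | zero => exact fun _ => hconj0
    | succ i ih =>
      intro hi
      have e : MulAut.conj (of (⟨i + 1, hi⟩ : Fin n)) =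
          τ * MulAut.conj (of (⟨i, by omega⟩ : Fin n)) * τ⁻¹ := by
        ext1 x
        rw [MulAut.mul_apply, MulAut.mul_apply, MulAut.conj_apply, MulAut.conj_apply, map_mul,
          map_mul, map_inv, hτ' i hi]
        rw [MulAut.apply_inv_self]
      rw [e]
      exact S.mul_mem (S.mul_mem hτ (ih (by omega))) (S.inv_mem hτ)
  have hinner : ∀ w : FreeGroup (Fin n), MulAut.conj w ∈ S := by
    intro w
    have : (⊤ : Subgroup (FreeGroup (Fin n))) ≤ S.comap MulAut.conj := by
      rw [← closure_range_of, Subgroup.closure_le]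
      rintro _ ⟨i, rfl⟩
      exact hconj i i.isLt
    exact this (Subgroup.mem_top w)
  obtain ⟨π, w, hw⟩ := hφ
  obtain ⟨u, hu⟩ := hb
  -- An inner automorphism corrects `φ` so that it fixes the boundary word.
  have h1 : MulAut.conj u⁻¹ * φ ∈ S := by
    refine mem_of_boundary htw _ _ π (fun i => u⁻¹ * w i) (fun i => ?_) ?_ rfl
    · rw [MulAut.mul_apply, hw, MulAut.conj_apply]; group
    · rw [MulAut.mul_apply, hu, MulAut.conj_apply]; group
  have h2 := S.mul_mem (hinner u) h1
  rwa [← mul_assoc, ← map_mul, mul_inv_cancel, map_one, one_mul] at h2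

end Generation

end Necklace

end

/-! ### Sufficiency, geometry: composing and realizing motions -/

noncomputable section

namespace Necklace

open Set Topology unitInterval

/-! ### The automorphisms realized by motions form a subgroup -/

namespace Motion

variable {n : ℕ} {Γ Γ' : Path (std n) (std n)}

theorem image_core_one (F : Motion Γ) : F.f 1 '' core (std n) = core (std n) := by
  rw [F.image_core, Γ.target]

theorem image_beads_one (F : Motion Γ) : F.f 1 '' beads (std n) = beads (std n) := by
  rw [F.image_beads, Γ.target]

theorem induced_mk (F : Motion Γ) (γ : Path (base n) (base n)) :
    F.induced (Path.Homotopic.Quotient.mk γ) = Path.Homotopic.Quotient.mk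
      ((γ.map F.endMap.continuous).cast F.endMap_base.symm F.endMap_base.symm) :=
  FundamentalGroup.mapOfEq_apply ..

/-- The first half of the unit interval, stretched. -/
def stretchLeft (t : I) : I := projIcc 0 1 zero_le_one (2 * t : ℝ)

/-- The second half of the unit interval, stretched. -/
def stretchRight (t : I) : I := projIcc 0 1 zero_le_one (2 * t - 1 : ℝ)

@[fun_prop] theorem continuous_stretchLeft : Continuous stretchLeft :=
  continuous_projIcc.comp (by fun_prop)

@[fun_prop] theorem continuous_stretchRight : Continuous stretchRight :=
  continuous_projIcc.comp (by fun_prop)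

theorem stretchRight_of_le {t : I} (h : (t : ℝ) ≤ 1 / 2) : stretchRight t = 0 :=
  projIcc_of_le_left _ (by linarith)

theorem stretchLeft_of_ge {t : I} (h : 1 / 2 ≤ (t : ℝ)) : stretchLeft t = 1 :=
  projIcc_of_right_le _ (by linarith)

theorem trans_of_le {X : Type*} [TopologicalSpace X] {x y z : X} (γ : Path x y) (γ' : Path y z)
    {t : I} (h : (t : ℝ) ≤ 1 / 2) : γ.trans γ' t = γ (stretchLeft t) := by
  rw [Path.trans_apply, dif_pos h]
  congr 1
  rw [stretchLeft, projIcc_of_mem _ ⟨by linarith [t.2.1], by linarith⟩]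

theorem trans_of_ge {X : Type*} [TopologicalSpace X] {x y z : X} (γ : Path x y) (γ' : Path y z)
    {t : I} (h : 1 / 2 ≤ (t : ℝ)) : γ.trans γ' t = γ' (stretchRight t) := by
  rcases h.eq_or_lt with h' | h'
  · rw [trans_of_le _ _ h'.ge, stretchLeft_of_ge h, stretchRight_of_le h'.ge, γ.target, γ'.source]
  · rw [Path.trans_apply, dif_neg (not_le.2 h')]
    congr 1
    rw [stretchRight, projIcc_of_mem _ ⟨by linarith, by linarith [t.2.2]⟩]

/-- The motion `F'` followed by the motion `F`. -/
def comp (F : Motion Γ) (F' : Motion Γ') : Motion (Γ'.trans Γ) where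
  -- With clamped parameters one formula serves both halves: `F` is at the identity during the first
  -- half and `F'` rests at its end during the second.
  f t := (F'.f (stretchLeft t)).trans (F.f (stretchRight t))
  continuous_f := F.continuous_f.comp
    ((continuous_stretchRight.comp continuous_fst).prodMk
      (F'.continuous_f.comp ((continuous_stretchLeft.comp continuous_fst).prodMk continuous_snd)))
  continuous_symm := F'.continuous_symm.comp
    ((continuous_stretchLeft.comp continuous_fst).prodMk
      (F.continuous_symm.comp ((continuous_stretchRight.comp continuous_fst).prodMk continuous_snd)))
  compact_support := by
    obtain ⟨K, hK, h⟩ := F.compact_support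
    obtain ⟨K', hK', h'⟩ := F'.compact_support
    refine ⟨K ∪ K', hK.union hK', fun t p hp => ?_⟩
    rw [Homeomorph.trans_apply, h' _ _ fun hm => hp (.inr hm), h _ _ fun hm => hp (.inl hm)]
  f_zero := by
    have h1 : stretchLeft 0 = 0 := projIcc_of_le_left _ (by simp)
    rw [h1, stretchRight_of_le (by simp), F.f_zero, F'.f_zero]
    rfl
  f_base t := by rw [Homeomorph.trans_apply, F'.f_base, F.f_base]
  image_core t := by
    change (F.f (stretchRight t) ∘ F'.f (stretchLeft t)) '' _ = _
    rw [image_comp]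
    rcases le_total (t : ℝ) (1 / 2) with h | h
    · rw [trans_of_le _ _ h, stretchRight_of_le h, F'.image_core, F.f_zero]
      simp
    · rw [trans_of_ge _ _ h, stretchLeft_of_ge h, F'.image_core_one, F.image_core]
  image_beads t := by
    change (F.f (stretchRight t) ∘ F'.f (stretchLeft t)) '' _ = _
    rw [image_comp]
    rcases le_total (t : ℝ) (1 / 2) with h | h
    · rw [trans_of_le _ _ h, stretchRight_of_le h, F'.image_beads, F.f_zero]
      simp
    · rw [trans_of_ge _ _ h, stretchLeft_of_ge h, F'.image_beads_one, F.image_beads]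

theorem comp_one (F : Motion Γ) (F' : Motion Γ') (p : E3) :
    (F.comp F').f 1 p = F.f 1 (F'.f 1 p) := by
  have h1 : stretchRight 1 = 1 := projIcc_of_right_le _ (by norm_num)
  change F.f (stretchRight 1) (F'.f (stretchLeft 1) p) = _
  rw [h1, stretchLeft_of_ge (by norm_num)]

/-- The reverse of a motion. -/
def reverse (F : Motion Γ) : Motion Γ.symm where
  f t := (F.f 1).symm.trans (F.f (σ t))
  continuous_f := F.continuous_f.comp ((unitInterval.continuous_symm.comp continuous_fst).prodMk
    ((F.f 1).symm.continuous.comp continuous_snd))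
  continuous_symm := (F.f 1).continuous.comp
    (F.continuous_symm.comp ((unitInterval.continuous_symm.comp continuous_fst).prodMk
      continuous_snd))
  compact_support := by
    obtain ⟨K, hK, h⟩ := F.compact_support
    refine ⟨K, hK, fun t p hp => ?_⟩
    have : (F.f 1).symm p = p := by
      rw [Homeomorph.symm_apply_eq, h _ _ hp]
    rw [Homeomorph.trans_apply, this, h _ _ hp]
  f_zero := by
    ext1 p
    simp
  f_base t := by
    have : (F.f 1).symm basePoint = basePoint := by
      rw [Homeomorph.symm_apply_eq, F.f_base]
    rw [Homeomorph.trans_apply, this, F.f_base]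
  image_core t := by
    have : (F.f 1).symm '' core (std n) = core (std n) := by
      conv_lhs => rw [← F.image_core_one, ← image_comp]
      simp
    change (F.f (σ t) ∘ (F.f 1).symm) '' _ = _
    rw [image_comp, this, F.image_core]
    rfl
  image_beads t := by
    have : (F.f 1).symm '' beads (std n) = beads (std n) := by
      conv_lhs => rw [← F.image_beads_one, ← image_comp]
      simp
    change (F.f (σ t) ∘ (F.f 1).symm) '' _ = _
    rw [image_comp, this, F.image_beads]
    rfl

theorem reverse_one (F : Motion Γ) (p : E3) : F.reverse.f 1 p = (F.f 1).symm p := by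
  change F.f (σ 1) ((F.f 1).symm p) = _
  rw [symm_one, F.f_zero]
  rfl

theorem induced_comp (F : Motion Γ) (F' : Motion Γ')
    (a : Path.Homotopic.Quotient (base n) (base n)) :
    (F.comp F').induced a = F.induced (F'.induced a) := by
  induction a using Path.Homotopic.Quotient.ind with
  | mk γ =>
    rw [induced_mk, induced_mk, induced_mk]
    congr 1
    ext1
    funext s
    exact Subtype.ext (comp_one F F' (γ s).1)

theorem induced_reverse (F : Motion Γ) (a : Path.Homotopic.Quotient (base n) (base n)) :
    F.reverse.induced (F.induced a) = a := by
  induction a using Path.Homotopic.Quotient.ind with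
  | mk γ =>
    rw [induced_mk, induced_mk]
    congr 1
    ext1
    funext s
    refine Subtype.ext ((reverse_one F _).trans ?_)
    exact (F.f 1).symm_apply_apply _

theorem induced_reverse' (F : Motion Γ) (a : Path.Homotopic.Quotient (base n) (base n)) :
    F.induced (F.reverse.induced a) = a := by
  induction a using Path.Homotopic.Quotient.ind with
  | mk γ =>
    rw [induced_mk, induced_mk]
    congr 1
    ext1
    funext s
    refine Subtype.ext (Eq.trans (congrArg (F.f 1) (reverse_one F _)) ?_)
    exact (F.f 1).apply_symm_apply _

/-- The constant motion. -/
protected def refl (n : ℕ) : Motion (Path.refl (std n)) where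
  f _ := Homeomorph.refl E3
  continuous_f := continuous_snd
  continuous_symm := continuous_snd
  compact_support := ⟨∅, isCompact_empty, fun _ _ _ => rfl⟩
  f_zero := rfl
  f_base _ := rfl
  image_core _ := image_id _
  image_beads _ := image_id _

theorem induced_refl (a : Path.Homotopic.Quotient (base n) (base n)) :
    (Motion.refl n).induced a = a := by
  induction a using Path.Homotopic.Quotient.ind with
  | mk γ =>
    rw [induced_mk]
    rfl

/-- The isomorphism induced by the end of a motion. -/
def inducedEquiv (F : Motion Γ) :
    FundamentalGroup (Compl n) (base n) ≃* FundamentalGroup (Compl n) (base n) :=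
  { F.induced with
    invFun := F.reverse.induced
    left_inv := F.induced_reverse
    right_inv := F.induced_reverse' }

/-- The automorphism of the free group induced by the end of a motion. -/
def aut (F : Motion Γ) (hn : 2 ≤ n) : MulAut (FreeGroup (Fin n)) :=
  let W := MulEquiv.ofBijective (wordClass n) (wordClass_bijective hn)
  (W.trans (MulEquiv.op F.inducedEquiv)).trans W.symm

theorem wordClass_aut (F : Motion Γ) (hn : 2 ≤ n) (w : FreeGroup (Fin n)) :
    (wordClass n (F.aut hn w)).unop = F.induced (wordClass n w).unop := by
  have h : wordClass n (F.aut hn w) = MulEquiv.op F.inducedEquiv (wordClass n w) :=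
    (MulEquiv.ofBijective (wordClass n) (wordClass_bijective hn)).apply_symm_apply _
  rw [h]
  rfl

theorem aut_apply (F : Motion Γ) (hn : 2 ≤ n) (w : FreeGroup (Fin n)) :
    F.aut hn w = transport (F.induced (wordClass n w).unop) 1 := by
  rw [← F.wordClass_aut hn, transport_wordClass hn, one_mul]

end Motion

/-- The automorphisms that are induced by loops of necklaces. -/
def realizable (n : ℕ) : Subgroup (MulAut (FreeGroup (Fin n))) where
  carrier := {φ | ∃ g, Induces g φ}
  mul_mem' := by
    rintro φ ψ ⟨_, Γ, -, F, hF⟩ ⟨_, Γ', -, F', hF'⟩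
    refine ⟨_, Γ'.trans Γ, rfl, F.comp F', fun w => ?_⟩
    rw [MulAut.mul_apply, hF, hF']
    exact (F.induced_comp F' _).symm
  one_mem' := by
    exact ⟨_, Path.refl _, rfl, .refl n, fun w => (Motion.induced_refl _).symm⟩
  inv_mem' := by
    rintro φ ⟨_, Γ, -, F, hF⟩
    refine ⟨_, Γ.symm, rfl, F.reverse, fun w => ?_⟩
    have := hF (φ⁻¹ w)
    rw [MulAut.apply_inv_self] at this
    rw [this]
    exact (F.induced_reverse _).symm

theorem Motion.aut_mem {n : ℕ} {Γ : Path (std n) (std n)} (F : Motion Γ) (hn : 2 ≤ n) :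
    F.aut hn ∈ realizable n :=
  ⟨_, Γ, rfl, F, F.wordClass_aut hn⟩

end Necklace

end

noncomputable section

namespace Necklace

open Set Topology unitInterval

/-! ### Motions of necklaces with a fixed core circle -/

theorem mem_beadCircle_iff_exists {θ r : ℝ} {p : E3} (hr : 0 < r) :
    p ∈ beadCircle (cyl 0 0 1) (cyl 1 θ 0) r ↔
      ∃ c s : ℝ, c ^ 2 + s ^ 2 = 1 ∧ p = cyl (1 + r * c) θ (r * s) := by
  rw [mem_beadCircle_cyl hr.le]
  constructor
  · rintro ⟨h1, h2⟩
    refine ⟨(rad θ p - 1) / r, p 2 / r, ?_, ?_⟩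
    · field_simp; linarith
    · rw [mul_div_cancel₀ _ hr.ne', mul_div_cancel₀ _ hr.ne', add_sub_cancel]
      exact eq_cyl_of_tng_eq_zero h1
  · rintro ⟨c, s, h, rfl⟩
    rw [tng_cyl, rad_cyl]
    refine ⟨by simp, ?_⟩
    simp only [sub_self, Real.cos_zero, cyl_two]
    linear_combination r ^ 2 * h

/-- A family of homeomorphisms that preserves the core circle and moves each bead of the base
necklace through circles in half-planes about the axis is a motion. -/
theorem exists_motion {n : ℕ} (f : I → E3 ≃ₜ E3)
    (hf : Continuous fun x : I × E3 => f x.1 x.2)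
    (hf' : Continuous fun x : I × E3 => (f x.1).symm x.2)
    (hK : ∃ K : Set E3, IsCompact K ∧ ∀ t, ∀ p ∉ K, f t p = p)
    (h0 : f 0 = Homeomorph.refl E3) (hb : ∀ t, f t basePoint = basePoint)
    (hcore : ∀ t, f t '' core (std n) = core (std n)) (θ r : I → Fin n → ℝ)
    (hθ : ∀ i, Continuous fun t => θ t i) (hr : ∀ i, Continuous fun t => r t i)
    (hr0 : ∀ t i, 0 < r t i) (hr1 : ∀ t i, r t i < 1 / 2)
    (hbead : ∀ t (i : Fin n) c s, c ^ 2 + s ^ 2 = 1 → f t (cyl (1 + 1 / 4 * c) (ang n i) (1 / 4 * s)) =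
      cyl (1 + r t i * c) (θ t i) (r t i * s))
    (hθ0 : ∀ i, cyl 1 (θ 0 i) 0 = cyl 1 (ang n i) 0) (hr00 : ∀ i, r 0 i = 1 / 4) (π : Equiv.Perm (Fin n))
    (hθ1 : ∀ i, cyl 1 (θ 1 i) 0 = cyl 1 (ang n (π i)) 0) (hr11 : ∀ i, r 1 i = 1 / 4) :
    ∃ (Γ : Path (std n) (std n)) (F : Motion Γ), F.f = f := by
  let q : I → OrderedConf n := fun t => ⟨(cyl 0 0 1, fun i => (cyl 1 (θ t i) 0, r t i)), by
    refine ⟨?_, fun i => ⟨⟨?_, ?_⟩, hr0 t i, hr1 t i⟩, fun i j hij h hr => hij ?_⟩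
    · rw [← sq_eq_sq₀ (norm_nonneg _) zero_le_one, norm_sq_eq]; simp
    · rw [← sq_eq_sq₀ (norm_nonneg _) zero_le_one, norm_sq_eq]; simp
    · simp [inner_eq]
    · have e0 : Real.cos (θ t i) = Real.cos (θ t j) := by
        simpa using congrArg (fun p : E3 => p 0) h
      have e1 : Real.sin (θ t i) = Real.sin (θ t j) := by
        simpa using congrArg (fun p : E3 => p 1) h
      -- Admissibility comes for free: if two beads coincided, so would their outermost points, and
      -- by injectivity of `f t` the outermost points of two base beads.
      have e2 : cyl (1 + r t i * 1) (θ t i) (r t i * 0) =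
          cyl (1 + r t j * 1) (θ t j) (r t j * 0) := by
        refine E3.ext ?_ ?_ ?_ <;> simp [e0, e1, show r t i = r t j from hr]
      rw [← hbead t i 1 0 (by norm_num), ← hbead t j 1 0 (by norm_num)] at e2
      have e3 := (f t).injective e2
      have e4 : Real.cos (ang n i) = Real.cos (ang n j) := by
        have := congrArg (fun p : E3 => p 0) e3
        simp only [cyl_zero] at this
        exact mul_left_cancel₀ (by norm_num) this
      have e5 : Real.sin (ang n i) = Real.sin (ang n j) := by
        have := congrArg (fun p : E3 => p 1) e3
        simp only [cyl_one] at this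
        exact mul_left_cancel₀ (by norm_num) this
      by_contra hne
      obtain ⟨k, hk⟩ := Real.Angle.angle_eq_iff_two_pi_dvd_sub.1 (Real.Angle.cos_sin_inj e4 e5)
      exact ang_sub_ne hne k hk⟩
  have hq : Continuous q := by
    refine Continuous.subtype_mk (continuous_const.prodMk (continuous_pi fun i => ?_)) _
    exact (continuous_cyl continuous_const (hθ i) continuous_const).prodMk (hr i)
  have q0 : q 0 = stdOrdered n := by
    refine Subtype.ext (Prod.ext rfl (funext fun i => ?_))
    change (cyl 1 (θ 0 i) 0, r 0 i) = (cyl 1 (ang n i) 0, 1 / 4)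
    rw [hθ0, hr00]
  have q1 : q 1 = π⁻¹ • stdOrdered n := by
    refine Subtype.ext (Prod.ext rfl (funext fun i => ?_))
    change (cyl 1 (θ 1 i) 0, r 1 i) = (cyl 1 (ang n (π⁻¹⁻¹ i)) 0, 1 / 4)
    rw [hθ1, hr11, inv_inv]
  let Γ : Path (std n) (std n) :=
    { toFun := fun t => Quotient.mk _ (q t)
      continuous_toFun := continuous_quotient_mk'.comp hq
      source' := by rw [q0]; rfl
      target' := by
        rw [q1]
        exact Quotient.sound ⟨π⁻¹, rfl⟩ }
  refine ⟨Γ, ⟨f, hf, hf', hK, h0, hb, hcore, fun t => ?_⟩, rfl⟩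
  change f t '' (⋃ i : Fin n, beadCircle (cyl 0 0 1) (cyl 1 (ang n i) 0) (1 / 4)) =
    ⋃ i : Fin n, beadCircle (cyl 0 0 1) (cyl 1 (θ t i) 0) (r t i)
  rw [image_iUnion]
  refine iUnion_congr fun i => Set.ext fun p => ?_
  rw [mem_beadCircle_iff_exists (hr0 t i)]
  constructor
  · rintro ⟨y, hy, rfl⟩
    obtain ⟨c, s, h, rfl⟩ := (mem_beadCircle_iff_exists (by norm_num)).1 hy
    exact ⟨c, s, h, hbead t i c s h⟩
  · rintro ⟨c, s, h, rfl⟩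
    exact ⟨_, (mem_beadCircle_iff_exists (by norm_num)).2 ⟨c, s, h, rfl⟩, hbead t i c s h⟩

theorem exists_eq_cyl (p : E3) : ∃ ρ α : ℝ, 0 ≤ ρ ∧ p = cyl ρ α (p 2) := by
  refine ⟨‖(⟨p 0, p 1⟩ : ℂ)‖, Complex.arg ⟨p 0, p 1⟩, norm_nonneg _, E3.ext ?_ ?_ rfl⟩
  · rw [cyl_zero, Complex.norm_mul_cos_arg]
  · rw [cyl_one, Complex.norm_mul_sin_arg]

theorem norm_cyl_sq (ρ α z : ℝ) : ‖cyl ρ α z‖ ^ 2 = ρ ^ 2 + z ^ 2 := by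
  rw [norm_sq_eq, cyl_zero, cyl_one, cyl_two]
  linear_combination ρ ^ 2 * Real.sin_sq_add_cos_sq α

theorem mem_core_std_iff {n : ℕ} {p : E3} : p ∈ core (std n) ↔ ∃ α, p = cyl 1 α 0 := by
  change ‖p‖ = 1 ∧ inner ℝ p (cyl 0 0 1) = 0 ↔ _
  constructor
  · rintro ⟨h1, h2⟩
    obtain ⟨ρ, α, hρ, h⟩ := exists_eq_cyl p
    have h3 : p 2 = 0 := by simpa [inner_eq] using h2
    rw [h3] at h
    rw [h, ← sq_eq_sq₀ (norm_nonneg _) zero_le_one, norm_cyl_sq] at h1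
    have h4 : ρ = 1 := (sq_eq_sq₀ hρ zero_le_one).1 (by linarith)
    exact ⟨α, by rw [h, h4]⟩
  · rintro ⟨α, rfl⟩
    refine ⟨?_, by simp [inner_eq]⟩
    rw [← sq_eq_sq₀ (norm_nonneg _) zero_le_one, norm_cyl_sq]; norm_num

/-! ### The rotation -/

/-- The rotation of angle `β` about the vertical axis. -/
def rotate (β : ℝ) (p : E3) : E3 :=
  !₂[p 0 * Real.cos β - p 1 * Real.sin β, p 0 * Real.sin β + p 1 * Real.cos β, p 2]

theorem rotate_cyl (β ρ α z : ℝ) : rotate β (cyl ρ α z) = cyl ρ (α + β) z := by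
  refine E3.ext ?_ ?_ rfl
  · change ρ * Real.cos α * Real.cos β - ρ * Real.sin α * Real.sin β = ρ * Real.cos (α + β)
    rw [Real.cos_add]; ring
  · change ρ * Real.cos α * Real.sin β + ρ * Real.sin α * Real.cos β = ρ * Real.sin (α + β)
    rw [Real.sin_add]; ring

theorem continuous_rotate {X : Type*} [TopologicalSpace X] {β : X → ℝ} {p : X → E3}
    (hβ : Continuous β) (hp : Continuous p) : Continuous fun x => rotate (β x) (p x) := by
  unfold rotate
  have h : ∀ i, Continuous fun x => p x i := fun i => (continuous_coord i).comp hp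
  refine (PiLp.continuous_toLp 2 _).comp (continuous_pi fun j => ?_)
  fin_cases j
  · exact ((h 0).mul (Real.continuous_cos.comp hβ)).sub ((h 1).mul (Real.continuous_sin.comp hβ))
  · exact ((h 0).mul (Real.continuous_sin.comp hβ)).add ((h 1).mul (Real.continuous_cos.comp hβ))
  · exact h 2

theorem norm_rotate (β : ℝ) (p : E3) : ‖rotate β p‖ = ‖p‖ := by
  obtain ⟨ρ, α, -, h⟩ := exists_eq_cyl p
  rw [h, rotate_cyl, ← sq_eq_sq₀ (norm_nonneg _) (norm_nonneg _), norm_cyl_sq, norm_cyl_sq]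

theorem rotate_rotate (β γ : ℝ) (p : E3) : rotate β (rotate γ p) = rotate (β + γ) p := by
  obtain ⟨ρ, α, -, h⟩ := exists_eq_cyl p
  rw [h, rotate_cyl, rotate_cyl, rotate_cyl]
  congr 1; ring

theorem rotate_zero (p : E3) : rotate 0 p = p := by
  obtain ⟨ρ, α, -, h⟩ := exists_eq_cyl p
  rw [h, rotate_cyl, add_zero]

/-- The rotation of angle `β` near the necklace, damped away from it. -/
def spin (β : ℝ) (p : E3) : E3 := rotate (β * max 0 (min 1 (7 - 4 * ‖p‖))) p

theorem continuous_spin {X : Type*} [TopologicalSpace X] {β : X → ℝ} {p : X → E3}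
    (hβ : Continuous β) (hp : Continuous p) : Continuous fun x => spin (β x) (p x) :=
  continuous_rotate (by fun_prop) hp

theorem spin_neg_spin (β : ℝ) (p : E3) : spin (-β) (spin β p) = p := by
  unfold spin
  rw [norm_rotate, rotate_rotate, neg_mul, neg_add_cancel, rotate_zero]

/-- The damping factor is 1 up to norm 3/2, which covers every necklace, and vanishes from norm 7/4
on, before the base point at norm 2. -/
theorem spin_of_le (β : ℝ) {ρ α z : ℝ} (h : ρ ^ 2 + z ^ 2 ≤ 9 / 4) :
    spin β (cyl ρ α z) = cyl ρ (α + β) z := by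
  have h1 : ‖cyl ρ α z‖ ≤ 3 / 2 := by
    rw [← sq_le_sq₀ (norm_nonneg _) (by norm_num), norm_cyl_sq]; linarith
  rw [spin, min_eq_left (by linarith), max_eq_right zero_le_one, mul_one, rotate_cyl]

theorem spin_of_ge (β : ℝ) {p : E3} (h : 2 ≤ ‖p‖) : spin β p = p := by
  rw [spin, max_eq_left, mul_zero, rotate_zero]
  exact (min_le_right _ _).trans (by linarith)

theorem norm_basePoint : ‖basePoint‖ = 2 := by
  rw [basePoint, ← sq_eq_sq₀ (norm_nonneg _) zero_le_two, norm_cyl_sq]; norm_num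

/-- The damped rotation as a homeomorphism. -/
def spinHomeo (β : ℝ) : E3 ≃ₜ E3 where
  toFun := spin β
  invFun := spin (-β)
  left_inv := spin_neg_spin β
  right_inv p := by simpa using spin_neg_spin (-β) p
  continuous_toFun := continuous_spin continuous_const continuous_id
  continuous_invFun := continuous_spin continuous_const continuous_id

theorem ang_succ {n k : ℕ} : ang n (k + 1) = ang n k + 2 * Real.pi / n := by
  unfold ang; push_cast; ring

theorem ang_self {n : ℕ} (hn : n ≠ 0) : ang n n = 2 * Real.pi := by
  unfold ang; field_simp

theorem ang_finRotate {n : ℕ} (i : Fin n) : ∃ m : ℤ,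
    ang n i + 2 * Real.pi / n = ang n (finRotate n i) + m * (2 * Real.pi) := by
  obtain ⟨k, rfl⟩ : ∃ k, n = k + 1 := ⟨n - 1, by have := i.pos; omega⟩
  rw [← ang_succ]
  rcases Nat.lt_or_ge (i : ℕ) k with h | h
  · exact ⟨0, by rw [finRotate_of_lt h]; simp⟩
  · have : i = Fin.last k := Fin.ext (by have := i.isLt; simp; omega)
    refine ⟨1, ?_⟩
    rw [this, finRotate_last, Fin.val_last, ang_self (by omega)]
    simp [ang]

theorem cyl_add_int_mul (ρ α z : ℝ) (m : ℤ) : cyl ρ (α + m * (2 * Real.pi)) z = cyl ρ α z := by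
  simp [cyl]

/-- The rotation is realized by a motion. -/
theorem exists_rotation {n : ℕ} (hn : 2 ≤ n) :
    ∃ φ ∈ realizable n, ∀ i, φ (.of i) = .of (finRotate n i) := by
  have hn0 : (0 : ℝ) < n := by exact_mod_cast (by omega : 0 < n)
  have hspin : ∀ (β c s : ℝ) (α : ℝ), c ^ 2 + s ^ 2 = 1 →
      spin β (cyl (1 + 1 / 4 * c) α (1 / 4 * s)) = cyl (1 + 1 / 4 * c) (α + β) (1 / 4 * s) :=
    fun β c s α h => spin_of_le β (by nlinarith [sq_nonneg (c - 1), sq_nonneg s])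
  obtain ⟨Γ, F, hF⟩ := exists_motion (n := n) (fun t => spinHomeo (t * (2 * Real.pi / n)))
    (continuous_spin (by fun_prop) continuous_snd)
    (continuous_spin (by fun_prop) continuous_snd)
    ⟨Metric.closedBall 0 2, isCompact_closedBall _ _, fun t p hp => spin_of_ge _ (by
      rw [mem_closedBall_zero_iff] at hp; linarith)⟩
    (by
      ext1 p
      change spin _ p = p
      simp [spin, rotate_zero])
    (fun t => spin_of_ge _ norm_basePoint.ge)
    (fun t => by
      ext p
      rw [mem_core_std_iff]
      constructor
      · rintro ⟨y, hy, rfl⟩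
        obtain ⟨α, rfl⟩ := mem_core_std_iff.1 hy
        exact ⟨_, spin_of_le _ (by norm_num)⟩
      · rintro ⟨α, rfl⟩
        refine ⟨cyl 1 (α - t * (2 * Real.pi / n)) 0, mem_core_std_iff.2 ⟨_, rfl⟩, ?_⟩
        refine (spin_of_le _ (by norm_num)).trans ?_
        rw [sub_add_cancel])
    (fun t i => ang n i + t * (2 * Real.pi / n)) (fun _ _ => 1 / 4)
    (fun i => by fun_prop) (fun i => by fun_prop) (fun _ _ => by norm_num)
    (fun _ _ => by norm_num) (fun t i c s h => hspin _ c s _ h) (fun i => by simp)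
    (fun _ => rfl) (finRotate n) (fun i => by
      obtain ⟨m, hm⟩ := ang_finRotate i
      simp only [Icc.coe_one, one_mul]
      rw [hm, cyl_add_int_mul]) (fun _ => rfl)
  refine ⟨F.aut hn, F.aut_mem hn, fun i => ?_⟩
  obtain ⟨m, hm⟩ := ang_finRotate i
  rw [F.aut_apply, wordClass, FreeGroup.lift_apply_of]
  change transport (F.induced (.mk (meridianLoop n i))) 1 = _
  rw [F.induced_mk]
  have h1 : ∀ p, F.f 1 p = spin (2 * Real.pi / n) p := fun p => by
    rw [hF]
    change spin _ p = _
    simp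
  -- The image of the meridian keeps its radius and height and has only its angle changed. In the
  -- middle third its norm is at most 3/2, so there it is rotated fully; `m` removes the full turn
  -- at the last bead.
  rw [transport_of_dip hn (finRotate n i) _ (α := fun s => ang n i + (2 * s - 1) * Real.pi / n +
    2 * Real.pi / n * max 0 (min 1 (7 - 4 * ‖meridianFun n i s‖)) - m * (2 * Real.pi))
    (fun s => ?_) (fun s hs => ?_), one_mul]
  · change F.f 1 (meridianFun n i s) = _
    rw [h1, ← cyl_add_int_mul _ _ _ m, sub_add_cancel, spin]
    conv_lhs => enter [2]; rw [meridianFun]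
    rw [rotate_cyl]
    rfl
  · have h2 : Real.sin (Real.pi * s) ≤ 1 := Real.sin_le_one _
    have h3 : √3 / 2 ≤ Real.sin (Real.pi * s) := by
      have hs1 : (1 / 3 : ℝ) ≤ s := hs.1
      have hs2 : (s : ℝ) ≤ 2 / 3 := hs.2
      have hpi := Real.pi_pos
      rw [← Real.sin_pi_div_three]
      rcases le_total (s : ℝ) (1 / 2) with h | h
      · exact Real.sin_le_sin_of_le_of_le_pi_div_two (by linarith) (by nlinarith) (by nlinarith)
      · rw [← Real.sin_pi_sub (Real.pi * s)]
        exact Real.sin_le_sin_of_le_of_le_pi_div_two (by linarith) (by nlinarith) (by nlinarith)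
    have h4 : (1.7 : ℝ) ≤ √3 := Real.le_sqrt_of_sq_le (by norm_num)
    have h5 : ‖meridianFun n i s‖ ≤ 3 / 2 := by
      rw [← sq_le_sq₀ (norm_nonneg _) (by norm_num), meridianFun, norm_cyl_sq]
      nlinarith
    change ang n i + _ + 2 * Real.pi / n * _ - _ = _
    rw [min_eq_left (by linarith), max_eq_right zero_le_one]
    linarith

end Necklace

end

noncomputable section

namespace Necklace

open Set Topology unitInterval

/-! ### The half twist of a strip -/

/-- The angle by which the half twist turns the circle of radius `x`. -/
def turnAngle (x : ℝ) : ℝ := Real.pi * max 0 (min 1 (3 - 16 * x))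

theorem turnAngle_of_ge {x : ℝ} (h : 3 / 16 ≤ x) : turnAngle x = 0 := by
  rw [turnAngle, max_eq_left ((min_le_right _ _).trans (by linarith)), mul_zero]

theorem turnAngle_of_le {x : ℝ} (h : x ≤ 1 / 8) : turnAngle x = Real.pi := by
  rw [turnAngle, min_eq_left (by linarith), max_eq_right zero_le_one, mul_one]

@[fun_prop] theorem continuous_turnAngle : Continuous turnAngle := by
  unfold turnAngle; fun_prop

/-- The half twist of the plane at time `t`, first coordinate. -/
def turnFst (t a b : ℝ) : ℝ :=
  a * Real.cos (t * turnAngle √(a ^ 2 + b ^ 2)) - b * Real.sin (t * turnAngle √(a ^ 2 + b ^ 2))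

/-- The half twist of the plane at time `t`, second coordinate. -/
def turnSnd (t a b : ℝ) : ℝ :=
  a * Real.sin (t * turnAngle √(a ^ 2 + b ^ 2)) + b * Real.cos (t * turnAngle √(a ^ 2 + b ^ 2))

/-- Circles about the origin are preserved, so the turning angle is the same at a point and at its
image. This is why `-t` undoes `t`. -/
theorem turn_sq (t a b : ℝ) : turnFst t a b ^ 2 + turnSnd t a b ^ 2 = a ^ 2 + b ^ 2 := by
  unfold turnFst turnSnd
  linear_combination (a ^ 2 + b ^ 2) * Real.sin_sq_add_cos_sq (t * turnAngle √(a ^ 2 + b ^ 2))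

theorem turnFst_neg_turn (t a b : ℝ) : turnFst (-t) (turnFst t a b) (turnSnd t a b) = a := by
  rw [turnFst, turn_sq, neg_mul, Real.cos_neg, Real.sin_neg, turnFst, turnSnd]
  linear_combination a * Real.sin_sq_add_cos_sq (t * turnAngle √(a ^ 2 + b ^ 2))

theorem turnSnd_neg_turn (t a b : ℝ) : turnSnd (-t) (turnFst t a b) (turnSnd t a b) = b := by
  rw [turnSnd, turn_sq, neg_mul, Real.cos_neg, Real.sin_neg, turnFst, turnSnd]
  linear_combination b * Real.sin_sq_add_cos_sq (t * turnAngle √(a ^ 2 + b ^ 2))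

theorem turnAngle_sqrt_of_ge {a b : ℝ} (h : 9 / 256 ≤ a ^ 2 + b ^ 2) :
    turnAngle √(a ^ 2 + b ^ 2) = 0 :=
  turnAngle_of_ge (Real.le_sqrt_of_sq_le (by norm_num; linarith))

theorem turnFst_of_ge (t : ℝ) {a b : ℝ} (h : 9 / 256 ≤ a ^ 2 + b ^ 2) : turnFst t a b = a := by
  simp [turnFst, turnAngle_sqrt_of_ge h]

theorem turnSnd_of_ge (t : ℝ) {a b : ℝ} (h : 9 / 256 ≤ a ^ 2 + b ^ 2) : turnSnd t a b = b := by
  simp [turnSnd, turnAngle_sqrt_of_ge h]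

@[fun_prop] theorem continuous_turnFst :
    Continuous fun x : ℝ × ℝ × ℝ => turnFst x.1 x.2.1 x.2.2 := by
  unfold turnFst; fun_prop

@[fun_prop] theorem continuous_turnSnd :
    Continuous fun x : ℝ × ℝ × ℝ => turnSnd x.1 x.2.1 x.2.2 := by
  unfold turnSnd; fun_prop

/-! ### Toral coordinates -/

/-- The distance from the vertical axis. -/
def hyp (p : E3) : ℝ := √(p 0 ^ 2 + p 1 ^ 2)

/-- The distance from the core circle. -/
def tubeRadius (p : E3) : ℝ := √((hyp p - 1) ^ 2 + p 2 ^ 2)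

/-- The angle of a point, measured from the half-plane of angle `d`. -/
def relAngle (d : ℝ) (p : E3) : ℝ := Complex.arg ⟨rad d p, tng d p⟩

@[fun_prop] theorem continuous_hyp : Continuous hyp := by
  unfold hyp; fun_prop

@[fun_prop] theorem continuous_tubeRadius : Continuous tubeRadius := by
  unfold tubeRadius; fun_prop

theorem hyp_cyl {ρ : ℝ} (hρ : 0 ≤ ρ) (α z : ℝ) : hyp (cyl ρ α z) = ρ := by
  have : (ρ * Real.cos α) ^ 2 + (ρ * Real.sin α) ^ 2 = ρ ^ 2 := by
    linear_combination ρ ^ 2 * Real.sin_sq_add_cos_sq α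
  rw [hyp, cyl_zero, cyl_one, this, Real.sqrt_sq hρ]

theorem norm_rad_tng (d : ℝ) (p : E3) : ‖(⟨rad d p, tng d p⟩ : ℂ)‖ = hyp p := by
  rw [Complex.norm_def, Complex.normSq_mk, hyp, rad, tng]
  congr 1
  linear_combination (p 0 ^ 2 + p 1 ^ 2) * Real.sin_sq_add_cos_sq d

theorem hyp_mul_cos (d : ℝ) (p : E3) : hyp p * Real.cos (relAngle d p) = rad d p := by
  rw [← norm_rad_tng d, relAngle, Complex.norm_mul_cos_arg]

theorem hyp_mul_sin (d : ℝ) (p : E3) : hyp p * Real.sin (relAngle d p) = tng d p := by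
  rw [← norm_rad_tng d, relAngle, Complex.norm_mul_sin_arg]

theorem cyl_relAngle (d : ℝ) (p : E3) : cyl (hyp p) (d + relAngle d p) (p 2) = p := by
  have h := Real.sin_sq_add_cos_sq d
  refine E3.ext ?_ ?_ rfl
  · rw [cyl_zero, Real.cos_add]
    have e : hyp p * (Real.cos d * Real.cos (relAngle d p) - Real.sin d * Real.sin (relAngle d p)) =
        rad d p * Real.cos d - tng d p * Real.sin d := by
      rw [← hyp_mul_cos, ← hyp_mul_sin]; ring
    rw [e, rad, tng]
    linear_combination p 0 * h
  · rw [cyl_one, Real.sin_add]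
    have e : hyp p * (Real.sin d * Real.cos (relAngle d p) + Real.cos d * Real.sin (relAngle d p)) =
        rad d p * Real.sin d + tng d p * Real.cos d := by
      rw [← hyp_mul_cos, ← hyp_mul_sin]; ring
    rw [e, rad, tng]
    linear_combination p 1 * h

theorem relAngle_cyl {d ρ A z : ℝ} (hρ : 0 < ρ) (h1 : -Real.pi < A) (h2 : A ≤ Real.pi) :
    relAngle d (cyl ρ (d + A) z) = A := by
  rw [relAngle, rad_cyl, tng_cyl, add_sub_cancel_left]
  have : (⟨ρ * Real.cos A, ρ * Real.sin A⟩ : ℂ) = ρ * (Complex.cos A + Complex.sin A * Complex.I) := by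
    apply Complex.ext <;> simp [Complex.cos_ofReal_re, Complex.sin_ofReal_re]
  rw [this, Complex.arg_mul_cos_add_sin_mul_I hρ ⟨h1, h2⟩]

/-- The point at distance `r` from the core circle, in the half-plane of angle `α`, in the
direction `(c, s)`. -/
def tor (α r c s : ℝ) : E3 := cyl (1 + r * c) α (r * s)

theorem tubeRadius_tor {α r c s : ℝ} (hr : 0 ≤ r) (hρ : 0 ≤ 1 + r * c) (h : c ^ 2 + s ^ 2 = 1) :
    tubeRadius (tor α r c s) = r := by
  have : (1 + r * c - 1) ^ 2 + (r * s) ^ 2 = r ^ 2 := by linear_combination r ^ 2 * h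
  rw [tubeRadius, tor, hyp_cyl hρ, cyl_two, this, Real.sqrt_sq hr]

theorem abs_le_one_of_sq {c s : ℝ} (h : c ^ 2 + s ^ 2 = 1) : -1 ≤ c :=
  (abs_le_of_sq_le_sq' (by nlinarith [sq_nonneg s] : c ^ 2 ≤ 1 ^ 2) zero_le_one).1

/-! ### The half twist of space -/

/-- The half twist of two neighbouring beads at the angles `0` and `2 d`, at time `t`. -/
def twist (d t : ℝ) (p : E3) : E3 :=
  cyl (1 + (1 / 4 + turnSnd t (relAngle d p / (8 * d)) (tubeRadius p - 1 / 4)) / tubeRadius p *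
      (hyp p - 1))
    (d + 8 * d * turnFst t (relAngle d p / (8 * d)) (tubeRadius p - 1 / 4))
    ((1 / 4 + turnSnd t (relAngle d p / (8 * d)) (tubeRadius p - 1 / 4)) / tubeRadius p * p 2)

variable {d : ℝ}

theorem twist_eq_self (hd : 0 < d) {t : ℝ} {p : E3}
    (h1 : turnFst t (relAngle d p / (8 * d)) (tubeRadius p - 1 / 4) = relAngle d p / (8 * d))
    (h2 : turnSnd t (relAngle d p / (8 * d)) (tubeRadius p - 1 / 4) = tubeRadius p - 1 / 4) :
    twist d t p = p := by
  rw [twist, h1, h2, add_sub_cancel, mul_div_cancel₀ _ (by positivity)]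
  have h3 : tubeRadius p / tubeRadius p * (hyp p - 1) = hyp p - 1 ∧
      tubeRadius p / tubeRadius p * p 2 = p 2 := by
    -- On the core circle the quotient is 0 by convention, but both of the factors that it
    -- multiplies vanish.
    by_cases h0 : tubeRadius p = 0
    · have h4 : (hyp p - 1) ^ 2 + p 2 ^ 2 = 0 := (Real.sqrt_eq_zero (by positivity)).1 h0
      have h5 : hyp p - 1 = 0 := by nlinarith [sq_nonneg (hyp p - 1), sq_nonneg (p 2)]
      have h6 : p 2 = 0 := by nlinarith [sq_nonneg (hyp p - 1), sq_nonneg (p 2)]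
      simp [h5, h6]
    · rw [div_self h0, one_mul, one_mul]; exact ⟨rfl, rfl⟩
  rw [h3.1, h3.2, add_sub_cancel, cyl_relAngle]

theorem twist_of_ge (hd : 0 < d) (t : ℝ) {p : E3}
    (h : 9 / 256 ≤ (relAngle d p / (8 * d)) ^ 2 + (tubeRadius p - 1 / 4) ^ 2) :
    twist d t p = p :=
  twist_eq_self hd (turnFst_of_ge t h) (turnSnd_of_ge t h)

theorem twist_zero (hd : 0 < d) (p : E3) : twist d 0 p = p :=
  twist_eq_self hd (by simp [turnFst]) (by simp [turnSnd])

/-- The twist acts on the strip of angle and distance from the core circle and keeps the direction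
`(c, s)`, so circles around the core circle go to such circles. Where the twist is not trivially the
identity, `r` is between 1/16 and 7/16, and the coordinates can be read off. -/
theorem twist_tor (hd : 0 < d) (t : ℝ) {A r c s : ℝ} (hr : 0 ≤ r) (hρ : 0 ≤ 1 + r * c)
    (h : c ^ 2 + s ^ 2 = 1) (h1 : -Real.pi < A) (h2 : A ≤ Real.pi) :
    twist d t (tor (d + A) r c s) = tor (d + 8 * d * turnFst t (A / (8 * d)) (r - 1 / 4))
      (1 / 4 + turnSnd t (A / (8 * d)) (r - 1 / 4)) c s := by
  by_cases hb : 9 / 256 ≤ (r - 1 / 4) ^ 2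
  · rw [twist_of_ge hd, turnFst_of_ge, turnSnd_of_ge, mul_div_cancel₀ _ (by positivity),
      add_sub_cancel]
    · exact hb.trans (le_add_of_nonneg_left (sq_nonneg _))
    · exact hb.trans (le_add_of_nonneg_left (sq_nonneg _))
    · rw [tubeRadius_tor hr hρ h]
      exact hb.trans (le_add_of_nonneg_left (sq_nonneg _))
  · push Not at hb
    have hc := abs_le_one_of_sq h
    have hr0 : 1 / 16 < r := by nlinarith
    have hr1 : r < 7 / 16 := by nlinarith
    have hρ' : 0 < 1 + r * c := by nlinarith
    have e : relAngle d (tor (d + A) r c s) = A := relAngle_cyl hρ' h1 h2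
    rw [twist, tubeRadius_tor hr hρ h, e]
    have e1 : hyp (tor (d + A) r c s) - 1 = r * c := by rw [tor, hyp_cyl hρ]; ring
    have e2 : tor (d + A) r c s 2 = r * s := rfl
    rw [e1, e2, ← mul_assoc, ← mul_assoc, div_mul_cancel₀ _ (by linarith)]
    rfl

theorem exists_eq_tor {p : E3} (h : 0 < tubeRadius p) :
    ∃ c s, c ^ 2 + s ^ 2 = 1 ∧ p = tor (d + relAngle d p) (tubeRadius p) c s := by
  refine ⟨(hyp p - 1) / tubeRadius p, p 2 / tubeRadius p, ?_, ?_⟩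
  · have : tubeRadius p ^ 2 = (hyp p - 1) ^ 2 + p 2 ^ 2 := Real.sq_sqrt (by positivity)
    field_simp
    linarith
  · rw [tor, mul_div_cancel₀ _ h.ne', mul_div_cancel₀ _ h.ne', add_sub_cancel, cyl_relAngle]

/-- The support has radius 3/16 in the strip. There the relative angle stays below 3d/2 ≤ 3π/4 and
the distance from the core circle between 1/16 and 7/16, so the coordinates of the image are the
turned ones. -/
theorem twist_neg_twist (hd : 0 < d) (hd' : d ≤ Real.pi / 2) (t : ℝ) (p : E3) :
    twist d (-t) (twist d t p) = p := by
  by_cases h : 9 / 256 ≤ (relAngle d p / (8 * d)) ^ 2 + (tubeRadius p - 1 / 4) ^ 2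
  · rw [twist_of_ge hd t h, twist_of_ge hd (-t) h]
  · push Not at h
    have hpi := Real.pi_pos
    have h0 : 1 / 16 < tubeRadius p := by nlinarith [sq_nonneg (relAngle d p / (8 * d))]
    have h0' : tubeRadius p < 7 / 16 := by nlinarith [sq_nonneg (relAngle d p / (8 * d))]
    obtain ⟨c, s, hcs, hp⟩ := exists_eq_tor (d := d) (p := p) (by linarith)
    have hc := abs_le_one_of_sq hcs
    have hA := Complex.arg_mem_Ioc ⟨rad d p, tng d p⟩
    have e : twist d t p = tor (d + 8 * d * turnFst t (relAngle d p / (8 * d))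
        (tubeRadius p - 1 / 4)) (1 / 4 + turnSnd t (relAngle d p / (8 * d))
        (tubeRadius p - 1 / 4)) c s := by
      conv_lhs => rw [hp]
      exact twist_tor hd t (by linarith) (by nlinarith) hcs hA.1 hA.2
    have h1 := turn_sq t (relAngle d p / (8 * d)) (tubeRadius p - 1 / 4)
    have h2 : turnFst t (relAngle d p / (8 * d)) (tubeRadius p - 1 / 4) ^ 2 < (3 / 16) ^ 2 := by
      nlinarith [sq_nonneg (turnSnd t (relAngle d p / (8 * d)) (tubeRadius p - 1 / 4))]
    have h3 : turnSnd t (relAngle d p / (8 * d)) (tubeRadius p - 1 / 4) ^ 2 < (3 / 16) ^ 2 := by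
      nlinarith [sq_nonneg (turnFst t (relAngle d p / (8 * d)) (tubeRadius p - 1 / 4))]
    have h4 := abs_lt.1 (abs_lt_of_sq_lt_sq h2 (by norm_num))
    have h5 := abs_lt.1 (abs_lt_of_sq_lt_sq h3 (by norm_num))
    rw [e, twist_tor hd (-t) (by linarith) (by nlinarith) hcs (by nlinarith) (by nlinarith),
      mul_div_cancel_left₀ _ (by positivity), add_sub_cancel_left, turnFst_neg_turn,
      turnSnd_neg_turn, mul_div_cancel₀ _ (by positivity), add_sub_cancel]
    exact hp.symm

/-- The formula can fail to be continuous only on the core circle, on the axis and on the branch cut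
of the argument, and near these the twist is the identity. -/
theorem continuous_twist (hd : 0 < d) (hd' : d ≤ Real.pi / 2) :
    Continuous fun x : ℝ × E3 => twist d x.1 x.2 := by
  have hpi := Real.pi_pos
  rw [continuous_iff_continuousAt]
  rintro ⟨t, p⟩
  -- the half twist is the identity near points that are far from the two beads
  have hfar : (∀ᶠ q in 𝓝 p, 9 / 256 ≤ (relAngle d q / (8 * d)) ^ 2 + (tubeRadius q - 1 / 4) ^ 2) →
      ContinuousAt (fun x : ℝ × E3 => twist d x.1 x.2) (t, p) := fun h => by
    refine continuousAt_snd.congr ?_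
    filter_upwards [(continuous_snd.tendsto (t, p)).eventually h] with x hx
    exact (twist_of_ge hd x.1 hx).symm
  have hrad : 9 / 256 < (tubeRadius p - 1 / 4) ^ 2 →
      ContinuousAt (fun x : ℝ × E3 => twist d x.1 x.2) (t, p) := fun h => by
    refine hfar ?_
    have ho : IsOpen {q : E3 | 9 / 256 < (tubeRadius q - 1 / 4) ^ 2} :=
      isOpen_lt continuous_const (by fun_prop)
    filter_upwards [ho.mem_nhds h] with q hq
    exact (le_of_lt hq).trans (le_add_of_nonneg_left (sq_nonneg _))
  by_cases h0 : tubeRadius p = 0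
  · exact hrad (by rw [h0]; norm_num)
  by_cases hs : (⟨rad d p, tng d p⟩ : ℂ) ∈ Complex.slitPlane
  · have hA : ContinuousAt (fun x : ℝ × E3 => relAngle d x.2) (t, p) := by
      have h1 : Continuous fun q : E3 => (⟨rad d q, tng d q⟩ : ℂ) := by
        have : (fun q : E3 => (⟨rad d q, tng d q⟩ : ℂ)) =
            fun q : E3 => (rad d q : ℂ) + (tng d q : ℂ) * Complex.I := by
          funext q; apply Complex.ext <;> simp
        rw [this]
        fun_prop
      exact ContinuousAt.comp (f := fun x : ℝ × E3 => (⟨rad d x.2, tng d x.2⟩ : ℂ))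
        (Complex.continuousAt_arg hs) (h1.comp continuous_snd).continuousAt
    have hR : ContinuousAt (fun x : ℝ × E3 => tubeRadius x.2) (t, p) :=
      (continuous_tubeRadius.comp continuous_snd).continuousAt
    have hH : ContinuousAt (fun x : ℝ × E3 => hyp x.2) (t, p) :=
      (continuous_hyp.comp continuous_snd).continuousAt
    have hz : ContinuousAt (fun x : ℝ × E3 => x.2 2) (t, p) :=
      ((continuous_coord 2).comp continuous_snd).continuousAt
    have hv : ContinuousAt (fun x : ℝ × E3 =>
        (x.1, relAngle d x.2 / (8 * d), tubeRadius x.2 - 1 / 4)) (t, p) :=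
      continuousAt_fst.prodMk ((hA.div_const _).prodMk (hR.sub continuousAt_const))
    have h1 : ContinuousAt (fun x : ℝ × E3 =>
        turnFst x.1 (relAngle d x.2 / (8 * d)) (tubeRadius x.2 - 1 / 4)) (t, p) :=
      ContinuousAt.comp (f := fun x : ℝ × E3 =>
        (x.1, relAngle d x.2 / (8 * d), tubeRadius x.2 - 1 / 4)) continuous_turnFst.continuousAt hv
    have h2 : ContinuousAt (fun x : ℝ × E3 =>
        turnSnd x.1 (relAngle d x.2 / (8 * d)) (tubeRadius x.2 - 1 / 4)) (t, p) :=
      ContinuousAt.comp (f := fun x : ℝ × E3 =>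
        (x.1, relAngle d x.2 / (8 * d), tubeRadius x.2 - 1 / 4)) continuous_turnSnd.continuousAt hv
    have h3 := ((continuousAt_const (y := (1 / 4 : ℝ))).add h2).div hR h0
    exact ContinuousAt.comp (g := cylMap) (f := fun x : ℝ × E3 => (_, _, _))
      continuous_cylMap.continuousAt
      ((continuousAt_const.add (continuousAt_const.mul h1)).prodMk
        ((continuousAt_const.add (h3.mul (hH.sub continuousAt_const))).prodMk (h3.mul hz)))
  · rw [Complex.mem_slitPlane_iff] at hs
    push Not at hs
    obtain ⟨hs1, hs2⟩ := hs
    change rad d p ≤ 0 at hs1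
    change tng d p = 0 at hs2
    have hh : hyp p = -rad d p := by
      rw [← norm_rad_tng d, hs2, Complex.norm_def, Complex.normSq_mk, mul_zero, add_zero,
        Real.sqrt_mul_self_eq_abs, abs_of_nonpos hs1]
    rcases hs1.lt_or_eq with hlt | heq
    · have h2 : (1 : ℝ) < √2 := by
        rw [Real.lt_sqrt zero_le_one]; norm_num
      have h2' : √2 < 2 := by
        rw [Real.sqrt_lt' two_pos]; norm_num
      -- A cone around the branch cut: −√2/2 = cos(3π/4), and a relative angle beyond 3π/4 is
      -- outside the support since 8d · 3/16 ≤ 3π/4.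
      have ho : IsOpen {q : E3 | rad d q < -(√2 / 2) * hyp q} := isOpen_lt (by fun_prop) (by fun_prop)
      refine hfar ?_
      have hp : rad d p < -(√2 / 2) * hyp p := by rw [hh]; nlinarith
      filter_upwards [ho.mem_nhds hp] with q hq
      have hq : rad d q < -(√2 / 2) * hyp q := hq
      rw [← hyp_mul_cos] at hq
      have hq0 : 0 ≤ hyp q := Real.sqrt_nonneg _
      have hcos : Real.cos (relAngle d q) < -(√2 / 2) := by
        by_contra hcon
        push Not at hcon
        nlinarith
      have hA : 3 / 4 * Real.pi < |relAngle d q| := by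
        by_contra hcon
        push Not at hcon
        have := Real.cos_le_cos_of_nonneg_of_le_pi (abs_nonneg _) (by linarith) hcon
        rw [Real.cos_abs, show 3 / 4 * Real.pi = Real.pi - Real.pi / 4 by ring, Real.cos_pi_sub,
          Real.cos_pi_div_four] at this
        linarith
      have h3 : (3 / 16 : ℝ) ≤ |relAngle d q / (8 * d)| := by
        rw [abs_div, abs_of_pos (by positivity : 0 < 8 * d), le_div_iff₀ (by positivity)]
        linarith
      have h4 : (3 / 16 : ℝ) ^ 2 ≤ (relAngle d q / (8 * d)) ^ 2 := by
        rw [← sq_abs (relAngle d q / (8 * d))]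
        gcongr
      nlinarith [sq_nonneg (tubeRadius q - 1 / 4)]
    · refine hrad ?_
      have h1 : hyp p = 0 := by rw [hh, heq, neg_zero]
      have h2 : 1 ≤ tubeRadius p := by
        rw [tubeRadius, h1, Real.le_sqrt' one_pos]
        nlinarith [sq_nonneg (p 2)]
      nlinarith

theorem continuous_twist_comp {X : Type*} [TopologicalSpace X] (hd : 0 < d) (hd' : d ≤ Real.pi / 2)
    {t : X → ℝ} {f : X → E3} (ht : Continuous t) (hf : Continuous f) :
    Continuous fun x => twist d (t x) (f x) :=
  Continuous.comp (g := fun x : ℝ × E3 => twist d x.1 x.2) (f := fun x => (t x, f x))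
    (continuous_twist hd hd') (ht.prodMk hf)

/-- The half twist as a homeomorphism. -/
def twistHomeo (hd : 0 < d) (hd' : d ≤ Real.pi / 2) (t : ℝ) : E3 ≃ₜ E3 where
  toFun := twist d t
  invFun := twist d (-t)
  left_inv := twist_neg_twist hd hd' t
  right_inv p := by
    have := twist_neg_twist hd hd' (-t) p
    rwa [neg_neg] at this
  continuous_toFun := continuous_twist_comp hd hd' continuous_const continuous_id
  continuous_invFun := continuous_twist_comp hd hd' continuous_const continuous_id

theorem twist_of_tubeRadius (hd : 0 < d) (t : ℝ) {p : E3}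
    (h : 9 / 256 ≤ (tubeRadius p - 1 / 4) ^ 2) : twist d t p = p :=
  twist_of_ge hd t (h.trans (le_add_of_nonneg_left (sq_nonneg _)))

theorem twist_core (hd : 0 < d) (t α : ℝ) : twist d t (cyl 1 α 0) = cyl 1 α 0 := by
  refine twist_of_tubeRadius hd t ?_
  rw [tubeRadius, hyp_cyl zero_le_one, cyl_two]
  norm_num

end Necklace

end

noncomputable section

namespace Necklace

open Set Topology unitInterval

/-! ### The motion of the half twist -/

theorem norm_sq_eq_hyp (p : E3) : ‖p‖ ^ 2 = hyp p ^ 2 + p 2 ^ 2 := by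
  rw [norm_sq_eq, hyp, Real.sq_sqrt (by positivity)]

theorem twist_of_norm {d : ℝ} (hd : 0 < d) (t : ℝ) {p : E3} (h : 2 ≤ ‖p‖) : twist d t p = p := by
  refine twist_of_tubeRadius hd t ?_
  have h1 : 4 ≤ hyp p ^ 2 + p 2 ^ 2 := by rw [← norm_sq_eq_hyp]; nlinarith
  have h2 : 0 ≤ hyp p := Real.sqrt_nonneg _
  have h3 : 7 / 16 ≤ tubeRadius p := by
    refine Real.le_sqrt_of_sq_le ?_
    by_contra hcon
    push Not at hcon
    nlinarith [sq_nonneg (p 2), sq_nonneg (hyp p - 1)]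
  nlinarith

section Beads

variable {n : ℕ}

/-- The angle of a bead of the base necklace, measured from the half-plane midway between the first
two beads. -/
def beadAngle (n : ℕ) (i : Fin n) : ℝ :=
  if ang n i - Real.pi / n ≤ Real.pi then ang n i - Real.pi / n
  else ang n i - Real.pi / n - 2 * Real.pi

theorem ang_eq_beadAngle (i : Fin n) :
    ∃ m : ℤ, ang n i = Real.pi / n + beadAngle n i + m * (2 * Real.pi) := by
  unfold beadAngle
  split_ifs
  · exact ⟨0, by push_cast; ring⟩
  · exact ⟨1, by push_cast; ring⟩

theorem natCast_mul_pi_div (i : Fin n) : (n : ℝ) * (Real.pi / n) = Real.pi := by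
  have : (n : ℝ) ≠ 0 := by exact_mod_cast i.pos.ne'
  field_simp

theorem beadAngle_mem (hn : 2 ≤ n) (i : Fin n) :
    -Real.pi < beadAngle n i ∧ beadAngle n i ≤ Real.pi := by
  have hn0 : (0 : ℝ) < n := by exact_mod_cast i.pos
  have hpi := Real.pi_pos
  have hd : 0 < Real.pi / n := by positivity
  have hd' := two_pi_div_le hn
  have h1 := natCast_mul_pi_div i
  have h2 : ang n i = 2 * i * (Real.pi / n) := ang_eq n i
  have h3 : (i : ℝ) + 1 ≤ n := by exact_mod_cast i.isLt
  have h4 : (0 : ℝ) ≤ (i : ℕ) := Nat.cast_nonneg _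
  unfold beadAngle
  rw [h2]
  split_ifs with h
  · exact ⟨by nlinarith, h⟩
  · exact ⟨by linarith, by nlinarith⟩

theorem beadAngle_zero (hn : 2 ≤ n) (i : Fin n) (hi : (i : ℕ) = 0) :
    beadAngle n i = -(Real.pi / n) := by
  have hn0 : (0 : ℝ) < n := by exact_mod_cast i.pos
  have hpi := Real.pi_pos
  have hd : 0 < Real.pi / n := by positivity
  have h2 : ang n i = 0 := by simp [ang, hi]
  rw [beadAngle, h2, if_pos (by linarith), zero_sub]

theorem beadAngle_one (hn : 2 ≤ n) (i : Fin n) (hi : (i : ℕ) = 1) :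
    beadAngle n i = Real.pi / n := by
  have hpi := Real.pi_pos
  have hd' := two_pi_div_le hn
  have h2 : ang n i = 2 * (Real.pi / n) := by rw [ang_eq, hi]; push_cast; ring
  rw [beadAngle, h2, if_pos (by linarith)]; ring

theorem le_abs_beadAngle (hn : 2 ≤ n) (i : Fin n) (hi : 2 ≤ (i : ℕ)) :
    3 * (Real.pi / n) ≤ |beadAngle n i| := by
  have hn0 : (0 : ℝ) < n := by exact_mod_cast i.pos
  have hpi := Real.pi_pos
  have hd : 0 < Real.pi / n := by positivity
  have h1 := natCast_mul_pi_div i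
  have h2 : ang n i = 2 * i * (Real.pi / n) := ang_eq n i
  have h3 : (i : ℝ) + 1 ≤ n := by exact_mod_cast i.isLt
  have h4 : (2 : ℝ) ≤ (i : ℕ) := by exact_mod_cast hi
  unfold beadAngle
  rw [h2]
  split_ifs with h
  · exact le_abs.2 (.inl (by nlinarith))
  · exact le_abs.2 (.inr (by nlinarith))

/-- In the strip the first two beads are at ∓1/8, and all others are at distance at least 3/8,
outside the support. -/
theorem beadAngle_cases (hn : 2 ≤ n) (i : Fin n) :
    ((i : ℕ) = 0 ∧ beadAngle n i / (8 * (Real.pi / n)) = -(1 / 8)) ∨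
    ((i : ℕ) = 1 ∧ beadAngle n i / (8 * (Real.pi / n)) = 1 / 8) ∨
    (2 ≤ (i : ℕ) ∧ 9 / 256 ≤ (beadAngle n i / (8 * (Real.pi / n))) ^ 2) := by
  have hn0 : (0 : ℝ) < n := by exact_mod_cast i.pos
  have hpi := Real.pi_pos
  have hd : 0 < Real.pi / n := by positivity
  rcases Nat.lt_or_ge (i : ℕ) 2 with h | h
  · interval_cases hi : (i : ℕ)
    · exact .inl ⟨rfl, by rw [beadAngle_zero hn i hi]; field_simp⟩
    · exact .inr (.inl ⟨rfl, by rw [beadAngle_one hn i hi]; field_simp⟩)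
  · refine .inr (.inr ⟨h, ?_⟩)
    have h1 := le_abs_beadAngle hn i h
    rw [div_pow, le_div_iff₀ (by positivity), ← sq_abs (beadAngle n i)]
    nlinarith

end Beads

/-- At distance 1/8 from the centre the turn is rigid, so the two moving beads run along a half
circle and change places. -/
theorem turn_eighth {a : ℝ} (h : a ^ 2 = (1 / 8) ^ 2) (t : ℝ) :
    turnFst t a 0 = a * Real.cos (t * Real.pi) ∧ turnSnd t a 0 = a * Real.sin (t * Real.pi) := by
  have : turnAngle √(a ^ 2 + 0 ^ 2) = Real.pi := turnAngle_of_le (by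
    rw [h, zero_pow two_ne_zero, add_zero, Real.sqrt_sq (by norm_num)])
  rw [turnFst, turnSnd, this]
  constructor <;> ring

/-- This keeps the radii admissible. The two moving beads have radii between 1/8 and 3/8; half-way
they are concentric and the first one is the smaller. -/
theorem abs_turnSnd_lt {n : ℕ} (hn : 2 ≤ n) (i : Fin n) (t : ℝ) :
    |turnSnd t (beadAngle n i / (8 * (Real.pi / n))) 0| < 1 / 4 := by
  refine abs_lt_of_sq_lt_sq ?_ (by norm_num)
  have key : ∀ a : ℝ, a ^ 2 = (1 / 8) ^ 2 → turnSnd t a 0 ^ 2 < (1 / 4) ^ 2 := fun a ha => by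
    have := turn_sq t a 0
    nlinarith [sq_nonneg (turnFst t a 0)]
  rcases beadAngle_cases hn i with ⟨-, h⟩ | ⟨-, h⟩ | ⟨-, h⟩
  · exact key _ (by rw [h]; norm_num)
  · exact key _ (by rw [h])
  · rw [turnSnd_of_ge t (by linarith)]
    norm_num

/-- The half twist is realized by a motion. -/
theorem exists_twist_motion {n : ℕ} (hn : 2 ≤ n) :
    ∃ (Γ : Path (std n) (std n)) (F : Motion Γ), ∀ p, F.f 1 p = twist (Real.pi / n) 1 p := by
  have hn0 : (0 : ℝ) < n := by exact_mod_cast (by omega : 0 < n)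
  have hpi := Real.pi_pos
  have hd : 0 < Real.pi / n := by positivity
  have hd' := two_pi_div_le hn
  have h0n : 0 < n := by omega
  have h1n : 1 < n := by omega
  set d := Real.pi / n with hdef
  let a : Fin n → ℝ := fun i => beadAngle n i / (8 * d)
  have ha : ∀ i, 8 * d * a i = beadAngle n i := fun i => mul_div_cancel₀ _ (by positivity)
  have hang : ∀ i : Fin n, cyl 1 (d + 8 * d * a i) 0 = cyl 1 (ang n i) 0 := fun i => by
    obtain ⟨m, hm⟩ := ang_eq_beadAngle i
    rw [hm, cyl_add_int_mul, ha]
  have hact : ∀ (t : ℝ) (i : Fin n) (c s : ℝ), c ^ 2 + s ^ 2 = 1 →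
      twist d t (cyl (1 + 1 / 4 * c) (ang n i) (1 / 4 * s)) =
        cyl (1 + (1 / 4 + turnSnd t (a i) 0) * c) (d + 8 * d * turnFst t (a i) 0)
          ((1 / 4 + turnSnd t (a i) 0) * s) := fun t i c s h => by
    obtain ⟨m, hm⟩ := ang_eq_beadAngle i
    have hc := abs_le_one_of_sq h
    have hA := beadAngle_mem hn i
    have := twist_tor hd t (r := 1 / 4) (by norm_num) (by linarith) h hA.1 hA.2
    rw [sub_self] at this
    rw [hm, cyl_add_int_mul]
    exact this
  have hcont1 : ∀ i, Continuous fun t : I => turnFst t (a i) 0 := fun i =>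
    continuous_turnFst.comp (f := fun t : I => ((t : ℝ), a i, (0 : ℝ))) (by fun_prop)
  have hcont2 : ∀ i, Continuous fun t : I => turnSnd t (a i) 0 := fun i =>
    continuous_turnSnd.comp (f := fun t : I => ((t : ℝ), a i, (0 : ℝ))) (by fun_prop)
  obtain ⟨Γ, F, hF⟩ := exists_motion (n := n) (fun t => twistHomeo hd hd' t)
    (continuous_twist_comp hd hd' (continuous_subtype_val.comp continuous_fst) continuous_snd)
    (continuous_twist_comp hd hd' (continuous_subtype_val.comp continuous_fst).neg continuous_snd)
    ⟨Metric.closedBall 0 2, isCompact_closedBall _ _, fun t p hp => twist_of_norm hd _ (by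
      rw [mem_closedBall_zero_iff] at hp; linarith)⟩
    (by
      ext1 p
      exact twist_zero hd p)
    (fun t => twist_of_norm hd _ norm_basePoint.ge)
    (fun t => by
      have : EqOn (twistHomeo hd hd' t) id (core (std n)) := fun p hp => by
        obtain ⟨α, rfl⟩ := mem_core_std_iff.1 hp
        exact twist_core hd t α
      rw [this.image_eq, image_id])
    (fun t i => d + 8 * d * turnFst t (a i) 0) (fun t i => 1 / 4 + turnSnd t (a i) 0)
    (fun i => by have := hcont1 i; fun_prop) (fun i => by have := hcont2 i; fun_prop)
    (fun t i => by linarith [(abs_lt.1 (abs_turnSnd_lt hn i t)).1])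
    (fun t i => by linarith [(abs_lt.1 (abs_turnSnd_lt hn i t)).2])
    (fun t i c s h => hact t i c s h)
    (fun i => by
      have : turnFst (0 : I) (a i) 0 = a i := by simp [turnFst]
      rw [this, hang])
    (fun i => by simp [turnSnd])
    (Equiv.swap ⟨0, by omega⟩ ⟨1, by omega⟩)
    (fun i => by
      change cyl 1 (d + 8 * d * turnFst 1 (a i) 0) 0 = _
      rcases beadAngle_cases hn i with ⟨hi, h⟩ | ⟨hi, h⟩ | ⟨hi, h⟩
      · obtain rfl : i = ⟨0, h0n⟩ := Fin.ext hi
        change a _ = _ at h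
        rw [(turn_eighth (by rw [h]; norm_num) 1).1, Equiv.swap_apply_left, h, ang_eq, ← hdef]
        congr 1
        simp; ring
      · obtain rfl : i = ⟨1, h1n⟩ := Fin.ext hi
        change a _ = _ at h
        rw [(turn_eighth (by rw [h]) 1).1, Equiv.swap_apply_right, h, ang_eq, ← hdef]
        congr 1
        simp; ring
      · change _ ≤ a i ^ 2 at h
        rw [turnFst_of_ge 1 (by linarith), hang, Equiv.swap_apply_of_ne_of_ne]
        · intro e; rw [e] at hi; simp at hi
        · intro e; rw [e] at hi; simp at hi)
    (fun i => by
      change 1 / 4 + turnSnd 1 (a i) 0 = 1 / 4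
      rcases beadAngle_cases hn i with ⟨-, h⟩ | ⟨-, h⟩ | ⟨-, h⟩
      · change a _ = _ at h
        rw [(turn_eighth (by rw [h]; norm_num) 1).2]; simp
      · change a _ = _ at h
        rw [(turn_eighth (by rw [h]) 1).2]; simp
      · change _ ≤ a i ^ 2 at h
        rw [turnSnd_of_ge 1 (by linarith), add_zero])
  refine ⟨Γ, F, fun p => ?_⟩
  rw [hF]
  rfl

end Necklace

end

noncomputable section

namespace Necklace

open Set Topology unitInterval

/-! ### The half twist of the plane along a line -/

theorem turnFst_zero (y : ℝ) : turnFst 1 0 y = -(y * Real.sin (turnAngle |y|)) := by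
  simp [turnFst, Real.sqrt_sq_eq_abs]

theorem turnSnd_zero (y : ℝ) : turnSnd 1 0 y = y * Real.cos (turnAngle |y|) := by
  simp [turnSnd, Real.sqrt_sq_eq_abs]

theorem turnAngle_eq {x : ℝ} (h : 1 / 8 ≤ x) (h' : x ≤ 3 / 16) :
    turnAngle x = Real.pi * (3 - 16 * x) := by
  rw [turnAngle, min_eq_right (by linarith), max_eq_right (by linarith)]

theorem turnAngle_mem (x : ℝ) : 0 ≤ turnAngle x ∧ turnAngle x ≤ Real.pi := by
  have hpi := Real.pi_pos
  refine ⟨mul_nonneg hpi.le (le_max_left _ _), ?_⟩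
  have : max 0 (min 1 (3 - 16 * x)) ≤ 1 := max_le zero_le_one (min_le_left _ _)
  unfold turnAngle
  nlinarith

theorem antitone_turnAngle : Antitone turnAngle := fun x y h =>
  mul_le_mul_of_nonneg_left (max_le_max le_rfl (min_le_min le_rfl (by linarith))) Real.pi_pos.le

theorem turnAngle_half : turnAngle (5 / 32) = Real.pi / 2 := by
  rw [turnAngle_eq (by norm_num) (by norm_num)]; ring

theorem cos_turnAngle_nonneg {x : ℝ} (h : 5 / 32 ≤ x) : 0 ≤ Real.cos (turnAngle x) := by
  have h1 := antitone_turnAngle h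
  rw [turnAngle_half] at h1
  exact Real.cos_nonneg_of_neg_pi_div_two_le_of_le
    (by linarith [(turnAngle_mem x).1, Real.pi_pos]) h1

theorem cos_turnAngle_nonpos {x : ℝ} (h : x ≤ 5 / 32) : Real.cos (turnAngle x) ≤ 0 := by
  have h1 := antitone_turnAngle h
  rw [turnAngle_half] at h1
  exact Real.cos_nonpos_of_pi_div_two_le_of_le h1 (by linarith [(turnAngle_mem x).2, Real.pi_pos])

theorem sin_turnAngle_pos {x : ℝ} (h : 1 / 8 < x) (h' : x < 3 / 16) :
    0 < Real.sin (turnAngle x) := by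
  have hpi := Real.pi_pos
  rw [turnAngle_eq h.le h'.le]
  exact Real.sin_pos_of_pos_of_lt_pi (by nlinarith) (by nlinarith)

/-- At 13/96 and 17/96 the turning angle is 5π/6 and π/6. Beyond these values the twisted line is
safely between the two bead angles. -/
theorem sin_turnAngle_le {x : ℝ} (h : x ≤ 13 / 96 ∨ 17 / 96 ≤ x) :
    Real.sin (turnAngle x) ≤ 1 / 2 := by
  have hpi := Real.pi_pos
  obtain ⟨h0, h1⟩ := turnAngle_mem x
  rw [← Real.sin_pi_div_six]
  rcases h with h | h
  · rw [← Real.sin_pi_sub]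
    have h2 := antitone_turnAngle h
    rw [turnAngle_eq (by norm_num) (by norm_num)] at h2
    exact Real.sin_le_sin_of_le_of_le_pi_div_two (by linarith) (by linarith) (by linarith)
  · have h2 := antitone_turnAngle h
    rw [turnAngle_eq (x := 17 / 96) (by norm_num) (by norm_num)] at h2
    exact Real.sin_le_sin_of_le_of_le_pi_div_two (by linarith) (by linarith) (by linarith)

theorem turnFst_zero_of_ge {y : ℝ} (h : 3 / 16 ≤ |y|) : turnFst 1 0 y = 0 := by
  rw [turnFst_zero, turnAngle_of_ge h]; simp

theorem turnSnd_zero_of_ge {y : ℝ} (h : 3 / 16 ≤ |y|) : turnSnd 1 0 y = y := by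
  rw [turnSnd_zero, turnAngle_of_ge h]; simp

theorem abs_turnFst_zero (y : ℝ) : |turnFst 1 0 y| = |y| * Real.sin (turnAngle |y|) := by
  rw [turnFst_zero, abs_neg, abs_mul, abs_of_nonneg
    (Real.sin_nonneg_of_nonneg_of_le_pi (turnAngle_mem |y|).1 (turnAngle_mem |y|).2)]

theorem abs_turnFst_zero_le (y : ℝ) : |turnFst 1 0 y| ≤ 3 / 16 := by
  rcases le_total (3 / 16) |y| with h | h
  · rw [turnFst_zero_of_ge h]; norm_num
  · rw [abs_turnFst_zero]
    nlinarith [Real.sin_le_one (turnAngle |y|), abs_nonneg y]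

theorem abs_turnFst_zero_lt {y : ℝ} (h : |y| ≤ 13 / 96 ∨ 17 / 96 ≤ |y|) :
    |turnFst 1 0 y| < 1 / 8 := by
  rcases le_or_gt (3 / 16) |y| with h' | h'
  · rw [turnFst_zero_of_ge h']; norm_num
  · rw [abs_turnFst_zero]
    nlinarith [sin_turnAngle_le h, abs_nonneg y]

/-- The twisted line misses the points ±1/8 of the axis, that is the beads: such a point would come
from `|y| = 1/8`, where the turn by π keeps the line over `a = 0`. -/
theorem turnSnd_zero_ne {y : ℝ} (h : |turnFst 1 0 y| = 1 / 8) : turnSnd 1 0 y ≠ 0 := fun h0 => by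
  have h1 := turn_sq 1 0 y
  rw [h0, ← sq_abs (turnFst 1 0 y), h] at h1
  have h2 : |y| = 1 / 8 := by
    rw [← Real.sqrt_sq_eq_abs, show y ^ 2 = (1 / 8) ^ 2 by linarith, Real.sqrt_sq (by norm_num)]
  rw [abs_turnFst_zero, turnAngle_of_le h2.le] at h
  norm_num at h

/-! ### Points of the twisted half-plane -/

section Points

variable {n : ℕ}

/-- The bound on `x` leaves only the first two bead angles within reach, at `x = ∓1/8`; there a
positive `h` means lying outside the disc. -/
theorem mem_chart_none_of_strip (hn : 2 ≤ n) {p : Compl n} {x h c s : ℝ}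
    (hp : p.1 = tor (Real.pi / n + 8 * (Real.pi / n) * x) (1 / 4 + h) c s) (hcs : c ^ 2 + s ^ 2 = 1)
    (hρ : 0 ≤ 1 + (1 / 4 + h) * c) (hx : |x| ≤ 3 / 16) (hh : |x| = 1 / 8 → 0 < h) :
    p ∈ chart n none := by
  have hn0 : (0 : ℝ) < n := by exact_mod_cast (by omega : 0 < n)
  have hpi := Real.pi_pos
  have hd : 0 < Real.pi / n := by positivity
  have h2 : 2 * Real.pi / n = 2 * (Real.pi / n) := mul_div_assoc _ _ _
  obtain ⟨hx1, hx2⟩ := abs_le.1 hx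
  by_cases hx0 : |x| = 1 / 8
  · refine mem_chart_none_of_lt hp hρ ?_
    have : (1 + (1 / 4 + h) * c - 1) ^ 2 + ((1 / 4 + h) * s) ^ 2 = (1 / 4 + h) ^ 2 := by
      linear_combination (1 / 4 + h) ^ 2 * hcs
    rw [this]
    nlinarith [hh hx0]
  · refine mem_chart_none_of_ne hp hρ ?_
    rcases le_total x 0 with hs | hs
    · have e : ang n (⟨0, by omega⟩ : Fin n) = 0 := by simp [ang]
      rw [abs_of_nonpos hs] at hx0
      refine ang_ne_of_abs_lt (k := ⟨0, by omega⟩) ?_ fun he => hx0 ?_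
      · rw [e, h2, abs_lt]; constructor <;> nlinarith
      · rw [e] at he
        have : Real.pi / n * (1 + 8 * x) = 0 := by linarith
        linarith [(mul_eq_zero.1 this).resolve_left hd.ne']
    · have e : ang n (⟨1, by omega⟩ : Fin n) = 2 * (Real.pi / n) := by rw [ang_eq]; simp
      rw [abs_of_nonneg hs] at hx0
      refine ang_ne_of_abs_lt (k := ⟨1, by omega⟩) ?_ fun he => hx0 ?_
      · rw [e, h2, abs_lt]; constructor <;> nlinarith
      · rw [e] at he
        have : Real.pi / n * (8 * x - 1) = 0 := by linarith
        linarith [(mul_eq_zero.1 this).resolve_left hd.ne']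

/-- Parity: bead angles and full turns are even multiples of π/n. -/
theorem odd_ne (hn : 2 ≤ n) (k : ℕ) (j : Fin n) (m : ℤ) :
    (2 * k - 1) * (Real.pi / n) - ang n j ≠ 2 * Real.pi * m := by
  have hn0 : (0 : ℝ) < n := by exact_mod_cast (by omega : 0 < n)
  have hd : Real.pi / n ≠ 0 := (div_pos Real.pi_pos hn0).ne'
  intro h
  have hpi : Real.pi = n * (Real.pi / n) := by field_simp
  rw [ang_eq] at h
  have h1 : Real.pi / n * (2 * k - 1 - 2 * j - 2 * n * m) = 0 := by
    have : 2 * Real.pi * m = 2 * (n * (Real.pi / n)) * m := by rw [← hpi]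
    rw [this] at h
    linarith
  have h2 := (mul_eq_zero.1 h1).resolve_left hd
  have h3 : (2 * k - 1 - 2 * (j : ℕ) - 2 * n * m : ℤ) = 0 := by exact_mod_cast h2
  have h4 : (2 * (k - (j : ℕ) - n * m) : ℤ) = 1 := by linarith
  omega

/-- The straight path from the base point to the point of the core circle midway between two
beads. -/
def spoke (hn : 2 ≤ n) (k : ℕ) : Path (base n) (corePoint n ((2 * k - 1) * (Real.pi / n))) :=
  tether (odd_ne hn k) 0 rfl

/-- The arc of the core circle through the `k`-th bead. -/
def coreArc (n k : ℕ) : Path (corePoint n ((2 * k - 1) * (Real.pi / n)))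
    (corePoint n ((2 * (k + 1 : ℕ) - 1) * (Real.pi / n))) where
  toFun s := corePoint n ((2 * k - 1) * (Real.pi / n) + 2 * (Real.pi / n) * s)
  continuous_toFun := (continuous_corePoint n).comp (by fun_prop)
  source' := by simp
  target' := by congr 1; push_cast; simp; ring

/-- The meridian of the `k`-th bead that runs along the core circle. -/
def coreMeridian (hn : 2 ≤ n) (k : ℕ) : Path (base n) (base n) :=
  (spoke hn k).trans ((coreArc n k).trans (spoke hn (k + 1)).symm)

theorem transport_spoke (hn : 2 ≤ n) (k : ℕ) (g : FreeGroup (Fin n)) :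
    transport (.mk (spoke hn k)) g = g :=
  transport_of_mem_none _ (tether_mem (odd_ne hn k) 0 rfl) g

theorem transport_arc (hn : 2 ≤ n) (k : Fin n) {x y : Compl n} (γ : Path x y)
    (hγ : ∀ s : I, γ s = corePoint n ((2 * k - 1) * (Real.pi / n) + 2 * (Real.pi / n) * s))
    (g : FreeGroup (Fin n)) : transport (.mk γ) g = g * .of k := by
  have hn0 : (0 : ℝ) < n := by exact_mod_cast (by omega : 0 < n)
  have hd : 0 < Real.pi / n := div_pos Real.pi_pos hn0
  have hang : ∀ s : ℝ, (2 * k - 1) * (Real.pi / n) + 2 * (Real.pi / n) * s - ang n k =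
      Real.pi / n * (2 * s - 1) := fun s => by rw [ang_eq]; ring
  have hst : third ≤ twoThirds := by
    change (1 / 3 : ℝ) ≤ 2 / 3
    norm_num
  have hnone : ∀ s : I, (s : ℝ) ≠ 1 / 2 → γ s ∈ chart n none := fun s hs => by
    rw [hγ]
    refine core_mem_chart_none (k := k) ?_ ?_
    · rw [hang, abs_mul, abs_of_pos hd]
      have : |2 * (s : ℝ) - 1| ≤ 1 := abs_le.2 ⟨by linarith [s.2.1], by linarith [s.2.2]⟩
      nlinarith
    · rw [← sub_ne_zero, hang]
      exact mul_ne_zero hd.ne' fun h => hs (by linarith)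
  rw [transport_of_crossing hn γ hst k
    (ρ := fun _ => 1) (α := fun s => (2 * k - 1) * (Real.pi / n) + 2 * (Real.pi / n) * s)
    (z := fun _ => 0) (fun s => by rw [hγ]; rfl) (fun _ _ => one_pos) (fun s hs => ?_)
    (fun s _ _ => by norm_num) (fun s hs => hnone s ?_) (fun s hs => hnone s ?_), side_of_gt,
    side_of_lt]
  · simp
  · rw [← sub_pos, hang]
    exact mul_pos hd (by norm_num [twoThirds])
  · rw [← sub_neg, hang]
    exact mul_neg_of_pos_of_neg hd (by norm_num [third])
  · have h1 : (1 / 3 : ℝ) ≤ s := hs.1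
    have h2 : (s : ℝ) ≤ 2 / 3 := hs.2
    rw [hang, abs_lt]
    constructor <;> nlinarith
  · have : (s : ℝ) ≤ 1 / 3 := hs
    intro h; linarith
  · have : (2 / 3 : ℝ) ≤ s := hs
    intro h; linarith

/-- This representative runs along the core circle, which the half twist fixes pointwise, so only
the images of the spokes have to be computed. -/
theorem wordClass_of_eq (hn : 2 ≤ n) (k : Fin n) :
    (wordClass n (.of k)).unop = .mk (coreMeridian hn k) := by
  refine (eq_wordClass_of_transport hn ?_).symm
  rw [coreMeridian, Path.Homotopic.Quotient.mk_trans, Path.Homotopic.Quotient.mk_trans,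
    Path.Homotopic.Quotient.mk_symm, transport_trans, transport_trans, transport_spoke,
    transport_arc hn k _ (fun _ => rfl), one_mul]
  exact transport_symm _ (transport_spoke hn _ _)

/-! ### The twisted spokes -/

theorem cos_two_mul_le (hn : 2 ≤ n) {k : ℕ} (hk : k ≠ 1) (hkn : k ≤ n) :
    Real.cos (2 * (k - 1) * (Real.pi / n)) ≤ Real.cos (2 * (Real.pi / n)) := by
  have hn0 : (0 : ℝ) < n := by exact_mod_cast (by omega : 0 < n)
  have hd : 0 < Real.pi / n := div_pos Real.pi_pos hn0
  have hpi : Real.pi = n * (Real.pi / n) := by field_simp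
  rcases Nat.lt_or_gt_of_ne hk with h | h
  · obtain rfl : k = 0 := by omega
    rw [← Real.cos_neg]
    norm_num
  · have h1 : (2 : ℝ) ≤ k := by exact_mod_cast h
    have h2 : (k : ℝ) ≤ n := by exact_mod_cast hkn
    rcases le_total (2 * ((k : ℝ) - 1) * (Real.pi / n)) Real.pi with h3 | h3
    · exact Real.cos_le_cos_of_nonneg_of_le_pi (by positivity) h3 (by nlinarith)
    · rw [← Real.cos_two_pi_sub (2 * ((k : ℝ) - 1) * (Real.pi / n))]
      exact Real.cos_le_cos_of_nonneg_of_le_pi (by positivity) (by linarith) (by nlinarith)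

/-- A spoke other than the middle one makes a relative angle of at least 2d, that is 1/4 in the
strip, beyond the support radius 3/16. -/
theorem twist_spoke (hn : 2 ≤ n) {k : ℕ} (hk : k ≠ 1) (hkn : k ≤ n) (s : I) :
    twist (Real.pi / n) 1 (spoke hn k s).1 = (spoke hn k s).1 := by
  have hn0 : (0 : ℝ) < n := by exact_mod_cast (by omega : 0 < n)
  have hd : 0 < Real.pi / n := div_pos Real.pi_pos hn0
  have hd' := two_pi_div_le hn
  change twist _ 1 (cyl s ((2 * k - 1) * (Real.pi / n)) (2 + s * (0 - 2))) = cyl s _ _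
  by_cases hs : (s : ℝ) = 0
  · refine twist_of_tubeRadius hd 1 ?_
    rw [tubeRadius, hyp_cyl s.2.1, cyl_two, hs]
    have : (2 : ℝ) ≤ √((0 - 1) ^ 2 + (2 + 0 * (0 - 2)) ^ 2) :=
      Real.le_sqrt_of_sq_le (by norm_num)
    generalize √((0 - 1) ^ 2 + (2 + 0 * (0 - 2)) ^ 2 : ℝ) = r at this ⊢
    nlinarith
  · have hs0 : 0 < (s : ℝ) := lt_of_le_of_ne s.2.1 (Ne.symm hs)
    refine twist_of_ge hd 1 (le_add_of_le_of_nonneg ?_ (sq_nonneg _))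
    set A := relAngle (Real.pi / n) (cyl s ((2 * k - 1) * (Real.pi / n)) (2 + s * (0 - 2)))
    have h1 : (s : ℝ) * Real.cos A = s * Real.cos (2 * (k - 1) * (Real.pi / n)) := by
      have := hyp_mul_cos (Real.pi / n) (cyl s ((2 * k - 1) * (Real.pi / n)) (2 + s * (0 - 2)))
      rw [hyp_cyl s.2.1, rad_cyl] at this
      rw [this]
      congr 2; ring
    have h2 : Real.cos A ≤ Real.cos (2 * (Real.pi / n)) := by
      rw [mul_left_cancel₀ hs h1]
      exact cos_two_mul_le hn hk hkn
    have h3 : 2 * (Real.pi / n) ≤ |A| := by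
      by_contra hcon
      push Not at hcon
      have := Real.cos_lt_cos_of_nonneg_of_le_pi (abs_nonneg A) (by linarith) hcon
      rw [Real.cos_abs] at this
      linarith
    rw [div_pow, le_div_iff₀ (by positivity), ← sq_abs A]
    nlinarith

/-- In its half-plane the spoke is the segment from (0, 2) to (1, 0), of length √5 and direction
(−1, 2)/√5 as seen from the core circle. In the strip it is the line over `a = 0`. -/
theorem twist_spoke_one (hn : 2 ≤ n) (s : I) : twist (Real.pi / n) 1 (spoke hn 1 s).1 =
    tor (Real.pi / n + 8 * (Real.pi / n) * turnFst 1 0 (√5 * (1 - s) - 1 / 4))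
      (1 / 4 + turnSnd 1 0 (√5 * (1 - s) - 1 / 4)) (-(1 / √5)) (2 / √5) := by
  have hn0 : (0 : ℝ) < n := by exact_mod_cast (by omega : 0 < n)
  have hpi := Real.pi_pos
  have hd : 0 < Real.pi / n := div_pos Real.pi_pos hn0
  have h5 : 0 < √(5 : ℝ) := by positivity
  have h5' : √(5 : ℝ) ^ 2 = 5 := Real.sq_sqrt (by norm_num)
  have hs := s.2.2
  have hs' := s.2.1
  have e : (spoke hn 1 s).1 =
      tor (Real.pi / n + 0) (√5 * (1 - s)) (-(1 / √5)) (2 / √5) := by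
    change cyl s ((2 * (1 : ℕ) - 1) * (Real.pi / n)) (2 + s * (0 - 2)) = _
    unfold tor
    congr 1
    · field_simp; ring
    · push_cast; ring
    · field_simp; ring
  rw [e, twist_tor hd 1 (by nlinarith) ?_ ?_ (by linarith) (by linarith), zero_div]
  · have : √5 * (1 - s) * -(1 / √5) = -(1 - (s : ℝ)) := by field_simp
    rw [this]; linarith
  · field_simp; rw [h5']; norm_num

end Points

end Necklace

end

/-! ### The automorphism induced by the half twist -/

noncomputable section

namespace Necklace

open Set Topology unitInterval

section Spoke

variable {n : ℕ}

set_option maxHeartbeats 800000 in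
/-- The transport along the image of the spoke between the first two beads. -/
theorem transport_twisted_spoke (hn : 2 ≤ n) {x y : Compl n} (γ : Path x y)
    (hγ : ∀ s, (γ s).1 = twist (Real.pi / n) 1 (spoke hn 1 s).1) (g : FreeGroup (Fin n)) :
    transport (.mk γ) g = g * .of ⟨0, by omega⟩ * (.of ⟨1, hn⟩)⁻¹ := by
  have hn0 : (0 : ℝ) < n := by exact_mod_cast (by omega : 0 < n)
  have hd : 0 < Real.pi / n := div_pos Real.pi_pos hn0
  set d := Real.pi / n with hdef
  have h5' : √(5 : ℝ) ^ 2 = 5 := Real.sq_sqrt (by norm_num)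
  have h5 : 1 < √(5 : ℝ) := by rw [Real.lt_sqrt zero_le_one]; norm_num
  have hcs : (-(1 / √(5 : ℝ))) ^ 2 + (2 / √5) ^ 2 = 1 := by field_simp; rw [h5']; norm_num
  have hc := abs_le_one_of_sq hcs
  have hc0 : -(1 / √(5 : ℝ)) ≤ 0 := by rw [neg_nonpos]; positivity
  -- the signed distance to the circle through the beads, and the times at which it is taken
  let u : I → ℝ := fun s => √5 * (1 - s) - 1 / 4
  have hu : ∀ s : I, -(1 / 4) ≤ u s := fun s => by
    have : 0 ≤ √5 * (1 - (s : ℝ)) := mul_nonneg (by positivity) (by linarith [s.2.2])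
    change _ ≤ √5 * (1 - (s : ℝ)) - 1 / 4
    linarith
  let X : I → ℝ := fun s => turnFst 1 0 (u s)
  let H : I → ℝ := fun s => turnSnd 1 0 (u s)
  have hγ' : ∀ s, (γ s).1 = tor (d + 8 * d * X s) (1 / 4 + H s) (-(1 / √5)) (2 / √5) := fun s =>
    (hγ s).trans (twist_spoke_one hn s)
  have hXH : ∀ s, X s ^ 2 + H s ^ 2 = u s ^ 2 := fun s => by
    rw [turn_sq, zero_pow two_ne_zero, zero_add]
  have hρ : ∀ s, |u s| < 3 / 16 → 0 < 1 + (1 / 4 + H s) * -(1 / √5) := fun s h => by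
    have h1 : H s ^ 2 ≤ (3 / 16) ^ 2 := by
      have := hXH s
      rw [← sq_abs (u s)] at this
      nlinarith [sq_nonneg (X s), abs_nonneg (u s)]
    have h2 := abs_le_of_sq_le_sq' h1 (by norm_num)
    nlinarith
  have hρ0 : ∀ s, 0 ≤ 1 + (1 / 4 + H s) * -(1 / √5) := fun s => by
    rcases lt_or_ge |u s| (3 / 16) with h | h
    · exact (hρ s h).le
    · have : H s = u s := turnSnd_zero_of_ge h
      have e : 1 + (1 / 4 + u s) * -(1 / √5) = s := by
        change 1 + (1 / 4 + (√5 * (1 - s) - 1 / 4)) * -(1 / √5) = (s : ℝ)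
        field_simp; ring
      rw [this, e]
      exact s.2.1
  have hnone : ∀ s, (|X s| = 1 / 8 → 0 ≤ H s) → γ s ∈ chart n none := fun s h =>
    mem_chart_none_of_strip hn (hγ' s) hcs (hρ0 s) (abs_turnFst_zero_le _) fun hx =>
      lt_of_le_of_ne (h hx) (turnSnd_zero_ne hx).symm
  let τ : ℝ → I := fun y => projIcc 0 1 zero_le_one (1 - (y + 1 / 4) / √5)
  have huτ : ∀ y : ℝ, -(1 / 4) ≤ y → y ≤ 3 / 4 → u (τ y) = y := fun y h h' => by
    have h1 : (y + 1 / 4) / √5 ≤ 1 := (div_le_one (by positivity)).2 (by linarith)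
    have h2 : 0 ≤ (y + 1 / 4) / √5 := div_nonneg (by linarith) (by positivity)
    have e : (τ y : ℝ) = 1 - (y + 1 / 4) / √5 := by
      change (projIcc 0 1 zero_le_one (1 - (y + 1 / 4) / √5) : I).1 = _
      rw [projIcc_of_mem zero_le_one ⟨sub_nonneg.2 h1, sub_le_self _ h2⟩]
    change √5 * (1 - (τ y : ℝ)) - 1 / 4 = y
    rw [e]
    field_simp; ring
  have hanti : ∀ {s t : I}, s ≤ t → u t ≤ u s := fun {s t} h => by
    have h : (s : ℝ) ≤ t := h
    change √5 * (1 - (t : ℝ)) - 1 / 4 ≤ √5 * (1 - (s : ℝ)) - 1 / 4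
    nlinarith
  have hle : ∀ {y z : ℝ}, z ≤ y → τ y ≤ τ z := fun {y z} hyz =>
    monotone_projIcc _ (by gcongr)
  -- At `u = ±5/32` the turn is by π/2 and the twisted line crosses the height of the beads on their
  -- far sides; at 13/96 and −17/96 it is back between them. So the disc crossings fall between `t1`
  -- and `t2`, and between `t4` and `t5`.
  let t1 := τ (5 / 32)
  let t2 := τ (13 / 96)
  let t3 := τ 0
  let t4 := τ (-(5 / 32))
  let t5 := τ (-(17 / 96))
  have e1 : u t1 = 5 / 32 := huτ _ (by norm_num) (by norm_num)
  have e2 : u t2 = 13 / 96 := huτ _ (by norm_num) (by norm_num)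
  have e3 : u t3 = 0 := huτ _ (by norm_num) (by norm_num)
  have e4 : u t4 = -(5 / 32) := huτ _ (by norm_num) (by norm_num)
  have e5 : u t5 = -(17 / 96) := huτ _ (by norm_num) (by norm_num)
  have h12 : t1 ≤ t2 := hle (by norm_num)
  have h23 : t2 ≤ t3 := hle (by norm_num)
  have h34 : t3 ≤ t4 := hle (by norm_num)
  have h45 : t4 ≤ t5 := hle (by norm_num)
  have hdisc : ∀ r, |u r| < 3 / 16 → H r ≤ 0 → |X r| = 1 / 8 →
      (1 + (1 / 4 + H r) * -(1 / √5) - 1) ^ 2 + ((1 / 4 + H r) * (2 / √5)) ^ 2 < 1 / 16 := by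
    intro r hr h0 hx
    have e : (1 + (1 / 4 + H r) * -(1 / √5) - 1) ^ 2 + ((1 / 4 + H r) * (2 / √5)) ^ 2 =
        (1 / 4 + H r) ^ 2 := by linear_combination (1 / 4 + H r) ^ 2 * hcs
    rw [e]
    have h1 : H r < 0 := lt_of_le_of_ne h0 (turnSnd_zero_ne hx)
    have h2 : H r ^ 2 ≤ (3 / 16) ^ 2 := by
      have := hXH r
      rw [← sq_abs (u r)] at this
      nlinarith [sq_nonneg (X r), abs_nonneg (u r)]
    have h3 := abs_le_of_sq_le_sq' h2 (by norm_num)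
    nlinarith
  have hang0 : ang n (⟨0, by omega⟩ : Fin n) = 0 := by simp [ang]
  have hang1 : ang n (⟨1, hn⟩ : Fin n) = 2 * d := by rw [ang_eq]; simp [hdef]
  have hXabs : ∀ s, |X s| = |u s| * Real.sin (turnAngle |u s|) := fun s => abs_turnFst_zero _
  have hX : ∀ s, X s = -(u s * Real.sin (turnAngle |u s|)) := fun s => turnFst_zero _
  have hH : ∀ s, H s = u s * Real.cos (turnAngle |u s|) := fun s => turnSnd_zero _
  -- the first crossing
  have A : transport (.mk (γ.subpath 0 t3)) g = g * .of ⟨0, by omega⟩ := by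
    have hr : ∀ r ∈ Icc t1 t2, 0 ≤ u r ∧ |u r| < 3 / 16 ∧ H r ≤ 0 ∧ X r < 0 ∧ -(1 / 4) < X r := by
      intro r hr
      have h1 := hanti hr.2
      have h2 := hanti hr.1
      rw [e2] at h1
      rw [e1] at h2
      have e : |u r| = u r := abs_of_nonneg (by linarith)
      have hs := sin_turnAngle_pos (x := u r) (by linarith) (by linarith)
      have hc := cos_turnAngle_nonpos h2
      have hs' := Real.sin_le_one (turnAngle (u r))
      refine ⟨by linarith, by linarith, ?_, ?_, ?_⟩
      · rw [hH, e]; exact mul_nonpos_of_nonneg_of_nonpos (by linarith) hc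
      · rw [hX, e]; exact neg_neg_of_pos (mul_pos (by linarith) hs)
      · have := mul_le_mul_of_nonneg_left hs' (show 0 ≤ u r by linarith)
        rw [hX, e]; linarith
    rw [transport_subpath_of_crossing hn γ (nonneg t1) h12 h23 ⟨0, by omega⟩
      (ρ := fun s => 1 + (1 / 4 + H s) * -(1 / √5)) (α := fun s => d + 8 * d * X s)
      (z := fun s => (1 / 4 + H s) * (2 / √5)) hγ' (fun r h => hρ r (hr r h).2.1) (fun r h => ?_)
      (fun r h he => hdisc r (hr r h).2.1 (hr r h).2.2.1 ?_) (fun r h => hnone r fun _ => ?_)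
      (fun r h => hnone r fun hx => ?_), side_of_gt, side_of_lt]
    · simp
    · rw [hang0]
      have h1 : |X t2| < 1 / 8 := abs_turnFst_zero_lt (.inl (by
        rw [e2, abs_of_nonneg (by norm_num)]))
      have := mul_pos hd (sub_pos.2 (abs_lt.1 h1).1)
      linarith
    · rw [hang0]
      have : X t1 = -(5 / 32) := by
        rw [hX, e1, abs_of_nonneg (by norm_num), turnAngle_half, Real.sin_pi_div_two, mul_one]
      rw [this]
      linarith
    · obtain ⟨-, -, -, h1, h2⟩ := hr r h
      have h3 := mul_neg_of_pos_of_neg hd h1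
      have h4 := mul_pos hd (sub_pos.2 h2)
      rw [hang0, ← hdef, abs_lt]
      constructor <;> linarith
    · rw [hang0] at he
      have : d * (1 + 8 * X r) = 0 := by linarith
      have := (mul_eq_zero.1 this).resolve_left hd.ne'
      rw [abs_of_neg (hr r h).2.2.2.1]
      linarith
    · have h1 := hanti h.2
      rw [e1] at h1
      rw [hH, abs_of_nonneg (by linarith)]
      exact mul_nonneg (by linarith) (cos_turnAngle_nonneg h1)
    · have h1 := hanti h.2
      have h2 := hanti h.1
      rw [e3] at h1
      rw [e2] at h2
      have : |X r| < 1 / 8 := abs_turnFst_zero_lt (.inl (by rwa [abs_of_nonneg h1]))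
      linarith
  -- The line passes the second bead outwards above its disc and comes back through the disc,
  -- against the direction of the core circle.
  have B : ∀ g, transport (.mk (γ.subpath t3 1)) g = g * (.of ⟨1, hn⟩)⁻¹ := fun g => by
    have hr : ∀ r ∈ Icc t4 t5, |u r| < 3 / 16 ∧ H r ≤ 0 ∧ 0 < X r ∧ X r < 1 / 4 := by
      intro r hr
      have h1 := hanti hr.2
      have h2 := hanti hr.1
      rw [e5] at h1
      rw [e4] at h2
      have e : |u r| = -u r := abs_of_nonpos (by linarith)
      have hs := sin_turnAngle_pos (x := -u r) (by linarith) (by linarith)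
      have hc := cos_turnAngle_nonneg (x := -u r) (by linarith)
      have hs' := Real.sin_le_one (turnAngle (-u r))
      refine ⟨by linarith, ?_, ?_, ?_⟩
      · rw [hH, e]; exact mul_nonpos_of_nonpos_of_nonneg (by linarith) hc
      · rw [hX, e]; exact neg_pos.2 (mul_neg_of_neg_of_pos (by linarith) hs)
      · have := mul_le_mul_of_nonpos_left hs' (show u r ≤ 0 by linarith)
        rw [hX, e]; linarith
    rw [transport_subpath_of_crossing hn γ h34 h45 (le_one t5) ⟨1, hn⟩
      (ρ := fun s => 1 + (1 / 4 + H s) * -(1 / √5)) (α := fun s => d + 8 * d * X s)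
      (z := fun s => (1 / 4 + H s) * (2 / √5)) hγ' (fun r h => hρ r (hr r h).1) (fun r h => ?_)
      (fun r h he => hdisc r (hr r h).1 (hr r h).2.1 ?_) (fun r h => hnone r fun hx => ?_)
      (fun r h => hnone r fun hx => ?_), side_of_lt, side_of_gt]
    · simp
    · rw [hang1]
      have h1 : |X t5| < 1 / 8 := abs_turnFst_zero_lt (.inr (by
        rw [e5, abs_neg, abs_of_nonneg (by norm_num)]))
      have := mul_pos hd (sub_pos.2 (abs_lt.1 h1).2)
      linarith
    · rw [hang1]
      have : X t4 = 5 / 32 := by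
        rw [hX, e4, abs_neg, abs_of_nonneg (by norm_num), turnAngle_half, Real.sin_pi_div_two]
        norm_num
      rw [this]
      linarith
    · obtain ⟨-, -, h1, h2⟩ := hr r h
      have h3 := mul_pos hd h1
      have h4 := mul_pos hd (sub_pos.2 h2)
      rw [hang1, ← hdef, abs_lt]
      constructor <;> linarith
    · rw [hang1] at he
      have : d * (8 * X r - 1) = 0 := by linarith
      have := (mul_eq_zero.1 this).resolve_left hd.ne'
      rw [abs_of_pos (hr r h).2.2.1]
      linarith
    · have h1 := hanti h.2
      have h2 := hanti h.1
      rw [e4] at h1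
      rw [e3] at h2
      have e : |u r| = -u r := abs_of_nonpos h2
      rw [hH, e]
      exact mul_nonneg_of_nonpos_of_nonpos h2 (cos_turnAngle_nonpos (by linarith))
    · have h1 := hanti h.1
      rw [e5] at h1
      have : |X r| < 1 / 8 := abs_turnFst_zero_lt (.inr (by
        rw [abs_of_nonpos (by linarith)]; linarith))
      linarith
  rw [← transport_subpath_zero_one, transport_subpath_comp γ 0 t3 1, A, B]

end Spoke

/-- A motion whose end is the half twist induces the twist automorphism. -/
theorem Motion.isTwist_aut {n : ℕ} (hn : 2 ≤ n) {Γ : Path (std n) (std n)} (F : Motion Γ)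
    (hF : ∀ p, F.f 1 p = twist (Real.pi / n) 1 p) : IsTwist (F.aut hn) 0 (by omega) := by
  have hn0 : (0 : ℝ) < n := by exact_mod_cast (by omega : 0 < n)
  have hd : 0 < Real.pi / n := div_pos Real.pi_pos hn0
  have hE : ∀ p : Compl n, (F.endMap p).1 = twist (Real.pi / n) 1 p.1 := fun p => hF p.1
  have hC : ∀ β, F.endMap (corePoint n β) = corePoint n β := fun β =>
    Subtype.ext ((hE _).trans (twist_core hd 1 β))
  -- the automorphism on a generator, in terms of the transports along the images of the spokes
  have key : ∀ (k : Fin n) (a b : FreeGroup (Fin n)),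
      transport (.mk ((spoke hn k).map F.endMap.continuous)) 1 = a →
      transport (.mk ((spoke hn (k + 1)).map F.endMap.continuous)) b = a * .of k →
      F.aut hn (.of k) = b := fun k a b ha hb => by
    rw [F.aut_apply, wordClass_of_eq hn, F.induced_mk, Path.Homotopic.Quotient.mk_cast,
      transport_cast, coreMeridian, Path.map_trans, Path.map_trans, ← Path.map_symm,
      Path.Homotopic.Quotient.mk_trans, Path.Homotopic.Quotient.mk_trans,
      Path.Homotopic.Quotient.mk_symm, transport_trans, transport_trans, ha,
      transport_arc hn k _ fun s => hC _]
    exact transport_symm _ hb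
  have hV : ∀ k : ℕ, k ≠ 1 → k ≤ n → ∀ g : FreeGroup (Fin n),
      transport (.mk ((spoke hn k).map F.endMap.continuous)) g = g := fun k hk hkn g => by
    refine transport_of_mem_none _ (fun s => ?_) g
    have e : F.endMap (spoke hn k s) = spoke hn k s :=
      Subtype.ext ((hE _).trans (twist_spoke hn hk hkn s))
    change F.endMap (spoke hn k s) ∈ _
    rw [e]
    exact tether_mem (odd_ne hn k) 0 rfl s
  have hV1 : ∀ g : FreeGroup (Fin n), transport (.mk ((spoke hn 1).map F.endMap.continuous)) g =
      g * .of ⟨0, by omega⟩ * (.of ⟨1, hn⟩)⁻¹ := fun g =>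
    transport_twisted_spoke hn _ (fun s => hE _) g
  refine ⟨?_, ?_, fun j hj hj' => ?_⟩
  · refine key ⟨0, by omega⟩ 1 _ (hV 0 (by omega) (by omega) 1) ?_
    refine (hV1 _).trans ?_
    simp
  · refine key ⟨1, hn⟩ _ _ (hV1 1) ?_
    refine (hV 2 (by omega) hn _).trans ?_
    simp
  · refine key j 1 _ (hV j ?_ j.isLt.le 1) ?_
    · simpa using hj'
    · refine (hV (j + 1) ?_ j.isLt _).trans (by simp)
      simpa using hj

end Necklace

end

/-! ### Conclusion -/

theorem theorem4p3 (n : ℕ) (hn : 2 ≤ n) :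
    Function.Bijective (Necklace.wordClass n) ∧
    ∀ φ : MulAut (FreeGroup (Fin n)),
      (∃ g : FundamentalGroup (Necklace.Conf n) (Necklace.std n), Necklace.Induces g φ) ↔
        (∃ (π : Equiv.Perm (Fin n)) (w : Fin n → FreeGroup (Fin n)),
          ∀ i, φ (FreeGroup.of i) = w i * FreeGroup.of (π i) * (w i)⁻¹) ∧
        ∃ w : FreeGroup (Fin n),
          φ (List.ofFn fun i : Fin n => FreeGroup.of i).prod =
            w * (List.ofFn fun i : Fin n => FreeGroup.of i).prod * w⁻¹ := by
  refine ⟨Necklace.wordClass_bijective hn, fun φ => ⟨fun ⟨g, h⟩ => h.exists_conj hn,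
    fun ⟨h1, h2⟩ => ?_⟩⟩
  obtain ⟨τ, hτ, hτi⟩ := Necklace.exists_rotation hn
  obtain ⟨Γ, F, hF⟩ := Necklace.exists_twist_motion hn
  obtain ⟨m, rfl⟩ : ∃ m, n = m + 1 := ⟨n - 1, by omega⟩
  have hτ1 : ∀ (k : ℕ) (hk : k + 1 < m + 1), τ (FreeGroup.of ⟨k, by omega⟩) =
      FreeGroup.of ⟨k + 1, hk⟩ := fun k hk => by
    rw [hτi, finRotate_of_lt (by omega)]
  have hτ2 : τ (FreeGroup.of ⟨m + 1 - 1, by omega⟩) = FreeGroup.of ⟨0, by omega⟩ := by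
    rw [hτi]
    exact congrArg _ finRotate_last
  exact Necklace.mem_of_conj_boundary hn hτ (F.aut_mem hn) hτ1 hτ2 (F.isTwist_aut hn hF) h1 h2
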